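/- Let $n\ge 1$, $0<T<\infty$ and $p,q\in(2,\infty)$. Let $m:\mathbb R^n\setminus\{0\}\to\mathbb C^n$ be a symbol of order zero, i.e. $m$ is smooth and for every $k\ge 0$ there is $C_k$ with $|D^k m(\xi)|\le C_k|\xi|^{-k}$ for all $\xi\neq 0$ (for instance, $m$ smooth away from the origin and homogeneous of degree $0$), and let $T_m$ be the corresponding Fourier multiplier operator on $L^2(\mathbb R^n)$, $\widehat{T_m f}=m\hat f$. Consider the inviscid active scalar equation $$\partial_t\theta+(u\cdot\nabla)\theta=0,\qquad \operatorname{div}u=0,\qquad u=T_m\theta \qquad\text{on }(0,T)\times\mathbb R^n,\qquad \theta(0)=\theta_0,$$ with $\theta_0\in L^2(\mathbb R^n)$. A weak solution is a pair $(\theta,u)$ of measurable functions, $\theta$ real-valued and $u$ with values in $\mathbb R^n$, both in $L^2_{loc}([0,T]\times\mathbb R^n)$, such that for a.e. $t\in(0,T)$ one has $\theta(t)\in L^2$, $u(t)=T_m\theta(t)$ and $\operatorname{div}u(t)=0$ in the sense of distributions, and such that for every $\varphi\in C_c^\infty([0,T)\times\mathbb R^n)$ $$\int_0^T\!\!\int_{\mathbb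 R^n}\theta\,(\partial_t\varphi+u\cdot\nabla\varphi)\,dx\,dt+\int_{\mathbb R^n}\theta_0\,\varphi(0,\cdot)\,dx=0 .$$ $BMO$ denotes the space of locally integrable functions $f$ on $\mathbb R^n$ (here with values in $\mathbb R^n$) for which $M^\# f(x)=\sup_{Q\ni x}|Q|^{-1}\int_Q|f-f_Q|$ (supremum over cubes $Q$ containing $x$, $f_Q$ the average of $f$ on $Q$) is bounded, with $\|f\|_{BMO}=\|M^\# f\|_{L^\infty}$. **Claim.** There is at most one weak solution $(\theta,u)$ with initial datum $\theta_0$ such that $$\theta\in L^\infty((0,T),L^2(\mathbb R^n))\cap L^q((0,T),L^p(\mathbb R^n)),$$ and such that, for a.e. $t\in(0,T)$, the distributional spatial gradient is $\nabla\theta(t)=g(t)+b(t)$, where $g\in L^1((0,T),L^\infty(\mathbb R^n))$ and $b\in L^1((0,T),BMO)$, and $b(t)$ vanishes outside a set of finite measure for a.e. $t\in(0,T)$. That is, if $(\theta_1,u_1)$ and $(\theta_2,u_2)$ are two weak solutions with the same datum $\theta_0$ and both have these properties (each with its own $g$ and $b$), then $\theta_1=\theta_2$ and $u_1=u_2$ almost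 everywhere on $(0,T)\times\mathbb R^n$. -/

import Mathlib

open MeasureTheory Set
open scoped ENNReal FourierTransform

noncomputable section

namespace ActiveScalar

/-- Points of `ℝⁿ`, with the Euclidean norm and Lebesgue measure `volume`. -/
abbrev Space (n : ℕ) : Type := EuclideanSpace ℝ (Fin n)

/-! ### Bounded mean oscillation -/

/-- The closed axis-parallel cube with centre `c` and side length `2 * r`. -/
def cube {n : ℕ} (c : Space n) (r : ℝ) : Set (Space n) :=
  {x | ∀ i, |x i - c i| ≤ r}

/-- The mean oscillation `|Q|⁻¹ ∫_Q |f - f_Q|` of `f` over the set `Q`, where `f_Q` is the average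
of `f` over `Q`. -/
def meanOscillation {n : ℕ} {F : Type*} [NormedAddCommGroup F] [NormedSpace ℝ F]
    (f : Space n → F) (Q : Set (Space n)) : ℝ≥0∞ :=
  (volume Q)⁻¹ * ∫⁻ y in Q, ‖f y - ⨍ z in Q, f z‖ₑ

/-- The sharp maximal function: the supremum of the mean oscillations of `f` over all
nondegenerate cubes that contain `x`. -/
def sharpMaximal {n : ℕ} {F : Type*} [NormedAddCommGroup F] [NormedSpace ℝ F]
    (f : Space n → F) (x : Space n) : ℝ≥0∞ :=
  ⨆ (c : Space n) (r : ℝ) (_ : 0 < r) (_ : x ∈ cube c r), meanOscillation f (cube c r)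

/-- The `BMO` norm: the `L^∞` norm of the sharp maximal function. -/
def bmoNorm {n : ℕ} {F : Type*} [NormedAddCommGroup F] [NormedSpace ℝ F]
    (f : Space n → F) : ℝ≥0∞ :=
  eLpNorm (sharpMaximal f) ∞ volume

/-- The space `BMO`: locally integrable functions with bounded sharp maximal function. -/
def MemBMO {n : ℕ} {F : Type*} [NormedAddCommGroup F] [NormedSpace ℝ F]
    (f : Space n → F) : Prop :=
  LocallyIntegrable f volume ∧ bmoNorm f < ∞

/-! ### Fourier multipliers of order zero -/

/-- A (vector-valued) symbol of order zero: smooth away from the origin, with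
`|∂^k m(ξ)| ≤ C_k |ξ|^{-k}` for every order `k`. Every symbol that is smooth away from the origin
and homogeneous of degree zero is of this kind. The value at the origin is irrelevant. -/
structure IsOrderZeroSymbol {n : ℕ} (m : Space n → EuclideanSpace ℂ (Fin n)) : Prop where
  smooth : ContDiffOn ℝ (⊤ : ℕ∞) m {0}ᶜ
  bound : ∀ k : ℕ, ∃ C : ℝ, ∀ ξ : Space n, ξ ≠ 0 →
    ‖iteratedFDeriv ℝ k m ξ‖ * ‖ξ‖ ^ k ≤ C

/-- `v = T f`, where `T` is the Fourier multiplier operator with symbol `m`: both `f` and `v` are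
square integrable and `v̂ᵢ(ξ) = mᵢ(ξ) f̂(ξ)` for every component `i` and almost every `ξ`, with the
Fourier transform on `L²`. -/
def IsMultiplierImage {n : ℕ} (m : Space n → EuclideanSpace ℂ (Fin n))
    (f : Space n → ℝ) (v : Space n → Space n) : Prop :=
  ∃ (hf : MemLp (fun x => (f x : ℂ)) 2 volume)
    (hv : ∀ i, MemLp (fun x => (v x i : ℂ)) 2 volume),
    ∀ i, (𝓕 (hv i).toLp : Lp ℂ 2 (volume : Measure (Space n))) =ᵐ[volume]
      fun ξ => m ξ i * (𝓕 hf.toLp : Lp ℂ 2 (volume : Measure (Space n))) ξ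

/-! ### Weak derivatives -/

/-- `G` is the weak (distributional) gradient of `f` on `ℝⁿ`. -/
def HasWeakGradient {n : ℕ} (f : Space n → ℝ) (G : Space n → Space n) : Prop :=
  LocallyIntegrable f volume ∧ LocallyIntegrable G volume ∧
    ∀ ψ : Space n → ℝ, ContDiff ℝ (⊤ : ℕ∞) ψ → HasCompactSupport ψ →
      ∫ x, f x • gradient ψ x = -∫ x, ψ x • G x

/-- `v` is weakly divergence free on `ℝⁿ`. -/
def WeaklyDivFree {n : ℕ} (v : Space n → Space n) : Prop :=
  LocallyIntegrable v volume ∧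
    ∀ ψ : Space n → ℝ, ContDiff ℝ (⊤ : ℕ∞) ψ → HasCompactSupport ψ →
      ∫ x, inner ℝ (v x) (gradient ψ x) = 0

/-! ### Functions on space-time -/

/-- Lebesgue measure on `(0,T) × ℝⁿ`. -/
def slab (n : ℕ) (T : ℝ) : Measure (ℝ × Space n) :=
  (volume.restrict (Ioo 0 T)).prod volume

/-- The space `L^q((0,T), L^p(ℝⁿ))`, for functions that are measurable on space-time. -/
def MemMixedLp {n : ℕ} {F : Type*} [NormedAddCommGroup F] (T : ℝ) (q p : ℝ≥0∞)
    (f : ℝ → Space n → F) : Prop :=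
  AEStronglyMeasurable (Function.uncurry f) (slab n T) ∧
    eLpNorm (fun t => eLpNorm (f t) p volume) q (volume.restrict (Ioo 0 T)) < ∞

/-- The space `L^q((0,T), BMO)`, for functions that are measurable on space-time. -/
def MemLpBMO {n : ℕ} {F : Type*} [NormedAddCommGroup F] [NormedSpace ℝ F] (T : ℝ) (q : ℝ≥0∞)
    (f : ℝ → Space n → F) : Prop :=
  AEStronglyMeasurable (Function.uncurry f) (slab n T) ∧
    (∀ᵐ t ∂(volume.restrict (Ioo 0 T)), MemBMO (f t)) ∧
    eLpNorm (fun t => bmoNorm (f t)) q (volume.restrict (Ioo 0 T)) < ∞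

/-- The pair `(θ, u)` is a weak solution on `(0,T) × ℝⁿ` of
`∂ₜθ + (u · ∇)θ = 0`, `div u = 0`, `u = T[θ]`, `θ(0) = θ₀`,
where `T[·]` is the Fourier multiplier operator with symbol `m`. The equation and the initial
condition are tested against smooth compactly supported functions on `[0,T) × ℝⁿ`. -/
structure IsWeakSolution {n : ℕ} (m : Space n → EuclideanSpace ℂ (Fin n)) (T : ℝ)
    (θ₀ : Space n → ℝ) (θ : ℝ → Space n → ℝ) (u : ℝ → Space n → Space n) : Prop where
  aesm_scalar : AEStronglyMeasurable (Function.uncurry θ) (slab n T)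
  aesm_velocity : AEStronglyMeasurable (Function.uncurry u) (slab n T)
  scalar_L2loc : ∀ K : Set (ℝ × Space n), IsCompact K →
    MemLp (Function.uncurry θ) 2 ((slab n T).restrict K)
  velocity_L2loc : ∀ K : Set (ℝ × Space n), IsCompact K →
    MemLp (Function.uncurry u) 2 ((slab n T).restrict K)
  velocity_eq : ∀ᵐ t ∂(volume.restrict (Ioo 0 T)), IsMultiplierImage m (θ t) (u t)
  div_free : ∀ᵐ t ∂(volume.restrict (Ioo 0 T)), WeaklyDivFree (u t)
  equation : ∀ φ : ℝ × Space n → ℝ, ContDiff ℝ (⊤ : ℕ∞) φ → HasCompactSupport φ →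
    tsupport φ ⊆ Iio T ×ˢ univ →
    (∫ z, θ z.1 z.2 * (deriv (fun s => φ (s, z.2)) z.1
        + inner ℝ (u z.1 z.2) (gradient (fun y => φ (z.1, y)) z.2)) ∂(slab n T))
      + ∫ x, θ₀ x * φ (0, x) = 0

/-- The class in which uniqueness is claimed: `θ ∈ L^∞((0,T), L²) ∩ L^q((0,T), L^p)` and
`∇θ = g + b` with `g ∈ L¹((0,T), L^∞)` and `b ∈ L¹((0,T), BMO)`, where `b(t)` is supported on a set
of finite measure for almost every `t`. -/
def InUniquenessClass {n : ℕ} (T : ℝ) (q p : ℝ≥0∞) (θ : ℝ → Space n → ℝ) : Prop :=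
  MemMixedLp T ∞ 2 θ ∧ MemMixedLp T q p θ ∧
    ∃ g b : ℝ → Space n → Space n,
      MemMixedLp T 1 ∞ g ∧ MemLpBMO T 1 b ∧
      (∀ᵐ t ∂(volume.restrict (Ioo 0 T)), volume (Function.support (b t)) < ∞) ∧
      ∀ᵐ t ∂(volume.restrict (Ioo 0 T)), HasWeakGradient (θ t) (fun x => g t x + b t x)

end ActiveScalar

end

noncomputable section

namespace ActiveScalar

open Filter Topology
open scoped Convolution

section

variable {n : ℕ}

/-! ### Dyadic cubes -/

/-! Put `w = θ₁ - θ₂` and `F = θ₁u₁ - θ₂u₂`. Then `∂ₜw + div F = 0` up to the sign convention of the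
weak form, with zero initial datum, and formally `‖w(t)‖₂² = 2 ∫₀ᵗ ∫ F · ∇w`. Writing `θ₁ = w + θ₂`
and using `div u₁ = div u₂ = 0` against `w²` and `wθ₂`, the flux becomes `-∫ (u₁ - u₂) · w∇θ₂`.
Since `u₁ - u₂ = T_m w` and `T_m` is bounded on `L²`, it is at most a constant times `‖w‖₂ ‖w∇θ₂‖₂`.
For bounded `∇θ₂` Gronwall would finish; with mean oscillations bounded by `A(t)` there is a
logarithmic loss.

The loss is quantified by the product estimate `exists_product_le`: if the gradients of `f` and `g`
have oscillation at most `A` and both energies are at most `E`, then `∫ |f|²|∇g|² ≤ C A² (L² ∫ |f|²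
+ τ E)` whenever `L ≥ 1` and `τ ≥ e^{-L}`. After normalising `A = 1`, space is cut into the maximal
dyadic cubes `Q` of side `ℓ` on which the mass of `|f|² + |g|²`, plus a small positive weight, is at
least `ℓ^(n+2)`. The parent of `Q` fails this test, so the mass on `Q` is also at most `(2ℓ)^(n+2)`.
At this scale the `L²` size of a function controls the mean of its gradient over `Q` by an absolute
constant (`exists_norm_average_gradient_le`). John–Nirenberg then makes the gradients exponentially
integrable on `Q`, and a Poincaré inequality bounds the fourth powers of the functions. The
elementary inequality `sq_mul_sq_le_of_exp` turns this into the estimate on `Q` with error `τ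
ℓ^(n+2)`, and the selection rule bounds that error by `τ` times the mass of `Q`, so the errors can
be summed.

With `L = 1 + m` and `τ = e^{-m}`, the energy `y = ‖w‖₂²` satisfies `y(t) ≤ ∫₀ᵗ C A ((1 + m) y +
e^{-m})` for every `m`. On an interval where `C ∫ A ≤ 1/2`, starting from zero, Gronwall gives a
bound of order `e^{-m} e^{(1+m)/2}`, which tends to zero. Finitely many such intervals cover
`(0,T)`; this is `ae_eq_zero_of_log_gronwall`.

The formal computation is justified by mollification. `SolvesContinuity.energy` is an exact identity
for the mollified solution, whose flux pairs `F` with the gradient of the doubly mollified `w`.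
Products such as `θ ∇w` are bounded in `L²` by the product estimate, uniformly in the mollification,
and converge almost everywhere, hence weakly in `L²`. This identifies the limiting flux
(`exists_flux_bound`). The splitting of the gradient enters through
`InUniquenessClass.exists_regularScalar`: the bounded part and the `BMO` part both have mean
oscillations integrable in time. -/

/-- The integer coordinates of the dyadic cube of side `2 ^ (-k)` containing `x`. -/
def dyadicIndex (k : ℤ) (x : Space n) : Fin n → ℤ := fun i => ⌊(2 : ℝ) ^ k * x i⌋

/-- The half-open dyadic cube of side `2 ^ (-k)` with integer coordinates `v`. -/
def dyadic (k : ℤ) (v : Fin n → ℤ) : Set (Space n) := {x | dyadicIndex k x = v}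

lemma mem_dyadic_self (k : ℤ) (x : Space n) : x ∈ dyadic k (dyadicIndex k x) := rfl

lemma measurable_dyadicIndex (k : ℤ) : Measurable (dyadicIndex (n := n) k) := by
  refine measurable_pi_lambda _ fun i => Int.measurable_floor.comp ?_
  fun_prop

lemma measurableSet_dyadic (k : ℤ) (v : Fin n → ℤ) : MeasurableSet (dyadic k v) :=
  measurable_dyadicIndex k (measurableSet_singleton v)

/-- Nestedness of the dyadic grids: the coarse index is the integer quotient of the fine index by `2
^ m`, so it is a function of the fine index. -/
lemma dyadicIndex_congr {j k : ℤ} (hjk : j ≤ k) {x y : Space n}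
    (h : dyadicIndex k x = dyadicIndex k y) : dyadicIndex j x = dyadicIndex j y := by
  obtain ⟨m, rfl⟩ := Int.le.dest hjk
  have key : ∀ (z : Space n) (i : Fin n),
      dyadicIndex j z i = dyadicIndex (j + m) z i / ((2 ^ m : ℕ) : ℤ) := by
    intro z i
    have := Int.mul_natCast_floor_div_cancel (n := 2 ^ m) (by positivity) ((2 : ℝ) ^ j * z i)
    simp only [dyadicIndex]
    rw [← this, zpow_add₀ (by norm_num)]
    congr 2
    push_cast
    rw [zpow_natCast]
    ring
  funext i
  rw [key x i, key y i, h]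

lemma dyadic_subset {j k : ℤ} (hjk : j ≤ k) {v w : Fin n → ℤ} {x : Space n}
    (hv : x ∈ dyadic k v) (hw : x ∈ dyadic j w) : dyadic k v ⊆ dyadic j w := by
  intro y hy
  have hyx : dyadicIndex k y = dyadicIndex k x := by
    rw [show dyadicIndex k y = v from hy, show dyadicIndex k x = v from hv]
  show dyadicIndex j y = w
  rw [dyadicIndex_congr hjk hyx]
  exact hw

lemma mem_dyadic_iff {k : ℤ} {v : Fin n → ℤ} {x : Space n} :
    x ∈ dyadic k v ↔ ∀ i, (v i : ℝ) * 2 ^ (-k) ≤ x i ∧ x i < (v i + 1) * 2 ^ (-k) := by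
  have h2 : (0 : ℝ) < 2 ^ k := by positivity
  simp only [dyadic, mem_ofPred_eq, funext_iff, dyadicIndex, Int.floor_eq_iff, zpow_neg,
    ← div_eq_mul_inv]
  refine forall_congr' fun i => ?_
  rw [div_le_iff₀ h2, lt_div_iff₀ h2, mul_comm (x i)]

/-- The centre of a dyadic cube. -/
def dyadicCenter (k : ℤ) (v : Fin n → ℤ) : Space n :=
  WithLp.toLp 2 fun i => ((v i : ℝ) + 1 / 2) * 2 ^ (-k)

/-- The half-open and closed cubes differ by null faces. This carries oscillation bounds from the
cubes of the `BMO` definition to the dyadic grid. -/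
lemma dyadic_ae_eq_cube (k : ℤ) (v : Fin n → ℤ) :
    dyadic k v =ᵐ[volume] cube (dyadicCenter k v) (2 ^ (-k) / 2) := by
  have hmp := PiLp.volume_preserving_ofLp (Fin n)
  have h := hmp.quasiMeasurePreserving.preimage_ae_eq
    (Measure.univ_pi_Ico_ae_eq_Icc (μ := fun _ : Fin n => (volume : Measure ℝ))
      (f := fun i => (v i : ℝ) * 2 ^ (-k)) (g := fun i => (v i + 1) * 2 ^ (-k)))
  have h1 : dyadic k v = @WithLp.ofLp 2 (Fin n → ℝ) ⁻¹'
      (pi univ fun i => Ico ((v i : ℝ) * 2 ^ (-k)) ((v i + 1) * 2 ^ (-k))) := by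
    ext x
    rw [mem_dyadic_iff]
    simp [Set.mem_pi, mem_Ico]
  have h2 : cube (dyadicCenter k v) (2 ^ (-k) / 2) = @WithLp.ofLp 2 (Fin n → ℝ) ⁻¹'
      (Icc (fun i => (v i : ℝ) * 2 ^ (-k)) fun i => (v i + 1) * 2 ^ (-k)) := by
    ext x
    simp only [cube, dyadicCenter, mem_ofPred_eq, mem_preimage, mem_Icc, Pi.le_def, ← forall_and]
    refine forall_congr' fun i => ?_
    rw [abs_le]
    constructor <;> rintro ⟨h1, h2⟩ <;> constructor <;> linarith
  rw [h1, h2]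
  exact h

lemma volume_dyadic (k : ℤ) (v : Fin n → ℤ) :
    volume (dyadic k v) = ENNReal.ofReal ((2 : ℝ) ^ (-k)) ^ n := by
  have hmp := PiLp.volume_preserving_ofLp (Fin n)
  have : dyadic k v = @WithLp.ofLp 2 (Fin n → ℝ) ⁻¹'
      (pi univ fun i => Ico ((v i : ℝ) * 2 ^ (-k)) ((v i + 1) * 2 ^ (-k))) := by
    ext x
    rw [mem_dyadic_iff]
    simp [Set.mem_pi, mem_Ico]
  rw [this, hmp.measure_preimage (MeasurableSet.univ_pi fun _ => measurableSet_Ico).nullMeasurableSet,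
    Real.volume_pi_Ico]
  simp [add_mul]

lemma volume_dyadic_ne_top (k : ℤ) (v : Fin n → ℤ) : volume (dyadic k v) ≠ ∞ := by
  rw [volume_dyadic]; finiteness

lemma volume_dyadic_ne_zero (k : ℤ) (v : Fin n → ℤ) : volume (dyadic k v) ≠ 0 := by
  rw [volume_dyadic]
  have : (0 : ℝ) < 2 ^ (-k) := by positivity
  exact pow_ne_zero _ (ENNReal.ofReal_pos.2 this).ne'

lemma volume_dyadic_pred (k : ℤ) (v w : Fin n → ℤ) :
    volume (dyadic (k - 1) w) = 2 ^ n * volume (dyadic k v) := by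
  rw [volume_dyadic, volume_dyadic, ← mul_pow]
  congr 1
  rw [show -(k - 1) = -k + 1 by ring, zpow_add₀ (by norm_num), zpow_one, mul_comm,
    ENNReal.ofReal_mul (by norm_num)]
  simp

lemma norm_sub_le_of_mem_dyadic {k : ℤ} {v : Fin n → ℤ} {x y : Space n}
    (hx : x ∈ dyadic k v) (hy : y ∈ dyadic k v) : ‖x - y‖ ≤ n * 2 ^ (-k) := by
  rw [mem_dyadic_iff] at hx hy
  have h : ∀ i, |(x - y) i| ≤ 2 ^ (-k) := by
    intro i
    have h1 := hx i
    have h2 := hy i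
    rw [PiLp.sub_apply, abs_le]
    constructor <;> linarith [h1.1, h1.2, h2.1, h2.2]
  calc ‖x - y‖ ≤ ∑ i, |(x - y) i| := by
        have := EuclideanSpace.norm_eq (x - y)
        rw [this]
        refine Real.sqrt_le_iff.2 ⟨by positivity, ?_⟩
        simp only [Real.norm_eq_abs]
        exact Finset.sum_sq_le_sq_sum_of_nonneg fun i _ => abs_nonneg _
    _ ≤ ∑ _i : Fin n, (2 : ℝ) ^ (-k) := Finset.sum_le_sum fun i _ => h i
    _ = n * 2 ^ (-k) := by simp

lemma tendsto_two_zpow_neg : Tendsto (fun k : ℤ => (2 : ℝ) ^ (-k)) atTop (𝓝 0) := by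
  have h := (tendsto_rpow_atTop_of_base_lt_one (1 / 2) (by norm_num) (by norm_num)).comp
    (tendsto_intCast_atTop_atTop (R := ℝ))
  refine h.congr fun k => ?_
  simp [zpow_neg]

lemma tendsto_two_zpow_neg_atBot : Tendsto (fun k : ℤ => (2 : ℝ) ^ (-k)) atBot atTop := by
  have h := ((tendsto_rpow_atTop_of_base_gt_one 2 (by norm_num)).comp
    (tendsto_intCast_atTop_atTop (R := ℝ))).comp tendsto_neg_atBot_atTop
  refine h.congr fun k => ?_
  exact (congrArg _ (by simp)).trans (Real.rpow_intCast 2 (-k))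

lemma eventually_dyadic_forall {p : Space n → Prop} {x : Space n} (h : ∀ᶠ y in 𝓝 x, p y) :
    ∀ᶠ k : ℤ in atTop, ∀ y ∈ dyadic k (dyadicIndex k x), p y := by
  obtain ⟨ε, hε, hp⟩ := Metric.eventually_nhds_iff.1 h
  have h0 : Tendsto (fun k : ℤ => (n : ℝ) * (2 : ℝ) ^ (-k)) atTop (𝓝 0) := by
    simpa using tendsto_two_zpow_neg.const_mul (n : ℝ)
  filter_upwards [h0.eventually (gt_mem_nhds hε)] with k hk y hy
  refine hp ?_
  rw [dist_eq_norm]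
  exact (norm_sub_le_of_mem_dyadic hy (mem_dyadic_self k x)).trans_lt hk

/-- The maximal cubes among a family of dyadic cubes. -/
def maximalDyadic (S : Set (ℤ × (Fin n → ℤ))) : Set (ℤ × (Fin n → ℤ)) :=
  {p | p ∈ S ∧ ∀ j < p.1, ∀ x ∈ dyadic p.1 p.2, (j, dyadicIndex j x) ∉ S}

lemma maximalDyadic_subset (S : Set (ℤ × (Fin n → ℤ))) : maximalDyadic S ⊆ S := fun _ h => h.1

/-- If cubes of two generations shared a point, the coarser one would be a member of `S` around a
point of the finer, contradicting maximality of the finer. -/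
lemma pairwiseDisjoint_maximalDyadic (S : Set (ℤ × (Fin n → ℤ))) :
    (maximalDyadic S).PairwiseDisjoint fun p => dyadic p.1 p.2 := by
  rintro ⟨k, v⟩ hp ⟨j, w⟩ hq hne
  refine disjoint_left.2 fun x hx hy => hne ?_
  have hx' : dyadicIndex k x = v := hx
  have hy' : dyadicIndex j x = w := hy
  rcases lt_trichotomy j k with h | h | h
  · exact absurd (hy' ▸ hq.1) (hp.2 j h x hx)
  · subst h; rw [← hx', ← hy']
  · exact absurd (hx' ▸ hp.1) (hq.2 k h x hy)

/-- The cubes of `S` around `x` have generation at least `k₀`, so a coarsest one exists. Nestedness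
makes its ancestors the same at all its points, which is what maximality requires. -/
lemma exists_mem_maximalDyadic {S : Set (ℤ × (Fin n → ℤ))} {x : Space n} {k k₀ : ℤ}
    (hk : (k, dyadicIndex k x) ∈ S) (h₀ : ∀ j < k₀, (j, dyadicIndex j x) ∉ S) :
    ∃ p ∈ maximalDyadic S, x ∈ dyadic p.1 p.2 := by
  obtain ⟨j, hj, hmin⟩ := Int.exists_least_of_bdd (P := fun j => (j, dyadicIndex j x) ∈ S)
    ⟨k₀, fun z hz => not_lt.1 fun hlt => h₀ z hlt hz⟩ ⟨k, hk⟩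
  refine ⟨(j, dyadicIndex j x), ⟨hj, fun i hi y hy => ?_⟩, mem_dyadic_self j x⟩
  rw [dyadicIndex_congr hi.le (show dyadicIndex j y = dyadicIndex j x from hy)]
  exact fun h => absurd (hmin i h) (not_le.2 hi)

lemma tsum_lintegral_maximalDyadic (S : Set (ℤ × (Fin n → ℤ))) (f : Space n → ℝ≥0∞) :
    ∑' p : maximalDyadic S, ∫⁻ x in dyadic p.1.1 p.1.2, f x
      = ∫⁻ x in ⋃ p ∈ maximalDyadic S, dyadic p.1 p.2, f x :=
  (lintegral_biUnion (to_countable _) (fun p _ => measurableSet_dyadic p.1 p.2)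
    (pairwiseDisjoint_maximalDyadic S) f).symm

end

section

variable {n : ℕ} {F : Type*} [NormedAddCommGroup F] [NormedSpace ℝ F]

/-! ### The John–Nirenberg inequality for continuous functions -/

lemma dyadic_nonempty (k : ℤ) (v : Fin n → ℤ) : (dyadic k v).Nonempty :=
  nonempty_of_measure_ne_zero (volume_dyadic_ne_zero k v)

omit [NormedSpace ℝ F] in
lemma integrableOn_dyadic {H : Space n → F} (hH : LocallyIntegrable H volume) (k : ℤ)
    (v : Fin n → ℤ) : IntegrableOn H (dyadic k v) := by
  obtain ⟨x, hx⟩ := dyadic_nonempty k v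
  refine (hH.integrableOn_isCompact (isCompact_closedBall x (n * 2 ^ (-k)))).mono_set ?_
  intro y hy
  rw [mem_closedBall_iff_norm]
  exact norm_sub_le_of_mem_dyadic hy hx

lemma enorm_setAverage_sub_le [CompleteSpace F] {H : Space n → F} {s : Set (Space n)}
    (hs : volume s ≠ 0) (hs' : volume s ≠ ∞) (hH : IntegrableOn H s) (a : F) :
    ‖(⨍ z in s, H z) - a‖ₑ ≤ (volume s)⁻¹ * ∫⁻ z in s, ‖H z - a‖ₑ := by
  have h1 : (⨍ z in s, H z) - a = ⨍ z in s, (H z - a) := by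
    rw [setAverage_eq, setAverage_eq, integral_sub hH (integrableOn_const hs'),
      setIntegral_const, smul_sub, smul_smul, inv_mul_cancel₀, one_smul]
    exact ENNReal.toReal_ne_zero.2 ⟨hs, hs'⟩
  rw [h1, setAverage_eq, enorm_smul]
  gcongr
  · rw [measureReal_def, ← ENNReal.toReal_inv]
    exact (Real.enorm_eq_ofReal ENNReal.toReal_nonneg).trans_le ENNReal.ofReal_toReal_le
  · exact enorm_integral_le_lintegral_enorm _

/-- The mean oscillation over every dyadic cube is at most one. -/
def DyadicOscLeOne (H : Space n → F) : Prop :=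
  ∀ (k : ℤ) (v : Fin n → ℤ),
    ∫⁻ y in dyadic k v, ‖H y - ⨍ z in dyadic k v, H z‖ₑ ≤ volume (dyadic k v)

/-- Calderón–Zygmund stopping: the maximal proper subcubes where the mean of `|H - a|` exceeds `2`
have total measure at most half that of the cube. Their averages differ from `a` by at most `2 ^ (n
+ 1)`, because the mean over the parent is at most `2`. Each further height `2 ^ (n + 1)` therefore
costs a factor `1/2`. Continuity replaces Lebesgue differentiation in showing that `|H - a| > 2`
forces a point into a selected cube. -/
theorem volume_johnNirenberg_le [CompleteSpace F] {H : Space n → F} (hc : Continuous H)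
    (hosc : DyadicOscLeOne H) (j : ℕ) (k : ℤ) (v : Fin n → ℤ) :
    volume {x ∈ dyadic k v | (j * 2 ^ (n + 1) : ℝ) < ‖H x - ⨍ z in dyadic k v, H z‖}
      ≤ 2⁻¹ ^ j * volume (dyadic k v) := by
  induction j generalizing k v with
  | zero => simpa using measure_mono (sep_subset _ _)
  | succ j ih =>
    set a := ⨍ z in dyadic k v, H z with ha
    let S : Set (ℤ × (Fin n → ℤ)) := {p | k < p.1 ∧ dyadic p.1 p.2 ⊆ dyadic k v ∧
      2 * volume (dyadic p.1 p.2) < ∫⁻ x in dyadic p.1 p.2, ‖H x - a‖ₑ}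
    have hvol : 2 * ∑' p : maximalDyadic S, volume (dyadic p.1.1 p.1.2)
        ≤ volume (dyadic k v) := by
      rw [← ENNReal.tsum_mul_left]
      calc ∑' p : maximalDyadic S, 2 * volume (dyadic p.1.1 p.1.2)
          ≤ ∑' p : maximalDyadic S, ∫⁻ x in dyadic p.1.1 p.1.2, ‖H x - a‖ₑ :=
            ENNReal.tsum_le_tsum fun p => (maximalDyadic_subset S p.2).2.2.le
        _ = ∫⁻ x in ⋃ p ∈ maximalDyadic S, dyadic p.1 p.2, ‖H x - a‖ₑ :=
            tsum_lintegral_maximalDyadic S _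
        _ ≤ ∫⁻ x in dyadic k v, ‖H x - a‖ₑ :=
            lintegral_mono_set (iUnion₂_subset fun p hp => (maximalDyadic_subset S hp).2.1)
        _ ≤ _ := hosc k v
    have hpar : ∀ p ∈ maximalDyadic S,
        ‖(⨍ z in dyadic p.1 p.2, H z) - a‖ ≤ 2 ^ (n + 1) := by
      rintro ⟨m, w⟩ hp
      obtain ⟨x, hx⟩ := dyadic_nonempty m w
      have hkm : k < m := hp.1.1
      have hsub : dyadic m w ⊆ dyadic (m - 1) (dyadicIndex (m - 1) x) :=
        dyadic_subset (by lia) hx (mem_dyadic_self _ x)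
      have hxk : x ∈ dyadic k v := hp.1.2.1 hx
      have hpar' : ∫⁻ y in dyadic (m - 1) (dyadicIndex (m - 1) x), ‖H y - a‖ₑ
          ≤ 2 * volume (dyadic (m - 1) (dyadicIndex (m - 1) x)) := by
        -- The parent may be the starting cube, which `S` excludes; there the oscillation hypothesis
        -- itself gives the bound. Otherwise the bound comes from maximality.
        rcases eq_or_lt_of_le (show k ≤ m - 1 by lia) with h | h
        · rw [← h, show dyadicIndex k x = v from hxk]
          refine (hosc k v).trans ?_
          rw [two_mul]
          exact le_self_add
        · have := hp.2 (m - 1) (by simp) x hx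
          by_contra hcon
          exact this ⟨h, dyadic_subset h.le (mem_dyadic_self _ x) hxk, not_le.1 hcon⟩
      have h1 : ‖(⨍ z in dyadic m w, H z) - a‖ₑ ≤ 2 ^ (n + 1) := by
        refine (enorm_setAverage_sub_le (volume_dyadic_ne_zero m w) (volume_dyadic_ne_top m w)
          (integrableOn_dyadic hc.locallyIntegrable m w) a).trans ?_
        calc (volume (dyadic m w))⁻¹ * ∫⁻ z in dyadic m w, ‖H z - a‖ₑ
            ≤ (volume (dyadic m w))⁻¹ * (2 * (2 ^ n * volume (dyadic m w))) := by
              rw [← volume_dyadic_pred m w (dyadicIndex (m - 1) x)]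
              gcongr
              exact (lintegral_mono_set hsub).trans hpar'
          _ = 2 ^ (n + 1) * ((volume (dyadic m w))⁻¹ * volume (dyadic m w)) := by ring
          _ ≤ 2 ^ (n + 1) := by
              rw [ENNReal.inv_mul_cancel (volume_dyadic_ne_zero m w) (volume_dyadic_ne_top m w),
                mul_one]
      have h2 := ENNReal.toReal_mono (by finiteness) h1
      simpa using h2
    have hcov : {x ∈ dyadic k v | ((j + 1 : ℕ) * 2 ^ (n + 1) : ℝ) < ‖H x - a‖} ⊆
        ⋃ p ∈ maximalDyadic S, {x ∈ dyadic p.1 p.2 |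
          (j * 2 ^ (n + 1) : ℝ) < ‖H x - ⨍ z in dyadic p.1 p.2, H z‖} := by
      rintro x ⟨hxk, hx⟩
      have h1 : (1 : ℝ) ≤ 2 ^ n := one_le_pow₀ (by norm_num)
      have h2 : (2 : ℝ) < ‖H x - a‖ := by
        refine lt_of_le_of_lt ?_ hx
        have : (0 : ℝ) ≤ j * 2 ^ (n + 1) := by positivity
        rw [pow_succ] at this ⊢
        push_cast
        nlinarith
      obtain ⟨d, hd2, hd⟩ := exists_between h2
      have hev : ∀ᶠ y in 𝓝 x, d < ‖H y - a‖ :=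
        (hc.sub continuous_const).norm.continuousAt.eventually (lt_mem_nhds hd)
      obtain ⟨m, hm, hkm⟩ := ((eventually_dyadic_forall hev).and (eventually_gt_atTop k)).exists
      have hmS : (m, dyadicIndex m x) ∈ S := by
        refine ⟨hkm, dyadic_subset hkm.le (mem_dyadic_self m x) hxk, ?_⟩
        calc 2 * volume (dyadic m (dyadicIndex m x))
            < ENNReal.ofReal d * volume (dyadic m (dyadicIndex m x)) := by
              refine (ENNReal.mul_lt_mul_iff_left (volume_dyadic_ne_zero _ _)
                (volume_dyadic_ne_top _ _)).2 ?_
              rw [show (2 : ℝ≥0∞) = ENNReal.ofReal 2 by simp]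
              exact (ENNReal.ofReal_lt_ofReal_iff (by linarith)).2 hd2
          _ = ∫⁻ _y in dyadic m (dyadicIndex m x), ENNReal.ofReal d := by
              rw [setLIntegral_const]
          _ ≤ _ := by
              refine setLIntegral_mono' (measurableSet_dyadic _ _) fun y hy => ?_
              rw [← ofReal_norm]
              exact ENNReal.ofReal_le_ofReal (hm y hy).le
      obtain ⟨p, hp, hxp⟩ := exists_mem_maximalDyadic hmS (k₀ := k) fun i hi h =>
        absurd h.1 (not_lt.2 hi.le)
      refine mem_iUnion₂.2 ⟨p, hp, hxp, ?_⟩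
      have h3 := norm_sub_le_norm_sub_add_norm_sub (H x) (⨍ z in dyadic p.1 p.2, H z) a
      have h4 := hpar p hp
      push_cast at hx
      linarith
    calc _ ≤ volume (⋃ p ∈ maximalDyadic S, {x ∈ dyadic p.1 p.2 |
          (j * 2 ^ (n + 1) : ℝ) < ‖H x - ⨍ z in dyadic p.1 p.2, H z‖}) := measure_mono hcov
      _ ≤ ∑' p : maximalDyadic S, volume {x ∈ dyadic p.1.1 p.1.2 |
          (j * 2 ^ (n + 1) : ℝ) < ‖H x - ⨍ z in dyadic p.1.1 p.1.2, H z‖} :=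
          measure_biUnion_le _ (to_countable _) _
      _ ≤ ∑' p : maximalDyadic S, 2⁻¹ ^ j * volume (dyadic p.1.1 p.1.2) :=
          ENNReal.tsum_le_tsum fun p => ih p.1.1 p.1.2
      _ = 2⁻¹ ^ (j + 1) * (2 * ∑' p : maximalDyadic S, volume (dyadic p.1.1 p.1.2)) := by
          rw [ENNReal.tsum_mul_left, pow_succ, mul_assoc, ← mul_assoc 2⁻¹ 2,
            ENNReal.inv_mul_cancel (by norm_num) (by norm_num), one_mul]
      _ ≤ _ := by gcongr

/-- The exponent in the John–Nirenberg inequality. -/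
def jnExp (n : ℕ) : ℝ := 1 / (4 * 2 ^ (n + 1))

lemma jnExp_pos (n : ℕ) : 0 < jnExp n := by unfold jnExp; positivity

/-- A discrete layer-cake bound. The exponent is chosen so that each step of height `2 ^ (n + 1)`
multiplies the exponential by `e^{1/4} ≤ 4/3`. This ratio is below `2`, so it is summable against
the decay `2⁻¹ ^ j` of the level sets. -/
lemma exp_jnExp_mul_le (n : ℕ) {s : ℝ} (hs : 0 ≤ s) :
    ENNReal.ofReal (Real.exp (jnExp n * s)) ≤
      1 + ∑' j : ℕ, (4 / 3 : ℝ≥0∞) ^ (j + 1) *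
        (Ioi (j * 2 ^ (n + 1) : ℝ)).indicator 1 s := by
  rcases hs.eq_or_lt with rfl | hs
  · simp
  set c : ℝ := 2 ^ (n + 1) with hc
  have hc0 : 0 < c := by positivity
  obtain ⟨j, hj1, hj2⟩ : ∃ j : ℕ, j * c < s ∧ s ≤ (j + 1) * c := by
    have h0 : 0 < s / c := by positivity
    have h1 : 0 < ⌈s / c⌉₊ := Nat.ceil_pos.2 h0
    refine ⟨⌈s / c⌉₊ - 1, ?_, ?_⟩
    · rw [← lt_div_iff₀ hc0]
      have := Nat.ceil_lt_add_one h0.le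
      rw [Nat.cast_sub h1]; push_cast; linarith
    · rw [← div_le_iff₀ hc0, Nat.cast_sub h1]
      have := Nat.le_ceil (s / c)
      push_cast; linarith
  have hexp : Real.exp (jnExp n * s) ≤ (4 / 3) ^ (j + 1) := by
    have h4 : Real.exp (1 / 4) ≤ 4 / 3 := by
      have := Real.one_sub_le_exp_neg (1 / 4)
      rw [Real.exp_neg] at this
      have h5 := Real.exp_pos (1 / 4)
      rw [le_inv_comm₀ (by norm_num) h5] at this
      linarith
    calc Real.exp (jnExp n * s) ≤ Real.exp ((j + 1 : ℕ) * (1 / 4)) := by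
          refine Real.exp_le_exp.2 ?_
          have : jnExp n = 1 / (4 * c) := rfl
          rw [this]
          push_cast
          rw [div_mul_eq_mul_div, div_le_iff₀ (by positivity)]
          linarith
      _ = Real.exp (1 / 4) ^ (j + 1) := by rw [Real.exp_nat_mul]
      _ ≤ _ := by gcongr
  calc ENNReal.ofReal (Real.exp (jnExp n * s)) ≤ ENNReal.ofReal ((4 / 3) ^ (j + 1)) :=
        ENNReal.ofReal_le_ofReal hexp
    _ = (4 / 3 : ℝ≥0∞) ^ (j + 1) * (Ioi (j * c : ℝ)).indicator 1 s := by
        rw [indicator_of_mem (show s ∈ Ioi (j * c) from hj1), ENNReal.ofReal_pow (by norm_num),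
          ENNReal.ofReal_div_of_pos (by norm_num)]
        simp
    _ ≤ ∑' j : ℕ, (4 / 3 : ℝ≥0∞) ^ (j + 1) * (Ioi (j * c : ℝ)).indicator 1 s :=
        ENNReal.le_tsum (f := fun j : ℕ => (4 / 3 : ℝ≥0∞) ^ (j + 1) *
          (Ioi (j * c : ℝ)).indicator 1 s) j
    _ ≤ _ := le_add_self

/-- The constant is `1 + (4/3) ∑ (2/3)^j = 5`, summing the layers against the decay of the level
sets. -/
theorem lintegral_exp_johnNirenberg_le [CompleteSpace F] {H : Space n → F} (hc : Continuous H)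
    (hosc : DyadicOscLeOne H) (k : ℤ) (v : Fin n → ℤ) :
    ∫⁻ x in dyadic k v,
      ENNReal.ofReal (Real.exp (jnExp n * ‖H x - ⨍ z in dyadic k v, H z‖))
      ≤ 5 * volume (dyadic k v) := by
  set a := ⨍ z in dyadic k v, H z with ha
  have hm : ∀ j : ℕ, Measurable fun x =>
      (Ioi (j * 2 ^ (n + 1) : ℝ)).indicator (1 : ℝ → ℝ≥0∞) ‖H x - a‖ := fun j =>
    (measurable_one.indicator measurableSet_Ioi).comp (hc.sub continuous_const).norm.measurable
  calc _ ≤ ∫⁻ x in dyadic k v, (1 + ∑' j : ℕ, (4 / 3 : ℝ≥0∞) ^ (j + 1) *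
        (Ioi (j * 2 ^ (n + 1) : ℝ)).indicator 1 ‖H x - a‖) :=
        lintegral_mono fun x => exp_jnExp_mul_le n (norm_nonneg _)
    _ = volume (dyadic k v) + ∑' j : ℕ, (4 / 3 : ℝ≥0∞) ^ (j + 1) *
        ∫⁻ x in dyadic k v, (Ioi (j * 2 ^ (n + 1) : ℝ)).indicator 1 ‖H x - a‖ := by
        rw [lintegral_add_left measurable_const, lintegral_tsum fun j => ((hm j).const_mul _).aemeasurable]
        congr 1
        · simp
        · exact tsum_congr fun j => lintegral_const_mul _ (hm j)
    _ ≤ volume (dyadic k v) + ∑' j : ℕ, (4 / 3 : ℝ≥0∞) ^ (j + 1) *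
        (2⁻¹ ^ j * volume (dyadic k v)) := by
        gcongr with j
        refine le_trans (le_of_eq ?_) (volume_johnNirenberg_le hc hosc j k v)
        have hset : MeasurableSet {x | (j * 2 ^ (n + 1) : ℝ) < ‖H x - a‖} :=
          measurableSet_lt measurable_const (hc.sub continuous_const).norm.measurable
        have h1 : (fun x => (Ioi (j * 2 ^ (n + 1) : ℝ)).indicator (1 : ℝ → ℝ≥0∞) ‖H x - a‖)
            = {x | (j * 2 ^ (n + 1) : ℝ) < ‖H x - a‖}.indicator 1 := by
          ext x; simp [indicator]
        rw [h1, lintegral_indicator_one hset, Measure.restrict_apply hset, inter_comm]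
        rfl
    _ = volume (dyadic k v) + (4 / 3 * ∑' j : ℕ, (4 / 3 * 2⁻¹ : ℝ≥0∞) ^ j)
          * volume (dyadic k v) := by
        rw [← ENNReal.tsum_mul_left, ← ENNReal.tsum_mul_right]
        congr 1
        refine tsum_congr fun j => ?_
        rw [mul_pow]; ring
    _ = _ := by
        have h1 : (4 / 3 * 2⁻¹ : ℝ≥0∞) = ENNReal.ofReal (2 / 3) := by
          rw [show (2 / 3 : ℝ) = 4 / 3 * 2⁻¹ by norm_num, ENNReal.ofReal_mul (by norm_num),
            ENNReal.ofReal_div_of_pos (by norm_num), ENNReal.ofReal_inv_of_pos (by norm_num)]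
          simp
        have h2 : (1 - ENNReal.ofReal (2 / 3))⁻¹ = 3 := by
          rw [← ENNReal.ofReal_one, ← ENNReal.ofReal_sub _ (by norm_num),
            ← ENNReal.ofReal_inv_of_pos (by norm_num)]
          norm_num
        rw [h1, ENNReal.tsum_geometric, h2, ENNReal.div_mul_cancel (by norm_num) (by norm_num)]
        ring

end

section

/-! ### Cauchy–Schwarz for lower Lebesgue integrals -/

lemma lintegral_mul_sq_le {α : Type*} [MeasurableSpace α] {μ : Measure α} {f g : α → ℝ≥0∞}
    (hf : AEMeasurable f μ) (hg : AEMeasurable g μ) :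
    (∫⁻ x, f x * g x ∂μ) ^ 2 ≤ (∫⁻ x, f x ^ 2 ∂μ) * ∫⁻ x, g x ^ 2 ∂μ := by
  have h := ENNReal.lintegral_mul_le_Lp_mul_Lq μ Real.HolderConjugate.two_two hf hg
  have h2 := pow_le_pow_left' h 2
  refine h2.trans (le_of_eq ?_)
  have h3 : ∀ a : ℝ≥0∞, (a ^ (1 / 2 : ℝ)) ^ 2 = a := fun a => by
    rw [← ENNReal.rpow_natCast, ← ENNReal.rpow_mul]; norm_num
  rw [mul_pow, h3, h3]
  simp only [ENNReal.rpow_two]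

lemma lintegral_sq_le {α : Type*} [MeasurableSpace α] {μ : Measure α} {f : α → ℝ≥0∞}
    (hf : AEMeasurable f μ) :
    (∫⁻ x, f x ∂μ) ^ 2 ≤ μ univ * ∫⁻ x, f x ^ 2 ∂μ := by
  simpa using lintegral_mul_sq_le (aemeasurable_const (b := (1 : ℝ≥0∞))) hf

lemma lintegral_pow_four_le {α : Type*} [MeasurableSpace α] {μ : Measure α} {f : α → ℝ≥0∞}
    (hf : AEMeasurable f μ) :
    (∫⁻ x, f x ∂μ) ^ 4 ≤ μ univ ^ 3 * ∫⁻ x, f x ^ 4 ∂μ := by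
  have h1 := pow_le_pow_left' (lintegral_sq_le hf) 2
  have h2 := lintegral_sq_le (hf.pow_const 2)
  calc (∫⁻ x, f x ∂μ) ^ 4 = ((∫⁻ x, f x ∂μ) ^ 2) ^ 2 := by ring
    _ ≤ (μ univ * ∫⁻ x, f x ^ 2 ∂μ) ^ 2 := h1
    _ = μ univ ^ 2 * (∫⁻ x, f x ^ 2 ∂μ) ^ 2 := by ring
    _ ≤ μ univ ^ 2 * (μ univ * ∫⁻ x, (f x ^ 2) ^ 2 ∂μ) := by gcongr
    _ = _ := by simp only [← pow_mul]; ring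

/-! ### A Poincaré inequality on dyadic cubes -/

variable {n : ℕ}

lemma convex_dyadic (k : ℤ) (v : Fin n → ℤ) : Convex ℝ (dyadic k v) := by
  intro x hx y hy a b ha hb hab
  rw [mem_dyadic_iff] at *
  intro i
  obtain ⟨h1, h2⟩ := hx i
  obtain ⟨h3, h4⟩ := hy i
  have h5 : (a • x + b • y) i = a * x i + b * y i := by simp
  rw [h5]
  set c := (v i : ℝ) * 2 ^ (-k)
  set d := (v i + 1 : ℝ) * 2 ^ (-k)
  have hc : c = a * c + b * c := by rw [← add_mul, hab, one_mul]
  have hd : d = a * d + b * d := by rw [← add_mul, hab, one_mul]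
  have h6 := mul_le_mul_of_nonneg_left h1 ha
  have h7 := mul_le_mul_of_nonneg_left h3 hb
  have h8 := mul_le_mul_of_nonneg_left h4.le hb
  refine ⟨by linarith, ?_⟩
  rcases ha.eq_or_lt with rfl | ha
  · have : b = 1 := by linarith
    subst this; linarith
  · have h9 := mul_lt_mul_of_pos_left h2 ha
    linarith

lemma lintegral_comp_smul_add {s : ℝ} (hs : 0 < s) (c : Space n) (h : Space n → ℝ≥0∞)
    (hh : Measurable h) :
    ∫⁻ x, h (s • x + c) = ENNReal.ofReal (s ^ n)⁻¹ * ∫⁻ x, h x := by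
  have h1 := Measure.map_addHaar_smul (volume : Measure (Space n)) hs.ne'
  have h2 : ∫⁻ x, h (s • x + c) = ∫⁻ y, h (y + c) ∂(Measure.map (s • ·) volume) := by
    rw [lintegral_map (by fun_prop) (by fun_prop)]
  rw [h2, h1, lintegral_smul_measure, lintegral_add_right_eq_self]
  simp [abs_of_pos hs]

/-- By convexity, `x ↦ s x + (1 - s) y` maps the cube into itself. Its Jacobian is `s ^ n`, and `s ≥
1/2` keeps the inverse below `2 ^ n`. -/
lemma setLIntegral_segment_le {s : ℝ} (hs : 1 / 2 ≤ s) (hs1 : s ≤ 1) {h : Space n → ℝ≥0∞}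
    (hh : Measurable h) {k : ℤ} {v : Fin n → ℤ} {y : Space n} (hy : y ∈ dyadic k v) :
    ∫⁻ x in dyadic k v, h (s • x + (1 - s) • y) ≤ 2 ^ n * ∫⁻ x in dyadic k v, h x := by
  have hD := measurableSet_dyadic k v
  have hs0 : 0 < s := by linarith
  calc ∫⁻ x in dyadic k v, h (s • x + (1 - s) • y)
      ≤ ∫⁻ x, (dyadic k v).indicator h (s • x + (1 - s) • y) := by
        rw [← lintegral_indicator hD]
        refine lintegral_mono fun x => ?_
        by_cases hx : x ∈ dyadic k v
        · rw [indicator_of_mem hx, indicator_of_mem]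
          exact convex_dyadic k v hx hy hs0.le (by linarith) (by ring)
        · rw [indicator_of_notMem hx]; exact zero_le
    _ = ENNReal.ofReal (s ^ n)⁻¹ * ∫⁻ x in dyadic k v, h x := by
        rw [lintegral_comp_smul_add hs0 _ _ (hh.indicator hD), lintegral_indicator hD]
    _ ≤ _ := by
        gcongr
        calc ENNReal.ofReal (s ^ n)⁻¹ ≤ ENNReal.ofReal (2 ^ n) := by
              refine ENNReal.ofReal_le_ofReal ?_
              rw [← inv_pow]
              refine pow_le_pow_left₀ (by positivity) ?_ n
              rw [inv_le_comm₀ hs0 (by norm_num)]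
              linarith
          _ = 2 ^ n := by rw [ENNReal.ofReal_pow (by norm_num)]; simp

/-- Integrating first in `x` for `s ≥ 1/2` and first in `y` for `s ≤ 1/2` avoids the degenerate
Jacobian at either end of the segment. -/
lemma setLIntegral_setLIntegral_segment_le {s : ℝ} (hs : 0 ≤ s) (hs1 : s ≤ 1)
    {h : Space n → ℝ≥0∞} (hh : Measurable h) (k : ℤ) (v : Fin n → ℤ) :
    ∫⁻ x in dyadic k v, ∫⁻ y in dyadic k v, h (s • x + (1 - s) • y)
      ≤ 2 ^ n * volume (dyadic k v) * ∫⁻ x in dyadic k v, h x := by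
  have hD := measurableSet_dyadic k v
  rcases le_total (1 / 2) s with hs2 | hs2
  · rw [lintegral_lintegral_swap (by fun_prop)]
    calc _ ≤ ∫⁻ _y in dyadic k v, 2 ^ n * ∫⁻ x in dyadic k v, h x :=
          setLIntegral_mono' hD fun y hy => setLIntegral_segment_le hs2 hs1 hh hy
      _ = _ := by rw [setLIntegral_const]; ring
  · calc _ ≤ ∫⁻ _y in dyadic k v, 2 ^ n * ∫⁻ x in dyadic k v, h x := by
          refine setLIntegral_mono' hD fun x hx => ?_
          have := setLIntegral_segment_le (s := 1 - s) (by linarith) (by linarith) hh hx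
          simpa [add_comm] using this
      _ = _ := by rw [setLIntegral_const]; ring

lemma enorm_gradient {f : Space n → ℝ} (x : Space n) : ‖gradient f x‖ₑ = ‖fderiv ℝ f x‖ₑ := by
  rw [← toDual_gradient, ← ofReal_norm, ← ofReal_norm, LinearIsometryEquiv.norm_map]

lemma continuous_gradient {f : Space n → ℝ} (hf : ContDiff ℝ 1 f) : Continuous (gradient f) :=
  (InnerProductSpace.toDual ℝ (Space n)).symm.continuous.comp (hf.continuous_fderiv (by simp))

lemma enorm_sub_pow_four_le {f : Space n → ℝ} (hf : ContDiff ℝ 1 f) {k : ℤ} {v : Fin n → ℤ}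
    {x y : Space n} (hx : x ∈ dyadic k v) (hy : y ∈ dyadic k v) :
    ‖f x - f y‖ₑ ^ 4 ≤ ENNReal.ofReal (n * 2 ^ (-k)) ^ 4 *
      ∫⁻ s in Icc (0 : ℝ) 1, ‖gradient f (s • x + (1 - s) • y)‖ₑ ^ 4 := by
  have hd : ∀ s : ℝ, HasDerivAt (fun s : ℝ => f (s • x + (1 - s) • y))
      (fderiv ℝ f (s • x + (1 - s) • y) (x - y)) s := by
    intro s
    have h1 : HasDerivAt (fun s : ℝ => s • x + (1 - s) • y) (x - y) s := by
      have := ((hasDerivAt_id s).smul_const x).add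
        (((hasDerivAt_id s).const_sub 1).smul_const y)
      exact this.congr_deriv (by simp [sub_eq_add_neg])
    exact ((hf.differentiable (by simp)) _).hasFDerivAt.comp_hasDerivAt s h1
  have hcont : Continuous fun s : ℝ => fderiv ℝ f (s • x + (1 - s) • y) :=
    (hf.continuous_fderiv (by simp)).comp (by fun_prop)
  have hint := intervalIntegral.integral_eq_sub_of_hasDerivAt (a := 0) (b := 1)
    (fun s _ => hd s) ((hcont.clm_apply continuous_const).intervalIntegrable 0 1)
  have h1 : ‖f x - f y‖ₑ ≤ ∫⁻ s in Icc (0 : ℝ) 1,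
      ‖gradient f (s • x + (1 - s) • y)‖ₑ * ENNReal.ofReal (n * 2 ^ (-k)) := by
    have h2 : f x - f y = ∫ s in (0 : ℝ)..1, fderiv ℝ f (s • x + (1 - s) • y) (x - y) := by
      rw [hint]; simp
    rw [h2, intervalIntegral.integral_of_le zero_le_one, ← integral_Icc_eq_integral_Ioc]
    refine (enorm_integral_le_lintegral_enorm _).trans (lintegral_mono fun s => ?_)
    rw [enorm_gradient]
    refine (ContinuousLinearMap.le_opENorm _ _).trans ?_
    gcongr
    rw [← ofReal_norm]
    exact ENNReal.ofReal_le_ofReal (norm_sub_le_of_mem_dyadic hx hy)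
  have hm : Measurable fun s : ℝ => ‖gradient f (s • x + (1 - s) • y)‖ₑ :=
    ((continuous_gradient hf).comp (by fun_prop)).enorm.measurable
  calc ‖f x - f y‖ₑ ^ 4 ≤ _ := pow_le_pow_left' h1 4
    _ = (∫⁻ s in Icc (0 : ℝ) 1, ‖gradient f (s • x + (1 - s) • y)‖ₑ) ^ 4
        * ENNReal.ofReal (n * 2 ^ (-k)) ^ 4 := by
        rw [lintegral_mul_const _ hm, mul_pow]
    _ ≤ (∫⁻ s in Icc (0 : ℝ) 1, ‖gradient f (s • x + (1 - s) • y)‖ₑ ^ 4)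
        * ENNReal.ofReal (n * 2 ^ (-k)) ^ 4 := by
        gcongr
        simpa using lintegral_pow_four_le (μ := volume.restrict (Icc (0 : ℝ) 1)) hm.aemeasurable
    _ = _ := mul_comm _ _

/-- The difference `f x - f y` is the integral of the gradient along the segment, which stays in the
cube. Jensen moves the fourth power inside, and Tonelli reduces the claim to the change of variables
at fixed `s`. -/
theorem poincare_dyadic {f : Space n → ℝ} (hf : ContDiff ℝ 1 f) (k : ℤ) (v : Fin n → ℤ) :
    ∫⁻ x in dyadic k v, ∫⁻ y in dyadic k v, ‖f x - f y‖ₑ ^ 4 ≤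
      ENNReal.ofReal (n * 2 ^ (-k)) ^ 4 *
        (2 ^ n * volume (dyadic k v) * ∫⁻ x in dyadic k v, ‖gradient f x‖ₑ ^ 4) := by
  have hD := measurableSet_dyadic k v
  have hB := fun (x : Space n) (hx : x ∈ dyadic k v) (y : Space n) (hy : y ∈ dyadic k v) =>
    enorm_sub_pow_four_le hf hx hy
  generalize ENNReal.ofReal (n * 2 ^ (-k)) ^ 4 = B at hB ⊢
  have hgr : Measurable fun x => ‖gradient f x‖ₑ ^ 4 :=
    (continuous_gradient hf).enorm.measurable.pow_const 4
  have hm : Measurable fun q : (Space n × Space n) × ℝ =>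
      ‖gradient f (q.2 • q.1.1 + (1 - q.2) • q.1.2)‖ₑ ^ 4 :=
    hgr.comp (Continuous.measurable (by fun_prop))
  have hm2 : Measurable fun q : (Space n × ℝ) × Space n =>
      ‖gradient f (q.1.2 • q.1.1 + (1 - q.1.2) • q.2)‖ₑ ^ 4 :=
    hgr.comp (Continuous.measurable (by fun_prop))
  have hm3 : ∀ x : Space n, Measurable fun q : Space n × ℝ =>
      ‖gradient f (q.2 • x + (1 - q.2) • q.1)‖ₑ ^ 4 := fun x =>
    hgr.comp (Continuous.measurable (by fun_prop))
  have hm4 : Measurable fun q : Space n × Space n =>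
      ∫⁻ s in Icc (0 : ℝ) 1, ‖gradient f (s • q.1 + (1 - s) • q.2)‖ₑ ^ 4 :=
    hm.lintegral_prod_right'
  have hm5 : Measurable fun q : Space n × ℝ =>
      ∫⁻ y in dyadic k v, ‖gradient f (q.2 • q.1 + (1 - q.2) • y)‖ₑ ^ 4 :=
    hm2.lintegral_prod_right'
  calc _ ≤ ∫⁻ x in dyadic k v, ∫⁻ y in dyadic k v, B *
        ∫⁻ s in Icc (0 : ℝ) 1, ‖gradient f (s • x + (1 - s) • y)‖ₑ ^ 4 :=
        setLIntegral_mono' hD fun x hx => setLIntegral_mono' hD fun y hy => hB x hx y hy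
    _ = B * ∫⁻ x in dyadic k v, ∫⁻ y in dyadic k v,
        ∫⁻ s in Icc (0 : ℝ) 1, ‖gradient f (s • x + (1 - s) • y)‖ₑ ^ 4 := by
        rw [← lintegral_const_mul B (f := fun x => ∫⁻ y in dyadic k v,
          ∫⁻ s in Icc (0 : ℝ) 1, ‖gradient f (s • x + (1 - s) • y)‖ₑ ^ 4)
          (Measurable.lintegral_prod_right' hm4)]
        refine lintegral_congr fun x => ?_
        have hm6 : Measurable ((fun q : Space n × Space n => ∫⁻ s in Icc (0 : ℝ) 1,
            ‖gradient f (s • q.1 + (1 - s) • q.2)‖ₑ ^ 4) ∘ Prod.mk x) :=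
          hm4.comp measurable_prodMk_left
        exact lintegral_const_mul B hm6
    _ = B * ∫⁻ x in dyadic k v, ∫⁻ s in Icc (0 : ℝ) 1, ∫⁻ y in dyadic k v,
        ‖gradient f (s • x + (1 - s) • y)‖ₑ ^ 4 := by
        congr 1
        exact lintegral_congr fun x => lintegral_lintegral_swap (hm3 x).aemeasurable
    _ = B * ∫⁻ s in Icc (0 : ℝ) 1, ∫⁻ x in dyadic k v, ∫⁻ y in dyadic k v,
        ‖gradient f (s • x + (1 - s) • y)‖ₑ ^ 4 := by
        congr 1
        exact lintegral_lintegral_swap hm5.aemeasurable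
    _ ≤ B * ∫⁻ _s in Icc (0 : ℝ) 1,
        (2 ^ n * volume (dyadic k v) * ∫⁻ x in dyadic k v, ‖gradient f x‖ₑ ^ 4) := by
        refine mul_le_mul_right (setLIntegral_mono' measurableSet_Icc fun s hs => ?_) B
        exact setLIntegral_setLIntegral_segment_le hs.1 hs.2 hgr k v
    _ = _ := by simp

end

section

variable {n : ℕ}

/-! ### Integration by parts -/

lemma inner_gradient (f : Space n → ℝ) (x e : Space n) :
    inner ℝ (gradient f x) e = fderiv ℝ f x e := by
  rw [← toDual_gradient, InnerProductSpace.toDual_apply_apply]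

lemma HasCompactSupport.gradient {f : Space n → ℝ} (hf : HasCompactSupport f) :
    HasCompactSupport (gradient f) :=
  (hf.fderiv ℝ).comp_left (map_zero (InnerProductSpace.toDual ℝ (Space n)).symm)

lemma integral_smul_gradient_eq_neg {f ψ : Space n → ℝ} (hf : ContDiff ℝ 1 f)
    (hψ : ContDiff ℝ 1 ψ) (hc : HasCompactSupport ψ) :
    ∫ x, f x • gradient ψ x = -∫ x, ψ x • gradient f x := by
  have h1 : Integrable fun x => f x • gradient ψ x :=
    (hf.continuous.smul (continuous_gradient hψ)).integrable_of_hasCompactSupport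
      (HasCompactSupport.gradient hc).smul_left
  have h2 : Integrable fun x => ψ x • gradient f x :=
    (hψ.continuous.smul (continuous_gradient hf)).integrable_of_hasCompactSupport hc.smul_right
  refine ext_inner_right ℝ fun e => ?_
  rw [inner_neg_left, real_inner_comm, ← integral_inner h1, real_inner_comm _ (∫ x, ψ x • _),
    ← integral_inner h2]
  have e1 : ∀ x, inner ℝ e (f x • gradient ψ x) = f x * fderiv ℝ ψ x e := fun x => by
    rw [real_inner_smul_right, real_inner_comm, inner_gradient]
  have e2 : ∀ x, inner ℝ e (ψ x • gradient f x) = fderiv ℝ f x e * ψ x := fun x => by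
    rw [real_inner_smul_right, real_inner_comm, inner_gradient, mul_comm]
  simp only [e1, e2]
  refine integral_mul_fderiv_eq_neg_fderiv_mul_of_integrable ?_ ?_ ?_
    (fun x _ => hf.differentiable (by simp) x) (fun x _ => hψ.differentiable (by simp) x)
  · exact ((h2.const_inner e).congr (ae_of_all _ e2))
  · exact ((h1.const_inner e).congr (ae_of_all _ e1))
  · exact (hf.continuous.mul hψ.continuous).integrable_of_hasCompactSupport hc.mul_left

/-! ### Averages of gradients over dyadic cubes -/

/-- A fixed bump function supported in the ball of radius `1 / 4`. -/
def refBump (n : ℕ) : ContDiffBump (0 : Space n) := ⟨1 / 8, 1 / 4, by norm_num, by norm_num⟩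

lemma ball_dyadicCenter_subset (k : ℤ) (v : Fin n → ℤ) :
    Metric.ball (dyadicCenter k v) (2 ^ (-k) / 4) ⊆ dyadic k v := by
  intro x hx
  rw [mem_dyadic_iff]
  intro i
  rw [mem_ball_iff_norm] at hx
  have h1 := (PiLp.norm_apply_le (x - dyadicCenter k v) i).trans hx.le
  have h2 : (x - dyadicCenter k v) i = x i - (v i + 1 / 2) * 2 ^ (-k) := rfl
  rw [h2, Real.norm_eq_abs, abs_le] at h1
  have : (0 : ℝ) < 2 ^ (-k) := by positivity
  constructor <;> nlinarith

/-- Test the mean `a` against a bump `ψ` adapted to the cube, with `∫ ψ` comparable to `ℓ ^ n`. In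
`∫ ψ a = ∫ ψ (a - ∇f) + ∫ ψ ∇f` the first term is at most the oscillation, `ℓ ^ n`. The second
equals `-∫ f ∇ψ` and is at most `(K/ℓ) ∫_Q |f|`, which by Cauchy–Schwarz is again of order `ℓ ^ n`.
The exponent `n + 2` in the energy hypothesis is exactly the one that makes this scale invariant. -/
theorem exists_norm_average_gradient_le (n : ℕ) : ∃ K : ℝ, 0 ≤ K ∧
    ∀ (f : Space n → ℝ) (k : ℤ) (v : Fin n → ℤ), ContDiff ℝ 1 f →
      DyadicOscLeOne (gradient f) →
      ∫⁻ x in dyadic k v, ‖f x‖ₑ ^ 2 ≤ 2 ^ (n + 2) * ENNReal.ofReal (2 ^ (-k)) ^ (n + 2) →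
      ‖⨍ x in dyadic k v, gradient f x‖ ≤ K := by
  have hb1 : ContDiff ℝ 1 (refBump n) := (refBump n).contDiff
  obtain ⟨K, hK⟩ := (hb1.continuous_fderiv (by simp)).bounded_above_of_compact_support
    ((refBump n).hasCompactSupport.fderiv ℝ)
  have hK0 : 0 ≤ K := (norm_nonneg _).trans (hK 0)
  have hI0 : 0 < ∫ x, refBump n x := (refBump n).integral_pos
  set I := ∫ x, refBump n x with hI
  refine ⟨(1 + K * 2 ^ (n + 2)) / I, by positivity, fun f k v hf hosc hE => ?_⟩
  set ℓ : ℝ := 2 ^ (-k) with hℓ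
  have hℓ0 : 0 < ℓ := by positivity
  set c := dyadicCenter k v
  set a := ⨍ x in dyadic k v, gradient f x with ha
  set H := gradient f with hH
  have hHc : Continuous H := continuous_gradient hf
  have hD := measurableSet_dyadic k v
  let ψ : Space n → ℝ := fun x => refBump n (ℓ⁻¹ • (x - c))
  have hψ : ContDiff ℝ 1 ψ := hb1.comp (by fun_prop)
  have hψ0 : ∀ x, 0 ≤ ψ x := fun x => (refBump n).nonneg
  have hψ1 : ∀ x, ψ x ≤ 1 := fun x => (refBump n).le_one
  have hψD : ∀ x ∉ Metric.ball c (ℓ / 4), ψ x = 0 := by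
    intro x hx
    refine (refBump n).zero_of_le_dist ?_
    rw [mem_ball_iff_norm, not_lt] at hx
    rw [dist_zero_right, norm_smul, norm_inv, Real.norm_of_nonneg hℓ0.le]
    rw [inv_mul_eq_div, le_div_iff₀ hℓ0]
    simp only [refBump]
    linarith
  have hψc : HasCompactSupport ψ := by
    refine HasCompactSupport.intro (isCompact_closedBall c (ℓ / 4)) fun x hx => hψD x fun h => ?_
    exact hx (Metric.ball_subset_closedBall h)
  -- The radius `ℓ / 4` is strictly below half the side, so even the closed support of `ψ` lies
  -- inside the half-open cube and the gradient vanishes off the cube.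
  have hψg : ∀ x, ‖gradient ψ x‖ₑ ≤ (dyadic k v).indicator
      (fun _ => ENNReal.ofReal (ℓ⁻¹ * K)) x := by
    intro x
    rw [enorm_gradient]
    by_cases hx : x ∈ dyadic k v
    · rw [indicator_of_mem hx, ← ofReal_norm]
      refine ENNReal.ofReal_le_ofReal ?_
      have h1 : HasFDerivAt (fun x : Space n => ℓ⁻¹ • (x - c))
          (ℓ⁻¹ • ContinuousLinearMap.id ℝ (Space n)) x :=
        ((hasFDerivAt_id x).sub_const c).const_smul ℓ⁻¹
      have h2 := ((hb1.differentiable (by simp)) (ℓ⁻¹ • (x - c))).hasFDerivAt.comp x h1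
      rw [show fderiv ℝ ψ x = _ from h2.fderiv]
      refine (ContinuousLinearMap.opNorm_comp_le _ _).trans ?_
      rw [mul_comm]
      refine mul_le_mul ?_ (hK _) (norm_nonneg _) (by positivity)
      rw [norm_smul, Real.norm_of_nonneg (by positivity)]
      exact mul_le_of_le_one_right (by positivity) ContinuousLinearMap.norm_id_le
    · rw [indicator_of_notMem hx]
      have h1 : x ∉ tsupport ψ := by
        intro h
        apply hx
        have h3 : tsupport ψ ⊆ Metric.closedBall c (ℓ / 4) := by
          refine closure_minimal (fun y hy => ?_) Metric.isClosed_closedBall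
          by_contra h4
          exact hy (hψD y fun h => h4 (Metric.ball_subset_closedBall h))
        have h4 := h3 h
        rw [mem_dyadic_iff]
        intro i
        rw [mem_closedBall_iff_norm] at h4
        have h1 := (PiLp.norm_apply_le (x - c) i).trans h4
        have h2 : (x - c) i = x i - (v i + 1 / 2) * ℓ := rfl
        rw [h2, Real.norm_eq_abs, abs_le] at h1
        constructor <;> nlinarith
      have h2 : fderiv ℝ ψ x = 0 := by
        by_contra h3
        exact h1 (support_fderiv_subset ℝ h3)
      rw [← ofReal_norm, h2, norm_zero, ENNReal.ofReal_zero]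
  have hint : ∫ x, ψ x = ℓ ^ n * I := by
    have h1 : ∫ x, ψ x = ∫ x, refBump n (ℓ⁻¹ • x) :=
      integral_sub_right_eq_self (fun x => refBump n (ℓ⁻¹ • x)) c
    rw [h1, Measure.integral_comp_smul_of_nonneg volume (refBump n) ℓ⁻¹ (hR := by positivity)]
    simp only [finrank_euclideanSpace, Fintype.card_fin, inv_pow, inv_inv, smul_eq_mul, hI]
  have hi1 : Integrable fun x => ψ x • (a - H x) :=
    (hψ.continuous.smul (continuous_const.sub hHc)).integrable_of_hasCompactSupport hψc.smul_right
  have hi2 : Integrable fun x => ψ x • H x :=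
    (hψ.continuous.smul hHc).integrable_of_hasCompactSupport hψc.smul_right
  have hsplit : (ℓ ^ n * I) • a = (∫ x, ψ x • (a - H x)) + ∫ x, ψ x • H x := by
    rw [← integral_add hi1 hi2, ← hint, ← integral_smul_const]
    refine integral_congr_ae (ae_of_all _ fun x => ?_)
    simp [smul_sub]
  have hb : ‖∫ x, ψ x • (a - H x)‖ₑ ≤ ENNReal.ofReal ℓ ^ n := by
    calc _ ≤ ∫⁻ x, ‖ψ x • (a - H x)‖ₑ := enorm_integral_le_lintegral_enorm _
      _ ≤ ∫⁻ x in dyadic k v, ‖H x - a‖ₑ := by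
        rw [← lintegral_indicator hD]
        refine lintegral_mono fun x => ?_
        by_cases hx : x ∈ dyadic k v
        · rw [indicator_of_mem hx, enorm_smul, enorm_sub_rev]
          refine mul_le_of_le_one_left' ?_
          rw [Real.enorm_of_nonneg (hψ0 x)]
          exact ENNReal.ofReal_le_one.2 (hψ1 x)
        · rw [hψD x fun h => hx (ball_dyadicCenter_subset k v h)]
          simp
      _ ≤ _ := (hosc k v).trans_eq (volume_dyadic k v)
  have hfD : ∫⁻ x in dyadic k v, ‖f x‖ₑ ≤ 2 ^ (n + 2) * ENNReal.ofReal ℓ ^ (n + 1) := by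
    have h1 := lintegral_sq_le (μ := volume.restrict (dyadic k v))
      hf.continuous.enorm.measurable.aemeasurable
    rw [Measure.restrict_apply_univ, volume_dyadic] at h1
    have h2 : (∫⁻ x in dyadic k v, ‖f x‖ₑ) ^ 2 ≤
        (2 ^ (n + 2) * ENNReal.ofReal ℓ ^ (n + 1)) ^ 2 := by
      calc _ ≤ _ := h1
        _ ≤ ENNReal.ofReal ℓ ^ n * (2 ^ (n + 2) * ENNReal.ofReal ℓ ^ (n + 2)) := by gcongr
        _ = 2 ^ (n + 2) * (ENNReal.ofReal ℓ ^ (n + 1)) ^ 2 := by ring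
        -- The factor `2 ^ (n + 2)` is replaced by its square so that the root is exact; the
        -- constant is not optimised.
        _ ≤ _ := by
          rw [mul_pow]
          have h3 : (1 : ℝ≥0∞) ≤ 2 ^ (n + 2) := one_le_pow₀ (by norm_num)
          refine mul_le_mul_left ?_ _
          exact le_self_pow₀ h3 (by norm_num)
    exact (ENNReal.pow_le_pow_left_iff (by norm_num)).1 h2
  have hb' : ‖∫ x, ψ x • H x‖ₑ ≤ ENNReal.ofReal (K * 2 ^ (n + 2)) * ENNReal.ofReal ℓ ^ n := by
    have h0 := integral_smul_gradient_eq_neg hf hψ hψc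
    rw [← enorm_neg, ← h0]
    calc _ ≤ ∫⁻ x, ‖f x • gradient ψ x‖ₑ := enorm_integral_le_lintegral_enorm _
      _ ≤ ∫⁻ x in dyadic k v, ‖f x‖ₑ * ENNReal.ofReal (ℓ⁻¹ * K) := by
        rw [← lintegral_indicator hD]
        refine lintegral_mono fun x => ?_
        have := hψg x
        by_cases hx : x ∈ dyadic k v
        · rw [indicator_of_mem hx] at this ⊢
          rw [enorm_smul]
          gcongr
        · rw [indicator_of_notMem hx] at this ⊢
          rw [enorm_smul, le_zero_iff.1 this, mul_zero]
      _ ≤ 2 ^ (n + 2) * ENNReal.ofReal ℓ ^ (n + 1) * ENNReal.ofReal (ℓ⁻¹ * K) := by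
        rw [lintegral_mul_const _ hf.continuous.enorm.measurable]
        gcongr
      _ = _ := by
        rw [show (2 : ℝ≥0∞) = ENNReal.ofReal 2 by simp]
        simp only [← ENNReal.ofReal_pow hℓ0.le, ← ENNReal.ofReal_pow (zero_le_two (α := ℝ))]
        rw [← ENNReal.ofReal_mul (by positivity), ← ENNReal.ofReal_mul (by positivity),
          ← ENNReal.ofReal_mul (by positivity)]
        congr 1
        field_simp
        ring
  have hfin : ENNReal.ofReal (ℓ ^ n * (I * ‖a‖)) ≤ ENNReal.ofReal (ℓ ^ n * (1 + K * 2 ^ (n + 2))) := by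
    calc _ = ‖(ℓ ^ n * I) • a‖ₑ := by
          rw [← ofReal_norm, norm_smul, Real.norm_of_nonneg (by positivity), mul_assoc]
      _ ≤ _ := by
        rw [hsplit]
        refine (enorm_add_le _ _).trans ((add_le_add hb hb').trans_eq ?_)
        rw [← ENNReal.ofReal_pow hℓ0.le, ← ENNReal.ofReal_mul (by positivity),
          ← ENNReal.ofReal_add (by positivity) (by positivity)]
        congr 1; ring
  rw [ENNReal.ofReal_le_ofReal_iff (by positivity)] at hfin
  rw [le_div_iff₀ hI0, mul_comm]
  exact le_of_mul_le_mul_left hfin (by positivity)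

end

section

variable {n : ℕ}

/-! ### Product estimate on one dyadic cube -/

lemma add_pow_four_le (a b : ℝ≥0∞) : (a + b) ^ 4 ≤ 16 * (a ^ 4 + b ^ 4) := by
  have h : ∀ a b : ℝ≥0∞, a ≤ b → (a + b) ^ 4 ≤ 16 * (a ^ 4 + b ^ 4) := fun a b hab =>
    calc (a + b) ^ 4 ≤ (b + b) ^ 4 := by gcongr
      _ = 16 * b ^ 4 := by ring
      _ ≤ _ := by gcongr; exact le_add_self
  rcases le_total a b with hab | hab
  · exact h a b hab
  · rw [add_comm, add_comm (a ^ 4)]; exact h b a hab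

lemma lintegral_exp_norm_le {H : Space n → Space n} (hc : Continuous H) (hosc : DyadicOscLeOne H)
    {K : ℝ} {k : ℤ} {v : Fin n → ℤ} (hK : ‖⨍ x in dyadic k v, H x‖ ≤ K) :
    ∫⁻ x in dyadic k v, ENNReal.ofReal (Real.exp (jnExp n * ‖H x‖)) ≤
      ENNReal.ofReal (Real.exp (jnExp n * K)) * 5 * volume (dyadic k v) := by
  set a := ⨍ x in dyadic k v, H x
  calc _ ≤ ∫⁻ x in dyadic k v, ENNReal.ofReal (Real.exp (jnExp n * K)) *
        ENNReal.ofReal (Real.exp (jnExp n * ‖H x - a‖)) := by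
        refine lintegral_mono fun x => ?_
        rw [← ENNReal.ofReal_mul (Real.exp_pos _).le, ← Real.exp_add]
        refine ENNReal.ofReal_le_ofReal (Real.exp_le_exp.2 ?_)
        have := norm_le_norm_sub_add (H x) a
        have h2 := jnExp_pos n
        rw [← mul_add]
        exact mul_le_mul_of_nonneg_left (by linarith) h2.le
    _ ≤ _ := by
        rw [lintegral_const_mul _ (Measurable.ennreal_ofReal (Continuous.measurable (by fun_prop))), mul_assoc]
        gcongr
        exact lintegral_exp_johnNirenberg_le hc hosc k v

lemma enorm_pow_four_le_exp {γ : ℝ} (hγ : 0 < γ) (y : Space n) :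
    ‖y‖ₑ ^ 4 ≤ ENNReal.ofReal (24 / γ ^ 4) * ENNReal.ofReal (Real.exp (γ * ‖y‖)) := by
  rw [← ofReal_norm, ← ENNReal.ofReal_pow (norm_nonneg _), ← ENNReal.ofReal_mul (by positivity)]
  refine ENNReal.ofReal_le_ofReal ?_
  have h := Real.pow_div_factorial_le_exp (γ * ‖y‖) (by positivity) 4
  have h4 : ((4 : ℕ).factorial : ℝ) = 24 := by norm_num [Nat.factorial]
  rw [h4, div_le_iff₀ (by norm_num)] at h
  rw [div_mul_eq_mul_div, le_div_iff₀ (by positivity)]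
  calc ‖y‖ ^ 4 * γ ^ 4 = (γ * ‖y‖) ^ 4 := by ring
    _ ≤ _ := by linarith

/-- Compare `f x` with its values over the cube: Poincaré controls the differences, and the `L²`
hypothesis controls the mean. Both contributions scale like `ℓ ^ 4` times the volume. The factor `V
^ 4` is carried along and cancelled at the end, instead of dividing by the volume. -/
lemma lintegral_pow_four_dyadic_le {f : Space n → ℝ} (hf : ContDiff ℝ 1 f) {M : ℝ≥0∞}
    {k : ℤ} {v : Fin n → ℤ}
    (hM : ∫⁻ x in dyadic k v, ‖gradient f x‖ₑ ^ 4 ≤ M * volume (dyadic k v))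
    (hE : ∫⁻ x in dyadic k v, ‖f x‖ₑ ^ 2 ≤ 2 ^ (n + 2) * ENNReal.ofReal (2 ^ (-k)) ^ (n + 2)) :
    ∫⁻ x in dyadic k v, ‖f x‖ₑ ^ 4 ≤
      16 * (n ^ 4 * 2 ^ n * M + 4 ^ (n + 2)) * ENNReal.ofReal (2 ^ (-k)) ^ 4 *
        volume (dyadic k v) := by
  set V := volume (dyadic k v) with hV
  have hV0 : V ≠ 0 := volume_dyadic_ne_zero k v
  have hVt : V ≠ ∞ := volume_dyadic_ne_top k v
  set ℓ := ENNReal.ofReal (2 ^ (-k)) with hℓ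
  have hVℓ : V = ℓ ^ n := volume_dyadic k v
  have hm : Measurable fun x => ‖f x‖ₑ := hf.continuous.enorm.measurable
  have hm2 : ∀ x, Measurable fun y => ‖f x - f y‖ₑ := fun x =>
    (continuous_const.sub hf.continuous).enorm.measurable
  have hpt : ∀ x, V ^ 4 * ‖f x‖ₑ ^ 4 ≤
      16 * V ^ 3 * ((∫⁻ y in dyadic k v, ‖f x - f y‖ₑ ^ 4) + V * ℓ ^ 4 * 4 ^ (n + 2)) := by
    intro x
    have h1 : V * ‖f x‖ₑ ≤
        (∫⁻ y in dyadic k v, ‖f x - f y‖ₑ) + ∫⁻ y in dyadic k v, ‖f y‖ₑ := by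
      rw [← lintegral_add_left (hm2 x), mul_comm, hV, ← setLIntegral_const]
      refine lintegral_mono fun y => ?_
      calc ‖f x‖ₑ = ‖(f x - f y) + f y‖ₑ := by rw [sub_add_cancel]
        _ ≤ _ := enorm_add_le _ _
    have h2 : (∫⁻ y in dyadic k v, ‖f x - f y‖ₑ) ^ 4 ≤
        V ^ 3 * ∫⁻ y in dyadic k v, ‖f x - f y‖ₑ ^ 4 := by
      simpa using lintegral_pow_four_le (μ := volume.restrict (dyadic k v)) (hm2 x).aemeasurable
    have h3 : (∫⁻ y in dyadic k v, ‖f y‖ₑ) ^ 4 ≤ V ^ 3 * (V * ℓ ^ 4 * 4 ^ (n + 2)) := by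
      have h4 : (∫⁻ y in dyadic k v, ‖f y‖ₑ) ^ 2 ≤ V * ∫⁻ y in dyadic k v, ‖f y‖ₑ ^ 2 := by
        simpa using lintegral_sq_le (μ := volume.restrict (dyadic k v)) hm.aemeasurable
      calc (∫⁻ y in dyadic k v, ‖f y‖ₑ) ^ 4 = ((∫⁻ y in dyadic k v, ‖f y‖ₑ) ^ 2) ^ 2 := by ring
        _ ≤ (V * (2 ^ (n + 2) * ℓ ^ (n + 2))) ^ 2 := by gcongr; exact h4.trans (by gcongr)
        _ = V ^ 3 * (V * ℓ ^ 4 * 4 ^ (n + 2)) := by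
          rw [show (4 : ℝ≥0∞) ^ (n + 2) = (2 ^ (n + 2)) ^ 2 by
            rw [← pow_mul, mul_comm, pow_mul]; norm_num, hVℓ]
          ring
    calc V ^ 4 * ‖f x‖ₑ ^ 4 = (V * ‖f x‖ₑ) ^ 4 := by ring
      _ ≤ _ := pow_le_pow_left' h1 4
      _ ≤ _ := add_pow_four_le _ _
      _ ≤ 16 * (V ^ 3 * (∫⁻ y in dyadic k v, ‖f x - f y‖ₑ ^ 4) +
          V ^ 3 * (V * ℓ ^ 4 * 4 ^ (n + 2))) := by gcongr
      _ = _ := by ring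
  have hm4 : Measurable fun q : Space n × Space n => ‖f q.1 - f q.2‖ₑ ^ 4 :=
    ((hf.continuous.comp continuous_fst).sub
      (hf.continuous.comp continuous_snd)).enorm.measurable.pow_const 4
  have hint : V ^ 4 * ∫⁻ x in dyadic k v, ‖f x‖ₑ ^ 4 ≤
      V ^ 4 * (16 * (n ^ 4 * 2 ^ n * M + 4 ^ (n + 2)) * ℓ ^ 4 * V) := by
    calc V ^ 4 * ∫⁻ x in dyadic k v, ‖f x‖ₑ ^ 4
        = ∫⁻ x in dyadic k v, V ^ 4 * ‖f x‖ₑ ^ 4 := (lintegral_const_mul _ (hm.pow_const 4)).symm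
      _ ≤ ∫⁻ x in dyadic k v, 16 * V ^ 3 * ((∫⁻ y in dyadic k v, ‖f x - f y‖ₑ ^ 4) +
          V * ℓ ^ 4 * 4 ^ (n + 2)) := lintegral_mono hpt
      _ = 16 * V ^ 3 * ((∫⁻ x in dyadic k v, ∫⁻ y in dyadic k v, ‖f x - f y‖ₑ ^ 4) +
          V * ℓ ^ 4 * 4 ^ (n + 2) * V) := by
          have hm5 : Measurable fun x => ∫⁻ y in dyadic k v, ‖f x - f y‖ₑ ^ 4 :=
            hm4.lintegral_prod_right'
          rw [lintegral_const_mul _ (hm5.add_const _), lintegral_add_left hm5, setLIntegral_const]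
      _ ≤ 16 * V ^ 3 * (ENNReal.ofReal (n * 2 ^ (-k)) ^ 4 * (2 ^ n * V * (M * V)) +
          V * ℓ ^ 4 * 4 ^ (n + 2) * V) := by
          gcongr
          exact (poincare_dyadic hf k v).trans (by gcongr)
      _ = _ := by
          rw [ENNReal.ofReal_mul (by positivity), ENNReal.ofReal_natCast]
          ring
  exact (ENNReal.mul_le_mul_iff_right (by positivity) (by finiteness)).1 hint

/-- The source of the logarithm. If `b ≤ 4L`, the term `L²ψ²` suffices. Otherwise `e^{-b/4} ≤ τ` and
`b² ≤ 32 e^{b/4}`. When `ψ² ≤ e^{b/2}` the product is at most `32 e^{3b/4} ≤ 32 τ e^b`; when `ψ² ≥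
e^{b/2}` it is at most `32 ψ⁴ e^{-b/4} ≤ 32 τ ψ⁴`. -/
lemma sq_mul_sq_le_of_exp {ψ b τ L : ℝ} (hb : 0 ≤ b) (hL : 1 ≤ L)
    (hτL : Real.exp (-L) ≤ τ) :
    ψ ^ 2 * b ^ 2 ≤ 32 * (L ^ 2 * ψ ^ 2 + τ * (Real.exp b + ψ ^ 4)) := by
  have hτ : 0 < τ := (Real.exp_pos _).trans_le hτL
  have hp : 0 ≤ τ * (Real.exp b + ψ ^ 4) := by positivity
  rcases le_total b (4 * L) with h | h
  · have : b ^ 2 ≤ 16 * L ^ 2 := by nlinarith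
    have := mul_le_mul_of_nonneg_left this (sq_nonneg ψ)
    nlinarith [sq_nonneg (L * ψ)]
  · have hb4 : Real.exp (-(b / 4)) ≤ τ :=
      (Real.exp_le_exp.2 (by linarith)).trans hτL
    have hb2 : b ^ 2 ≤ 32 * Real.exp (b / 4) := by
      have := Real.pow_div_factorial_le_exp (b / 4) (by positivity) 2
      norm_num at this
      linarith
    have hLp : 0 ≤ L ^ 2 * ψ ^ 2 := by positivity
    rcases le_total (ψ ^ 2) (Real.exp (b / 2)) with h2 | h2
    · have h3 : ψ ^ 2 * b ^ 2 ≤ Real.exp (b / 2) * (32 * Real.exp (b / 4)) :=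
        mul_le_mul h2 hb2 (by positivity) (by positivity)
      have h4 : Real.exp (b / 2) * Real.exp (b / 4) = Real.exp (-(b / 4)) * Real.exp b := by
        rw [← Real.exp_add, ← Real.exp_add]; congr 1; ring
      have h5 : Real.exp (-(b / 4)) * Real.exp b ≤ τ * Real.exp b := by gcongr
      have h6 : 0 ≤ τ * ψ ^ 4 := by positivity
      nlinarith
    · have h3 : 1 ≤ ψ ^ 2 * Real.exp (-(b / 2)) := by
        rw [Real.exp_neg, ← div_eq_mul_inv, one_le_div (Real.exp_pos _)]
        exact h2
      have h4 : ψ ^ 2 * b ^ 2 ≤ ψ ^ 2 * b ^ 2 * (ψ ^ 2 * Real.exp (-(b / 2))) :=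
        le_mul_of_one_le_right (by positivity) h3
      have h5 : ψ ^ 2 * b ^ 2 * (ψ ^ 2 * Real.exp (-(b / 2))) ≤
          ψ ^ 4 * (32 * Real.exp (b / 4)) * Real.exp (-(b / 2)) := by
        have := mul_le_mul_of_nonneg_left hb2 (show 0 ≤ ψ ^ 4 * Real.exp (-(b / 2)) by positivity)
        nlinarith
      have h6 : Real.exp (b / 4) * Real.exp (-(b / 2)) = Real.exp (-(b / 4)) := by
        rw [← Real.exp_add]; congr 1; ring
      have h7 : ψ ^ 4 * Real.exp (-(b / 4)) ≤ τ * ψ ^ 4 := by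
        rw [mul_comm]; gcongr
      have h8 : 0 ≤ τ * Real.exp b := by positivity
      nlinarith

lemma enorm_sq_mul_enorm_sq_le {γ ℓ τ L : ℝ} (hγ : 0 < γ) (hℓ : 0 < ℓ) (hL : 1 ≤ L)
    (hτL : Real.exp (-L) ≤ τ) (a : ℝ) (y : Space n) :
    ‖a‖ₑ ^ 2 * ‖y‖ₑ ^ 2 ≤ ENNReal.ofReal (32 / γ ^ 2) * (ENNReal.ofReal (L ^ 2) * ‖a‖ₑ ^ 2 +
      ENNReal.ofReal τ * (ENNReal.ofReal ℓ ^ 2 * ENNReal.ofReal (Real.exp (γ * ‖y‖)) +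
        ENNReal.ofReal (ℓ ^ 2)⁻¹ * ‖a‖ₑ ^ 4)) := by
  have hτ : 0 < τ := (Real.exp_pos _).trans_le hτL
  rw [← ofReal_norm, ← ofReal_norm]
  simp only [← ENNReal.ofReal_pow (norm_nonneg _), ← ENNReal.ofReal_pow hℓ.le]
  rw [← ENNReal.ofReal_mul (by positivity), ← ENNReal.ofReal_mul (by positivity),
    ← ENNReal.ofReal_mul (by positivity), ← ENNReal.ofReal_mul (by positivity),
    ← ENNReal.ofReal_add (by positivity) (by positivity), ← ENNReal.ofReal_mul (by positivity),
    ← ENNReal.ofReal_add (by positivity) (by positivity), ← ENNReal.ofReal_mul (by positivity)]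
  refine ENNReal.ofReal_le_ofReal ?_
  -- Dividing `a` by the side `ℓ` makes its fourth power comparable to the exponential term on a
  -- selected cube; `γ` is the John–Nirenberg exponent.
  have h := sq_mul_sq_le_of_exp (ψ := ‖a‖ / ℓ) (b := γ * ‖y‖) (by positivity) hL hτL
  have h2 := mul_le_mul_of_nonneg_left h (show 0 ≤ ℓ ^ 2 / γ ^ 2 by positivity)
  calc ‖a‖ ^ 2 * ‖y‖ ^ 2 = ℓ ^ 2 / γ ^ 2 * ((‖a‖ / ℓ) ^ 2 * (γ * ‖y‖) ^ 2) := by field_simp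
    _ ≤ _ := h2
    _ = _ := by field_simp

/-- The exponential integral of `∇g`, weighted by `ℓ²`, and the fourth power of `f`, weighted by
`ℓ⁻²`, are both of order `ℓ ^ (n + 2)`. Hence the remainder in the pointwise inequality costs `τ ℓ ^
(n + 2)`. -/
theorem exists_product_dyadic_le (n : ℕ) : ∃ C : ℝ≥0∞, C ≠ ∞ ∧
    ∀ (f g : Space n → ℝ) (k : ℤ) (v : Fin n → ℤ) (τ L : ℝ), ContDiff ℝ 1 f → ContDiff ℝ 1 g →
      DyadicOscLeOne (gradient f) → DyadicOscLeOne (gradient g) →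
      ∫⁻ x in dyadic k v, ‖f x‖ₑ ^ 2 ≤ 2 ^ (n + 2) * ENNReal.ofReal (2 ^ (-k)) ^ (n + 2) →
      ∫⁻ x in dyadic k v, ‖g x‖ₑ ^ 2 ≤ 2 ^ (n + 2) * ENNReal.ofReal (2 ^ (-k)) ^ (n + 2) →
      1 ≤ L → Real.exp (-L) ≤ τ →
      ∫⁻ x in dyadic k v, ‖f x‖ₑ ^ 2 * ‖gradient g x‖ₑ ^ 2 ≤
        C * (ENNReal.ofReal (L ^ 2) * (∫⁻ x in dyadic k v, ‖f x‖ₑ ^ 2) +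
          ENNReal.ofReal τ * ENNReal.ofReal (2 ^ (-k)) ^ (n + 2)) := by
  obtain ⟨K, hK0, hK⟩ := exists_norm_average_gradient_le n
  set γ := jnExp n with hγ
  have hγ0 : 0 < γ := jnExp_pos n
  set B : ℝ≥0∞ := ENNReal.ofReal (Real.exp (γ * K)) * 5 with hB
  set M : ℝ≥0∞ := ENNReal.ofReal (24 / γ ^ 4) * B with hM
  set N : ℝ≥0∞ := 16 * (n ^ 4 * 2 ^ n * M + 4 ^ (n + 2)) with hN
  refine ⟨ENNReal.ofReal (32 / γ ^ 2) * (1 + (B + N)), by finiteness, ?_⟩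
  intro f g k v τ L hf hg hof hog hEf hEg hL hτL
  set ℓ : ℝ := 2 ^ (-k) with hℓ
  have hℓ0 : 0 < ℓ := by positivity
  have hV : volume (dyadic k v) = ENNReal.ofReal ℓ ^ n := volume_dyadic k v
  have hexpf := lintegral_exp_norm_le (continuous_gradient hf) hof (hK f k v hf hof hEf)
  have hexpg := lintegral_exp_norm_le (continuous_gradient hg) hog (hK g k v hg hog hEg)
  have hf4 : ∫⁻ x in dyadic k v, ‖gradient f x‖ₑ ^ 4 ≤ M * volume (dyadic k v) := by
    calc _ ≤ ∫⁻ x in dyadic k v, ENNReal.ofReal (24 / γ ^ 4) *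
          ENNReal.ofReal (Real.exp (γ * ‖gradient f x‖)) :=
          lintegral_mono fun x => enorm_pow_four_le_exp hγ0 _
      _ ≤ _ := by
          have := continuous_gradient hf
          rw [lintegral_const_mul _ (Measurable.ennreal_ofReal (Continuous.measurable (by fun_prop))), hM, mul_assoc]
          gcongr
  have hff := lintegral_pow_four_dyadic_le hf hf4 hEf
  have hm1 : Measurable fun x => ENNReal.ofReal (Real.exp (γ * ‖gradient g x‖)) := by
    have := continuous_gradient hg
    exact Measurable.ennreal_ofReal (Continuous.measurable (by fun_prop))
  have hm2 : Measurable fun x => ‖f x‖ₑ := hf.continuous.enorm.measurable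
  calc ∫⁻ x in dyadic k v, ‖f x‖ₑ ^ 2 * ‖gradient g x‖ₑ ^ 2
      ≤ ∫⁻ x in dyadic k v, ENNReal.ofReal (32 / γ ^ 2) * (ENNReal.ofReal (L ^ 2) * ‖f x‖ₑ ^ 2 +
        ENNReal.ofReal τ * (ENNReal.ofReal ℓ ^ 2 *
          ENNReal.ofReal (Real.exp (γ * ‖gradient g x‖)) +
        ENNReal.ofReal (ℓ ^ 2)⁻¹ * ‖f x‖ₑ ^ 4)) :=
        lintegral_mono fun x => enorm_sq_mul_enorm_sq_le hγ0 hℓ0 hL hτL _ _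
    _ = ENNReal.ofReal (32 / γ ^ 2) * (ENNReal.ofReal (L ^ 2) *
        (∫⁻ x in dyadic k v, ‖f x‖ₑ ^ 2) + ENNReal.ofReal τ * (ENNReal.ofReal ℓ ^ 2 *
          (∫⁻ x in dyadic k v, ENNReal.ofReal (Real.exp (γ * ‖gradient g x‖))) +
        ENNReal.ofReal (ℓ ^ 2)⁻¹ * ∫⁻ x in dyadic k v, ‖f x‖ₑ ^ 4)) := by
        rw [lintegral_const_mul _ (by fun_prop), lintegral_add_left (by fun_prop),
          lintegral_const_mul _ (by fun_prop), lintegral_const_mul _ (by fun_prop),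
          lintegral_add_left (by fun_prop), lintegral_const_mul _ (by fun_prop),
          lintegral_const_mul _ (by fun_prop)]
    _ ≤ ENNReal.ofReal (32 / γ ^ 2) * (ENNReal.ofReal (L ^ 2) *
        (∫⁻ x in dyadic k v, ‖f x‖ₑ ^ 2) + ENNReal.ofReal τ * (ENNReal.ofReal ℓ ^ 2 *
          (B * ENNReal.ofReal ℓ ^ n) +
        ENNReal.ofReal (ℓ ^ 2)⁻¹ * (N * ENNReal.ofReal ℓ ^ 4 * ENNReal.ofReal ℓ ^ n))) := by
        rw [hV] at hexpg hff
        gcongr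
    _ = ENNReal.ofReal (32 / γ ^ 2) * (ENNReal.ofReal (L ^ 2) *
        (∫⁻ x in dyadic k v, ‖f x‖ₑ ^ 2) +
          (B + N) * (ENNReal.ofReal τ * ENNReal.ofReal ℓ ^ (n + 2))) := by
        have : ENNReal.ofReal (ℓ ^ 2)⁻¹ * ENNReal.ofReal ℓ ^ 4 = ENNReal.ofReal ℓ ^ 2 := by
          rw [← ENNReal.ofReal_pow hℓ0.le, ← ENNReal.ofReal_pow hℓ0.le,
            ← ENNReal.ofReal_mul (by positivity)]
          congr 1; field_simp
        rw [show ENNReal.ofReal (ℓ ^ 2)⁻¹ * (N * ENNReal.ofReal ℓ ^ 4 * ENNReal.ofReal ℓ ^ n)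
          = (ENNReal.ofReal (ℓ ^ 2)⁻¹ * ENNReal.ofReal ℓ ^ 4) * N * ENNReal.ofReal ℓ ^ n by ring,
          this]
        ring
    _ ≤ _ := by
        rw [mul_assoc]
        refine mul_le_mul_right ?_ _
        rw [mul_add]
        refine add_le_add ?_ ?_
        · exact le_mul_of_one_le_left' le_self_add
        · exact mul_le_mul_left le_add_self _

end

section

variable {n : ℕ}

/-! ### The product estimate for smooth functions -/

/-- The stopping rule serves twice. The failure of the parent gives the upper mass bound needed on
each cube, and the selection gives `ℓ ^ (n + 2) ≤ ∫_Q e`, so the errors sum to `τ ∫ e`. The weight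
`κ` forces every point into a selected cube, even where `f` and `g` vanish. -/
lemma exists_product_le_of_weight (n : ℕ) : ∃ C : ℝ≥0∞, C ≠ ∞ ∧
    ∀ (f g κ : Space n → ℝ) (τ L : ℝ), ContDiff ℝ 1 f → ContDiff ℝ 1 g →
      DyadicOscLeOne (gradient f) → DyadicOscLeOne (gradient g) →
      Continuous κ → (∀ x, 0 < κ x) → 1 ≤ L → Real.exp (-L) ≤ τ →
      (∫⁻ x, ‖f x‖ₑ ^ 2) + (∫⁻ x, ‖g x‖ₑ ^ 2) + (∫⁻ x, ENNReal.ofReal (κ x)) ≠ ∞ →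
      ∫⁻ x, ‖f x‖ₑ ^ 2 * ‖gradient g x‖ₑ ^ 2 ≤
        C * (ENNReal.ofReal (L ^ 2) * (∫⁻ x, ‖f x‖ₑ ^ 2) + ENNReal.ofReal τ *
          ((∫⁻ x, ‖f x‖ₑ ^ 2) + (∫⁻ x, ‖g x‖ₑ ^ 2) + (∫⁻ x, ENNReal.ofReal (κ x)))) := by
  obtain ⟨C, hC, hprod⟩ := exists_product_dyadic_le n
  refine ⟨C, hC, fun f g κ τ L hf hg hof hog hκ hκ0 hL hτL hfin => ?_⟩
  have hmf : Measurable fun x => ‖f x‖ₑ ^ 2 := hf.continuous.enorm.measurable.pow_const 2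
  have hmg : Measurable fun x => ‖g x‖ₑ ^ 2 := hg.continuous.enorm.measurable.pow_const 2
  set e : Space n → ℝ≥0∞ := fun x => ‖f x‖ₑ ^ 2 + ‖g x‖ₑ ^ 2 + ENNReal.ofReal (κ x) with he
  have hE : (∫⁻ x, ‖f x‖ₑ ^ 2) + (∫⁻ x, ‖g x‖ₑ ^ 2) + (∫⁻ x, ENNReal.ofReal (κ x))
      = ∫⁻ x, e x := by
    rw [← lintegral_add_left hmf,
      ← lintegral_add_left (f := fun x => ‖f x‖ₑ ^ 2 + ‖g x‖ₑ ^ 2) (hmf.add hmg)]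
  rw [hE] at hfin ⊢
  let S : Set (ℤ × (Fin n → ℤ)) :=
    {p | ENNReal.ofReal (2 ^ (-p.1)) ^ (n + 2) ≤ ∫⁻ x in dyadic p.1 p.2, e x}
  have hsmall : ∀ p ∈ maximalDyadic S, ∫⁻ x in dyadic p.1 p.2, e x ≤
      2 ^ (n + 2) * ENNReal.ofReal (2 ^ (-p.1)) ^ (n + 2) := by
    rintro ⟨k, v⟩ hp
    obtain ⟨x, hx⟩ := dyadic_nonempty k v
    have h1 : (k - 1, dyadicIndex (k - 1) x) ∉ S := hp.2 (k - 1) (by simp) x hx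
    have h2 : ∫⁻ x in dyadic (k - 1) (dyadicIndex (k - 1) x), e x <
        ENNReal.ofReal (2 ^ (-(k - 1))) ^ (n + 2) := not_le.1 h1
    refine (lintegral_mono_set (dyadic_subset (by lia) hx (mem_dyadic_self _ x))).trans
      (h2.le.trans_eq ?_)
    rw [← mul_pow]
    congr 1
    rw [show -(k - 1) = -k + 1 by ring, zpow_add₀ (by norm_num), zpow_one, mul_comm,
      ENNReal.ofReal_mul (by norm_num)]
    simp
  have hcover : ∀ x, ∃ p ∈ maximalDyadic S, x ∈ dyadic p.1 p.2 := by
    intro x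
    -- On small cubes around `x` the weight exceeds some `d > 0`, so the mass is at least `d ℓ ^ n`,
    -- which beats `ℓ ^ (n + 2)` once `ℓ² < d`.
    have hup : ∃ k, (k, dyadicIndex k x) ∈ S := by
      obtain ⟨d, hd0, hd⟩ := exists_between (hκ0 x)
      have hev : ∀ᶠ y in 𝓝 x, d < κ y := hκ.continuousAt.eventually (lt_mem_nhds hd)
      have hsq : Tendsto (fun k : ℤ => ((2 : ℝ) ^ (-k)) ^ 2) atTop (𝓝 0) := by
        simpa using tendsto_two_zpow_neg.pow 2
      obtain ⟨k, hk, hkd⟩ :=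
        ((eventually_dyadic_forall hev).and (hsq.eventually (gt_mem_nhds hd0))).exists
      refine ⟨k, ?_⟩
      calc ENNReal.ofReal (2 ^ (-k)) ^ (n + 2)
          = ENNReal.ofReal (((2 : ℝ) ^ (-k)) ^ 2) * volume (dyadic k (dyadicIndex k x)) := by
            rw [volume_dyadic, ENNReal.ofReal_pow (by positivity)]; ring
        _ ≤ ENNReal.ofReal d * volume (dyadic k (dyadicIndex k x)) := by gcongr
        _ = ∫⁻ _y in dyadic k (dyadicIndex k x), ENNReal.ofReal d := by rw [setLIntegral_const]
        _ ≤ _ := by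
            refine setLIntegral_mono' (measurableSet_dyadic _ _) fun y hy => ?_
            exact (ENNReal.ofReal_le_ofReal (hk y hy).le).trans le_add_self
    -- Very large cubes are never selected, because the total mass is finite.
    have hlow : ∃ k₀ : ℤ, ∀ j < k₀, (j, dyadicIndex j x) ∉ S := by
      have h1 := (tendsto_pow_atTop (α := ℝ) (n := n + 2) (by lia)).comp
        tendsto_two_zpow_neg_atBot
      obtain ⟨k₀, hk₀⟩ := eventually_atBot.1 (h1.eventually_gt_atTop (∫⁻ x, e x).toReal)
      refine ⟨k₀, fun j hj hS => ?_⟩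
      have h2 : (∫⁻ x, e x).toReal < ((2 : ℝ) ^ (-j)) ^ (n + 2) := hk₀ j hj.le
      have h3 : ENNReal.ofReal (2 ^ (-j)) ^ (n + 2) ≤ ∫⁻ x, e x :=
        le_trans hS (setLIntegral_le_lintegral _ _)
      rw [← ENNReal.ofReal_pow (by positivity)] at h3
      have h4 := ENNReal.toReal_mono hfin h3
      rw [ENNReal.toReal_ofReal (by positivity)] at h4
      linarith
    obtain ⟨k, hk⟩ := hup
    obtain ⟨k₀, hk₀⟩ := hlow
    exact exists_mem_maximalDyadic hk hk₀
  have huniv : (⋃ p ∈ maximalDyadic S, dyadic p.1 p.2) = univ :=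
    eq_univ_of_forall fun x => by simpa using hcover x
  have hsum : ∀ h : Space n → ℝ≥0∞,
      ∫⁻ x, h x = ∑' p : maximalDyadic S, ∫⁻ x in dyadic p.1.1 p.1.2, h x := fun h => by
    rw [tsum_lintegral_maximalDyadic, huniv, setLIntegral_univ]
  calc ∫⁻ x, ‖f x‖ₑ ^ 2 * ‖gradient g x‖ₑ ^ 2
      = ∑' p : maximalDyadic S, ∫⁻ x in dyadic p.1.1 p.1.2, ‖f x‖ₑ ^ 2 * ‖gradient g x‖ₑ ^ 2 :=
        hsum _
    _ ≤ ∑' p : maximalDyadic S, C * (ENNReal.ofReal (L ^ 2) *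
          (∫⁻ x in dyadic p.1.1 p.1.2, ‖f x‖ₑ ^ 2) + ENNReal.ofReal τ *
          ∫⁻ x in dyadic p.1.1 p.1.2, e x) := by
        refine ENNReal.tsum_le_tsum fun p => ?_
        have h1 := hsmall p.1 p.2
        have h2 : ENNReal.ofReal (2 ^ (-p.1.1)) ^ (n + 2) ≤ ∫⁻ x in dyadic p.1.1 p.1.2, e x :=
          (maximalDyadic_subset S p.2)
        refine (hprod f g p.1.1 p.1.2 τ L hf hg hof hog ?_ ?_ hL hτL).trans (by gcongr)
        · refine (lintegral_mono fun x => ?_).trans h1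
          exact le_self_add.trans le_self_add
        · refine (lintegral_mono fun x => ?_).trans h1
          exact le_add_self.trans le_self_add
    _ = _ := by
        rw [ENNReal.tsum_mul_left, ENNReal.tsum_add, ENNReal.tsum_mul_left, ENNReal.tsum_mul_left,
          ← hsum, ← hsum]

lemma exists_weight (n : ℕ) {δ : ℝ≥0∞} (hδ : δ ≠ 0) : ∃ κ : Space n → ℝ, Continuous κ ∧
    (∀ x, 0 < κ x) ∧ ∫⁻ x, ENNReal.ofReal (κ x) ≤ δ := by
  have hint : Integrable fun x : Space n => (1 + ‖x‖) ^ (-((n : ℝ) + 1)) :=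
    integrable_one_add_norm (by simp)
  have hcont : Continuous fun x : Space n => (1 + ‖x‖) ^ (-((n : ℝ) + 1)) :=
    (continuous_const.add continuous_norm).rpow_const fun x =>
      Or.inl (add_pos_of_pos_of_nonneg one_pos (norm_nonneg x)).ne'
  have hpos : ∀ x : Space n, 0 < (1 + ‖x‖) ^ (-((n : ℝ) + 1)) := fun x =>
    Real.rpow_pos_of_pos (add_pos_of_pos_of_nonneg one_pos (norm_nonneg x)) _
  set I := ∫⁻ x : Space n, ENNReal.ofReal ((1 + ‖x‖) ^ (-((n : ℝ) + 1))) with hI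
  have hIt : I ≠ ∞ := hint.lintegral_lt_top.ne
  obtain ⟨c, hc0, hc⟩ : ∃ c : ℝ, 0 < c ∧ ENNReal.ofReal c ≤ δ / I := by
    have h0 : δ / I ≠ 0 := (ENNReal.div_pos hδ hIt).ne'
    obtain ⟨q, hq0, hq⟩ := ENNReal.lt_iff_exists_nnreal_btwn.1 (pos_iff_ne_zero.2 h0)
    exact ⟨q, by exact_mod_cast hq0, by simpa using hq.le⟩
  refine ⟨fun x => c * (1 + ‖x‖) ^ (-((n : ℝ) + 1)), continuous_const.mul hcont, fun x => ?_, ?_⟩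
  · exact mul_pos hc0 (hpos x)
  · simp_rw [ENNReal.ofReal_mul hc0.le]
    rw [lintegral_const_mul _ (Measurable.ennreal_ofReal hcont.measurable)]
    exact (mul_le_mul_left hc _).trans ((mul_comm _ _).trans_le ENNReal.mul_div_le)

/-! ### Rescaling to arbitrary oscillation bounds -/

/-- Every mean oscillation of `H` over a cube is at most `A`. -/
def OscLe {F : Type*} [NormedAddCommGroup F] [NormedSpace ℝ F] (H : Space n → F) (A : ℝ≥0∞) :
    Prop :=
  ∀ (c : Space n) (r : ℝ), 0 < r → meanOscillation H (cube c r) ≤ A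

section

variable {F : Type*} [NormedAddCommGroup F] [NormedSpace ℝ F]

lemma meanOscillation_const_smul (H : Space n → F) (Q : Set (Space n)) (a : ℝ) :
    meanOscillation (fun x => a • H x) Q = ‖a‖ₑ * meanOscillation H Q := by
  have h : ⨍ z in Q, a • H z = a • ⨍ z in Q, H z := by
    rw [setAverage_eq, setAverage_eq, integral_smul, smul_comm]
  simp_rw [meanOscillation, h, ← smul_sub, enorm_smul]
  rw [lintegral_const_mul' _ _ enorm_ne_top]
  ring

lemma OscLe.const_smul {H : Space n → F} {A : ℝ≥0∞} (hH : OscLe H A) (a : ℝ) :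
    OscLe (fun x => a • H x) (‖a‖ₑ * A) := fun c r hr => by
  rw [meanOscillation_const_smul]
  gcongr
  exact hH c r hr

lemma OscLe.dyadicOscLeOne {H : Space n → F} (hH : OscLe H 1) : DyadicOscLeOne H := by
  intro k v
  have h := hH (dyadicCenter k v) (2 ^ (-k) / 2) (by positivity)
  have hae := dyadic_ae_eq_cube k v
  rw [meanOscillation, ← setAverage_congr hae, ← setLIntegral_congr hae, ← measure_congr hae,
    mul_comm, ← div_eq_mul_inv] at h
  have h2 := (ENNReal.div_le_iff (volume_dyadic_ne_zero k v) (volume_dyadic_ne_top k v)).1 h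
  rwa [one_mul] at h2

end

lemma gradient_const_mul {f : Space n → ℝ} (hf : ContDiff ℝ 1 f) (a : ℝ) :
    gradient (fun x => a * f x) = fun x => a • gradient f x := by
  funext x
  have h := ((hf.differentiable (by simp)) x).hasFDerivAt.const_mul a
  rw [gradient, h.fderiv, map_smul]
  rfl

/-- Apply the normalised estimate to `A⁻¹ f` and `A⁻¹ g`. The left side scales with `A⁻⁴` and the
right side with `A⁻²`, which leaves the factor `A²`. The weight is given mass at most `A⁻² E`, so
the three masses together are at most `3 A⁻² E`. The case `E = 0` is separate because a positive
weight cannot be that small. -/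
theorem exists_product_le_of_contDiff (n : ℕ) : ∃ C : ℝ≥0∞, C ≠ ∞ ∧
    ∀ (f g : Space n → ℝ) (A τ L : ℝ) (E : ℝ≥0∞), ContDiff ℝ 1 f → ContDiff ℝ 1 g → 0 < A →
      OscLe (gradient f) (ENNReal.ofReal A) → OscLe (gradient g) (ENNReal.ofReal A) →
      1 ≤ L → Real.exp (-L) ≤ τ → E ≠ ∞ → ∫⁻ x, ‖f x‖ₑ ^ 2 ≤ E → ∫⁻ x, ‖g x‖ₑ ^ 2 ≤ E →
      ∫⁻ x, ‖f x‖ₑ ^ 2 * ‖gradient g x‖ₑ ^ 2 ≤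
        C * ENNReal.ofReal A ^ 2 *
          (ENNReal.ofReal (L ^ 2) * (∫⁻ x, ‖f x‖ₑ ^ 2) + ENNReal.ofReal τ * E) := by
  obtain ⟨C, hC, hprod⟩ := exists_product_le_of_weight n
  refine ⟨C * 3, by finiteness, fun f g A τ L E hf hg hA hof hog hL hτL hE hfE hgE => ?_⟩
  have hmf : Measurable fun x => ‖f x‖ₑ ^ 2 := hf.continuous.enorm.measurable.pow_const 2
  rcases eq_or_ne E 0 with rfl | hE0
  · have h0 : (fun x => ‖f x‖ₑ ^ 2) =ᵐ[volume] 0 :=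
      (lintegral_eq_zero_iff hmf).1 (le_zero_iff.1 hfE)
    have h1 : ∫⁻ x, ‖f x‖ₑ ^ 2 * ‖gradient g x‖ₑ ^ 2 = 0 := by
      rw [← lintegral_zero (α := Space n) (μ := volume)]
      refine lintegral_congr_ae ?_
      filter_upwards [h0] with x hx
      rw [hx]; simp
    rw [h1]; exact zero_le
  set a := ENNReal.ofReal A⁻¹ ^ 2 with ha
  have ha0 : a ≠ 0 := pow_ne_zero _ (ENNReal.ofReal_pos.2 (inv_pos.2 hA)).ne'
  have hat : a ≠ ∞ := by finiteness
  have haA : ENNReal.ofReal A ^ 2 * a = 1 := by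
    rw [ha, ← mul_pow, ← ENNReal.ofReal_mul hA.le, mul_inv_cancel₀ hA.ne']
    simp
  have hen : ‖A⁻¹‖ₑ = ENNReal.ofReal A⁻¹ := Real.enorm_of_nonneg (inv_pos.2 hA).le
  obtain ⟨κ, hκ, hκ0, hκE⟩ := exists_weight n (mul_ne_zero ha0 hE0)
  have hosc : ∀ h : Space n → ℝ, ContDiff ℝ 1 h → OscLe (gradient h) (ENNReal.ofReal A) →
      DyadicOscLeOne (gradient fun x => A⁻¹ * h x) := by
    intro h hh ho
    rw [gradient_const_mul hh]
    have := ho.const_smul A⁻¹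
    rw [hen, ← ENNReal.ofReal_mul (inv_pos.2 hA).le, inv_mul_cancel₀ hA.ne',
      ENNReal.ofReal_one] at this
    exact this.dyadicOscLeOne
  have hsq : ∀ h : Space n → ℝ, ∫⁻ x, ‖A⁻¹ * h x‖ₑ ^ 2 = a * ∫⁻ x, ‖h x‖ₑ ^ 2 := by
    intro h
    rw [← lintegral_const_mul' _ _ hat]
    simp_rw [enorm_mul, mul_pow, hen, ha]
  have hle : (∫⁻ x, ‖A⁻¹ * f x‖ₑ ^ 2) + (∫⁻ x, ‖A⁻¹ * g x‖ₑ ^ 2)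
      + (∫⁻ x, ENNReal.ofReal (κ x)) ≤ 3 * (a * E) := by
    rw [hsq, hsq]
    calc _ ≤ a * E + a * E + a * E := by gcongr
      _ = _ := by ring
  have h := hprod (fun x => A⁻¹ * f x) (fun x => A⁻¹ * g x) κ τ L (contDiff_const.mul hf)
    (contDiff_const.mul hg) (hosc f hf hof) (hosc g hg hog) hκ hκ0 hL hτL
    (ne_top_of_le_ne_top (by finiteness) hle)
  have hLHS : ∫⁻ x, ‖A⁻¹ * f x‖ₑ ^ 2 * ‖gradient (fun x => A⁻¹ * g x) x‖ₑ ^ 2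
      = a ^ 2 * ∫⁻ x, ‖f x‖ₑ ^ 2 * ‖gradient g x‖ₑ ^ 2 := by
    rw [gradient_const_mul hg, ← lintegral_const_mul' _ _ (by finiteness)]
    refine lintegral_congr fun x => ?_
    rw [enorm_mul, enorm_smul, hen, ha]
    ring
  rw [hLHS, hsq] at h
  have haA2 : (ENNReal.ofReal A ^ 2) ^ 2 * a ^ 2 = 1 := by rw [← mul_pow, haA, one_pow]
  calc ∫⁻ x, ‖f x‖ₑ ^ 2 * ‖gradient g x‖ₑ ^ 2
      = (ENNReal.ofReal A ^ 2) ^ 2 * (a ^ 2 * ∫⁻ x, ‖f x‖ₑ ^ 2 * ‖gradient g x‖ₑ ^ 2) := by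
        rw [← mul_assoc, haA2, one_mul]
    _ ≤ (ENNReal.ofReal A ^ 2) ^ 2 * (C * (ENNReal.ofReal (L ^ 2) * (a * ∫⁻ x, ‖f x‖ₑ ^ 2) +
        ENNReal.ofReal τ * (3 * (a * E)))) := by
        refine mul_le_mul_right (h.trans ?_) _
        rw [hsq] at hle
        gcongr
    _ = (ENNReal.ofReal A ^ 2 * a) * (C * ENNReal.ofReal A ^ 2 * (ENNReal.ofReal (L ^ 2) *
        (∫⁻ x, ‖f x‖ₑ ^ 2) + ENNReal.ofReal τ * (3 * E))) := by ring
    _ ≤ _ := by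
        rw [haA, one_mul]
        calc _ ≤ C * ENNReal.ofReal A ^ 2 * (3 * (ENNReal.ofReal (L ^ 2) *
            (∫⁻ x, ‖f x‖ₑ ^ 2)) + ENNReal.ofReal τ * (3 * E)) := by
              refine mul_le_mul_right (add_le_add_left ?_ _) _
              exact le_mul_of_one_le_left' (show (1 : ℝ≥0∞) ≤ 3 by norm_num)
          _ = _ := by ring

end

section

variable {n : ℕ}

/-! ### Mollification -/

/-- A sequence of bump functions concentrating at the origin. -/
def bumpSeq (n k : ℕ) : ContDiffBump (0 : Space n) :=
  ⟨1 / (k + 1), 2 / (k + 1), by positivity, by gcongr; norm_num⟩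

/-- The standard mollifiers. -/
def mollifier (n k : ℕ) : Space n → ℝ := (bumpSeq n k).normed volume

lemma mollifier_nonneg (k : ℕ) (x : Space n) : 0 ≤ mollifier n k x := (bumpSeq n k).nonneg_normed x

lemma mollifier_neg (k : ℕ) (x : Space n) : mollifier n k (-x) = mollifier n k x :=
  (bumpSeq n k).normed_neg x

lemma contDiff_mollifier (k : ℕ) : ContDiff ℝ (⊤ : ℕ∞) (mollifier n k) :=
  (bumpSeq n k).contDiff_normed

lemma hasCompactSupport_mollifier (k : ℕ) : HasCompactSupport (mollifier n k) :=
  (bumpSeq n k).hasCompactSupport_normed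

lemma integral_mollifier (k : ℕ) : ∫ x, mollifier n k x = 1 := (bumpSeq n k).integral_normed

lemma continuous_mollifier (k : ℕ) : Continuous (mollifier n k) := (contDiff_mollifier k).continuous

lemma lintegral_mollifier (k : ℕ) : ∫⁻ x, ENNReal.ofReal (mollifier n k x) = 1 := by
  rw [← ofReal_integral_eq_lintegral_ofReal
    (Integrable.of_integral_ne_zero (by rw [integral_mollifier]; norm_num))
    (ae_of_all _ (mollifier_nonneg k)), integral_mollifier, ENNReal.ofReal_one]

variable {F : Type*} [NormedAddCommGroup F] [NormedSpace ℝ F]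

/-- Mollification of `f` at scale `2 / (k + 1)`. -/
def mollify (k : ℕ) (f : Space n → F) : Space n → F :=
  mollifier n k ⋆[ContinuousLinearMap.lsmul ℝ ℝ, volume] f

lemma mollify_eq (k : ℕ) (f : Space n → F) (x : Space n) :
    mollify k f x = ∫ t, mollifier n k t • f (x - t) := rfl

lemma mollify_eq_swap (k : ℕ) (f : Space n → F) (x : Space n) :
    mollify k f x = ∫ y, mollifier n k (x - y) • f y := by
  rw [mollify, convolution_eq_swap]; rfl

lemma mollify_congr_ae (k : ℕ) {f g : Space n → F} (h : f =ᵐ[volume] g) :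
    mollify k f = mollify k g :=
  convolution_congr _ (ae_eq_refl _) h

lemma contDiff_mollify (k : ℕ) {f : Space n → F} (hf : LocallyIntegrable f volume) :
    ContDiff ℝ (⊤ : ℕ∞) (mollify k f) :=
  (hasCompactSupport_mollifier k).contDiff_convolution_left _ (contDiff_mollifier k) hf

lemma gradient_comp_const_sub (ψ : Space n → ℝ) (hψ : ContDiff ℝ 1 ψ) (x y : Space n) :
    gradient (fun y => ψ (x - y)) y = -gradient ψ (x - y) := by
  have h := ((hψ.differentiable (by simp)) (x - y)).hasFDerivAt.comp y
    ((hasFDerivAt_id y).const_sub x)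
  rw [gradient, show fderiv ℝ (fun y => ψ (x - y)) y = _ from h.fderiv, gradient, ← map_neg]
  congr 1
  ext e
  simp

lemma gradient_mollify_eq_integral (k : ℕ) {f : Space n → ℝ} (hf : LocallyIntegrable f volume)
    (x : Space n) :
    gradient (mollify k f) x = ∫ y, f y • gradient (mollifier n k) (x - y) := by
  have hc := hasCompactSupport_mollifier (n := n) k
  have hs : ContDiff ℝ 1 (mollifier n k) := (contDiff_mollifier k).of_le (by simp)
  have hcg : HasCompactSupport fun y => gradient (mollifier n k) (x - y) :=
    (HasCompactSupport.gradient hc).comp_homeomorph (Homeomorph.subLeft x)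
  have hint : Integrable fun y => f y • gradient (mollifier n k) (x - y) :=
    hf.integrable_smul_right_of_hasCompactSupport
      ((continuous_gradient hs).comp (by fun_prop)) hcg
  have h := hc.hasFDerivAt_convolution_left (ContinuousLinearMap.lsmul ℝ ℝ) hs hf x
  have hex : ConvolutionExistsAt (fderiv ℝ (mollifier n k)) f x
      ((ContinuousLinearMap.lsmul ℝ ℝ).precompL (Space n)) volume :=
    (hc.fderiv ℝ).convolutionExists_left _ (hs.continuous_fderiv (by simp)) hf x
  refine ext_inner_right ℝ fun e => ?_
  rw [inner_gradient, real_inner_comm, ← integral_inner hint,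
    show fderiv ℝ (mollify k f) x = _ from h.fderiv, convolution_eq_swap,
    ContinuousLinearMap.integral_apply hex.integrable_swap]
  refine integral_congr_ae (ae_of_all _ fun y => ?_)
  simp only [ContinuousLinearMap.precompL_apply, ContinuousLinearMap.lsmul_apply, smul_eq_mul]
  rw [real_inner_smul_right, real_inner_comm, inner_gradient, mul_comm]

lemma gradient_mollify (k : ℕ) {f : Space n → ℝ} {H : Space n → Space n}
    (hf : HasWeakGradient f H) : gradient (mollify k f) = mollify k H := by
  funext x
  have hs : ContDiff ℝ (⊤ : ℕ∞) (mollifier n k) := contDiff_mollifier k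
  have hs1 : ContDiff ℝ 1 (mollifier n k) := hs.of_le (by simp)
  have h := hf.2.2 (fun y => mollifier n k (x - y)) (hs.comp (by fun_prop))
    ((hasCompactSupport_mollifier k).comp_homeomorph (Homeomorph.subLeft x))
  rw [gradient_mollify_eq_integral k hf.1, mollify_eq_swap]
  simp_rw [gradient_comp_const_sub _ hs1, smul_neg, integral_neg, neg_inj] at h
  exact h

lemma HasWeakGradient.mollify {f : Space n → ℝ} {H : Space n → Space n}
    (hf : HasWeakGradient f H) (k : ℕ) :
    HasWeakGradient (mollify k f) (ActiveScalar.mollify k H) := by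
  have h1 := contDiff_mollify k hf.1
  have h2 := contDiff_mollify k hf.2.1
  refine ⟨h1.continuous.locallyIntegrable, h2.continuous.locallyIntegrable, fun ψ hψ hc => ?_⟩
  rw [← gradient_mollify k hf]
  exact integral_smul_gradient_eq_neg (h1.of_le (by simp)) (hψ.of_le (by simp)) hc

/-! ### Mollification as an average of translates -/

/-- The probability measure with density a mollifier. -/
def mollifierMeasure (n k : ℕ) : Measure (Space n) :=
  volume.withDensity fun x => ENNReal.ofReal (mollifier n k x)

instance (k : ℕ) : IsProbabilityMeasure (mollifierMeasure n k) :=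
  ⟨by rw [mollifierMeasure, withDensity_apply _ MeasurableSet.univ, setLIntegral_univ,
    lintegral_mollifier]⟩

/-- As an average of translates over a probability measure, mollification does not increase any
translation-invariant convex quantity. Both the `L²` bound and the oscillation bound follow this
pattern. -/
lemma mollify_eq_integral_measure (k : ℕ) (f : Space n → F) (x : Space n) :
    mollify k f x = ∫ t, f (x - t) ∂(mollifierMeasure n k) := by
  have hm : Measurable fun x => ENNReal.ofReal (mollifier n k x) :=
    (continuous_mollifier k).measurable.ennreal_ofReal
  rw [mollifierMeasure, integral_withDensity_eq_integral_toReal_smul hm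
    (ae_of_all _ fun _ => ENNReal.ofReal_lt_top), mollify_eq]
  simp_rw [ENNReal.toReal_ofReal (mollifier_nonneg k _)]

lemma lintegral_enorm_mollify_sq_le (k : ℕ) {f : Space n → F} (hf : AEStronglyMeasurable f volume) :
    ∫⁻ x, ‖mollify k f x‖ₑ ^ 2 ≤ ∫⁻ x, ‖f x‖ₑ ^ 2 := by
  obtain ⟨g, hg, hfg⟩ := hf
  rw [mollify_congr_ae k hfg, lintegral_congr_ae (show (fun x => ‖f x‖ₑ ^ 2) =ᵐ[volume]
    fun x => ‖g x‖ₑ ^ 2 from hfg.fun_comp fun y => ‖y‖ₑ ^ 2)]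
  have hm : Measurable fun y => ‖g y‖ₑ := hg.enorm
  have hm2 : Measurable fun q : Space n × Space n => ‖g (q.1 - q.2)‖ₑ ^ 2 :=
    (hm.comp measurable_sub).pow_const 2
  calc ∫⁻ x, ‖mollify k g x‖ₑ ^ 2
      ≤ ∫⁻ x, ∫⁻ t, ‖g (x - t)‖ₑ ^ 2 ∂(mollifierMeasure n k) := by
        refine lintegral_mono fun x => ?_
        rw [mollify_eq_integral_measure]
        refine (pow_le_pow_left' (enorm_integral_le_lintegral_enorm _) 2).trans ?_
        simpa using lintegral_sq_le (μ := mollifierMeasure n k)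
          (hm.comp (measurable_const.sub measurable_id)).aemeasurable
    _ = ∫⁻ t, ∫⁻ x, ‖g (x - t)‖ₑ ^ 2 ∂volume ∂(mollifierMeasure n k) :=
        lintegral_lintegral_swap hm2.aemeasurable
    _ = ∫⁻ _t, (∫⁻ x, ‖g x‖ₑ ^ 2) ∂(mollifierMeasure n k) :=
        lintegral_congr fun t => lintegral_sub_right_eq_self (fun x => ‖g x‖ₑ ^ 2) t
    _ = _ := by simp

lemma cube_eq_preimage (c : Space n) (r : ℝ) (t : Space n) :
    cube c r = (fun x => x - t) ⁻¹' cube (c - t) r := by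
  ext x; simp [cube]

lemma meanOscillation_comp_sub (H : Space n → F) (c : Space n) (r : ℝ) (t : Space n) :
    meanOscillation (fun x => H (x - t)) (cube c r) = meanOscillation H (cube (c - t) r) := by
  have hmp := measurePreserving_sub_right (volume : Measure (Space n)) t
  have hemb : MeasurableEmbedding fun x : Space n => x - t :=
    (Homeomorph.subRight t).measurableEmbedding
  have hvol : volume (cube c r) = volume (cube (c - t) r) := by
    rw [cube_eq_preimage c r t, hmp.measure_preimage_emb hemb]
  have havg : ⨍ z in cube c r, H (z - t) = ⨍ z in cube (c - t) r, H z := by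
    rw [setAverage_eq, setAverage_eq, measureReal_def, measureReal_def, hvol,
      cube_eq_preimage c r t, hmp.setIntegral_preimage_emb hemb]
  rw [meanOscillation, meanOscillation, hvol, havg, cube_eq_preimage c r t,
    hmp.setLIntegral_comp_preimage_emb hemb (fun x => ‖H x - ⨍ z in cube (c - t) r, H z‖ₑ)]

lemma measurableSet_cube (c : Space n) (r : ℝ) : MeasurableSet (cube c r) := by
  have : cube c r = ⋂ i, {x : Space n | |x i - c i| ≤ r} := by ext x; simp [cube]
  rw [this]
  exact MeasurableSet.iInter fun i => measurableSet_le (by fun_prop) measurable_const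

lemma volume_cube (c : Space n) (r : ℝ) : volume (cube c r) = ENNReal.ofReal (2 * r) ^ n := by
  have h2 : cube c r = @WithLp.ofLp 2 (Fin n → ℝ) ⁻¹'
      (Icc (fun i => c i - r) fun i => c i + r) := by
    ext x
    simp only [cube, mem_ofPred_eq, mem_preimage, mem_Icc, Pi.le_def, ← forall_and]
    refine forall_congr' fun i => ?_
    rw [abs_le]
    constructor <;> rintro ⟨h1, h2⟩ <;> constructor <;> linarith
  rw [h2, (PiLp.volume_preserving_ofLp (Fin n)).measure_preimage measurableSet_Icc.nullMeasurableSet,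
    Real.volume_Icc_pi]
  simp [← two_mul]

lemma volume_cube_ne_top (c : Space n) (r : ℝ) : volume (cube c r) ≠ ∞ := by
  rw [volume_cube]; finiteness

lemma volume_cube_ne_zero (c : Space n) {r : ℝ} (hr : 0 < r) : volume (cube c r) ≠ 0 := by
  rw [volume_cube]
  exact pow_ne_zero _ (ENNReal.ofReal_pos.2 (by positivity)).ne'

lemma isBounded_cube (c : Space n) (r : ℝ) : Bornology.IsBounded (cube c r) := by
  refine (Metric.isBounded_iff_subset_closedBall c).2 ⟨n * |r|, fun x hx => ?_⟩
  rw [mem_closedBall_iff_norm, EuclideanSpace.norm_eq]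
  refine Real.sqrt_le_iff.2 ⟨by positivity, ?_⟩
  calc ∑ i, ‖(x - c) i‖ ^ 2 ≤ (∑ i, ‖(x - c) i‖) ^ 2 :=
        Finset.sum_sq_le_sq_sum_of_nonneg fun i _ => norm_nonneg _
    _ ≤ (∑ _i : Fin n, |r|) ^ 2 := by
        gcongr with i
        exact (hx i).trans (le_abs_self r)
    _ = _ := by simp

omit [NormedSpace ℝ F] in
lemma LocallyIntegrable.integrableOn_of_isBounded {H : Space n → F}
    (hH : LocallyIntegrable H volume) {s : Set (Space n)} (hs : Bornology.IsBounded s) :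
    IntegrableOn H s :=
  (hH.integrableOn_isCompact hs.isCompact_closure).mono_set subset_closure

end

section

variable {n : ℕ} {F : Type*} [NormedAddCommGroup F] [NormedSpace ℝ F]

/-! ### Mollification and mean oscillations -/

lemma OscLe.congr_ae {H H' : Space n → F} {A : ℝ≥0∞} (hH : OscLe H A) (h : H =ᵐ[volume] H') :
    OscLe H' A := by
  intro c r hr
  have h1 : ⨍ z in cube c r, H' z = ⨍ z in cube c r, H z := by
    rw [setAverage_eq, setAverage_eq, integral_congr_ae (ae_restrict_of_ae h.symm)]
  refine le_trans (le_of_eq ?_) (hH c r hr)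
  rw [meanOscillation, meanOscillation, h1]
  congr 1
  refine lintegral_congr_ae (ae_restrict_of_ae ?_)
  filter_upwards [h] with x hx
  rw [hx]

lemma mollifier_eq_zero {k : ℕ} {x : Space n} (hx : 2 / ((k : ℝ) + 1) ≤ ‖x‖) :
    mollifier n k x = 0 := by
  by_contra h
  have h1 : x ∈ Function.support (mollifier n k) := h
  rw [mollifier, ContDiffBump.support_normed_eq, mem_ball_zero_iff] at h1
  exact absurd h1 (not_lt.2 hx)

lemma two_div_le_two (k : ℕ) : 2 / ((k : ℝ) + 1) ≤ 2 := by
  rw [div_le_iff₀ (by positivity)]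
  have : (0 : ℝ) ≤ k := by positivity
  linarith

lemma ae_mollifierMeasure_norm_le (k : ℕ) : ∀ᵐ t ∂(mollifierMeasure n k), ‖t‖ ≤ 2 := by
  rw [mollifierMeasure, ae_withDensity_iff (continuous_mollifier k).measurable.ennreal_ofReal]
  refine ae_of_all _ fun t ht => ?_
  by_contra h
  refine ht ?_
  rw [mollifier_eq_zero ((two_div_le_two k).trans (not_le.1 h).le), ENNReal.ofReal_zero]

/-- The average of the mollification over a cube is the average in `t` of the averages `a t` of the
translates. Each translate has oscillation at most `A`, since translating the function amounts to
translating the cube. Tonelli then integrates the bound in `t`. A strongly measurable representative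
makes the two-variable function measurable. -/
theorem OscLe.mollify [CompleteSpace F] {H : Space n → F} {A : ℝ≥0∞} (hH : OscLe H A)
    (hloc : LocallyIntegrable H volume) (k : ℕ) : OscLe (mollify k H) A := by
  obtain ⟨g, hg, hHg⟩ := hloc.aestronglyMeasurable
  rw [mollify_congr_ae k hHg]
  replace hH := hH.congr_ae hHg
  replace hloc : LocallyIntegrable g volume := hloc.congr hHg
  intro c r hr
  set ν := mollifierMeasure n k with hν
  have hsm : StronglyMeasurable fun q : Space n × Space n => g (q.1 - q.2) :=
    hg.comp_measurable measurable_sub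
  have hQ := measurableSet_cube c r
  have hVt := volume_cube_ne_top c r
  have hV0 := volume_cube_ne_zero c hr
  have hint : Integrable (fun q : Space n × Space n => g (q.1 - q.2))
      ((volume.restrict (cube c r)).prod ν) := by
    refine ⟨hsm.aestronglyMeasurable, ?_⟩
    have hem : Measurable fun q : Space n × Space n => ‖g (q.1 - q.2)‖ₑ := hsm.enorm
    rw [hasFiniteIntegral_def, lintegral_prod_symm _ hem.aemeasurable]
    -- All translations charged by the mollifier have norm at most `2`, so the enlarged cube
    -- contains every translate of the original.
    have hfin : ∫⁻ z in cube c (r + 2), ‖g z‖ₑ < ∞ :=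
      (LocallyIntegrable.integrableOn_of_isBounded hloc (isBounded_cube c (r + 2))).2
    calc _ ≤ ∫⁻ _t, (∫⁻ z in cube c (r + 2), ‖g z‖ₑ) ∂ν := by
          refine lintegral_mono_ae ?_
          filter_upwards [ae_mollifierMeasure_norm_le (n := n) k] with t ht
          have hmp := measurePreserving_sub_right (volume : Measure (Space n)) t
          have hemb : MeasurableEmbedding fun x : Space n => x - t :=
            (Homeomorph.subRight t).measurableEmbedding
          rw [cube_eq_preimage c r t, hmp.setLIntegral_comp_preimage_emb hemb (fun x => ‖g x‖ₑ)]
          refine lintegral_mono_set fun x hx i => ?_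
          have h1 := hx i
          have h2 := (PiLp.norm_apply_le t i).trans ht
          rw [Real.norm_eq_abs] at h2
          rw [PiLp.sub_apply] at h1
          rw [abs_le] at *
          constructor <;> linarith
      _ < ∞ := by simpa using hfin
  let a : Space n → F := fun t => ⨍ z in cube c r, g (z - t)
  have hasm : StronglyMeasurable a := by
    simp only [a, setAverage_eq]
    exact (hsm.integral_prod_left' (μ := volume.restrict (cube c r))).const_smul _
  have hae : ∀ᵐ y ∂(volume.restrict (cube c r)), Integrable (fun t => g (y - t)) ν :=
    hint.prod_right_ae
  have hai : Integrable a ν := by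
    simp only [a, setAverage_eq]
    exact hint.integral_prod_right.smul _
  have havg : ⨍ z in cube c r, ActiveScalar.mollify k g z = ∫ t, a t ∂ν := by
    simp only [a, setAverage_eq, mollify_eq_integral_measure]
    rw [integral_smul, ← hν]
    congr 1
    exact integral_integral_swap hint
  have hmeas : Measurable fun q : Space n × Space n => ‖g (q.1 - q.2) - a q.2‖ₑ :=
    (hsm.sub (hasm.comp_measurable measurable_snd)).enorm
  have hpt : ∀ᵐ y ∂(volume.restrict (cube c r)),
      ‖ActiveScalar.mollify k g y - ⨍ z in cube c r, ActiveScalar.mollify k g z‖ₑ ≤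
        ∫⁻ t, ‖g (y - t) - a t‖ₑ ∂ν := by
    filter_upwards [hae] with y hy
    rw [havg, mollify_eq_integral_measure, ← integral_sub hy hai]
    exact enorm_integral_le_lintegral_enorm _
  have hosc : ∀ t, ∫⁻ y in cube c r, ‖g (y - t) - a t‖ₑ ≤ A * volume (cube c r) := by
    intro t
    have h1 := hH (c - t) r hr
    rw [← meanOscillation_comp_sub, meanOscillation, mul_comm, ← div_eq_mul_inv] at h1
    exact (ENNReal.div_le_iff hV0 hVt).1 h1
  rw [meanOscillation, mul_comm, ← div_eq_mul_inv, ENNReal.div_le_iff hV0 hVt]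
  calc _ ≤ ∫⁻ y in cube c r, ∫⁻ t, ‖g (y - t) - a t‖ₑ ∂ν := lintegral_mono_ae hpt
    _ = ∫⁻ t, ∫⁻ y in cube c r, ‖g (y - t) - a t‖ₑ ∂volume ∂ν :=
        lintegral_lintegral_swap hmeas.aemeasurable
    _ ≤ ∫⁻ _t, A * volume (cube c r) ∂ν := lintegral_mono hosc
    _ = _ := by simp

/-! ### Almost everywhere convergence of mollifications -/

lemma mollifier_le (k : ℕ) (x : Space n) :
    mollifier n k x ≤ 2 ^ n / volume.real (Metric.closedBall (0 : Space n) (2 / (k + 1))) := by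
  have h := (bumpSeq n k).normed_le_div_measure_closedBall_rOut volume 2
    (show 2 / ((k : ℝ) + 1) ≤ 2 * (1 / (k + 1)) by rw [mul_one_div]) x
  rw [finrank_euclideanSpace, Fintype.card_fin] at h
  exact h

lemma tendsto_two_div_atTop : Tendsto (fun k : ℕ => 2 / ((k : ℝ) + 1)) atTop (𝓝 0) := by
  have := (tendsto_one_div_add_atTop_nhds_zero_nat (𝕜 := ℝ)).const_mul 2
  simpa [div_eq_mul_inv] using this

/-- The mollifier centred at `x'` is supported in the ball of radius `2ρ` about `x` and has height
at most `2 ^ n / V`; rewriting as an average over that ball gives another `2 ^ n`. Uniformity over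
`x'` is what allows a second mollification at the same scale. -/
lemma norm_mollify_sub_le [CompleteSpace F] {f : Space n → F} (hf : LocallyIntegrable f volume)
    (k : ℕ) {x x' : Space n} (hx' : ‖x' - x‖ < 2 / (k + 1)) :
    ‖mollify k f x' - f x‖ ≤
      4 ^ n * ⨍ y in Metric.closedBall x (2 * (2 / (k + 1))), ‖f y - f x‖ := by
  set ρ : ℝ := 2 / (k + 1) with hρ
  have hρ0 : 0 < ρ := by positivity
  have hcc : HasCompactSupport fun y => mollifier n k (x' - y) :=
    (hasCompactSupport_mollifier k).comp_homeomorph (Homeomorph.subLeft x')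
  have hcont : Continuous fun y => mollifier n k (x' - y) :=
    (continuous_mollifier k).comp (by fun_prop)
  have h1 : Integrable fun y => mollifier n k (x' - y) • f y :=
    hf.integrable_smul_left_of_hasCompactSupport hcont hcc
  have h2 : Integrable fun y => mollifier n k (x' - y) • f x :=
    (hcont.integrable_of_hasCompactSupport hcc).smul_const _
  have hone : ∫ y, mollifier n k (x' - y) = 1 := by
    rw [integral_sub_left_eq_self (mollifier n k) volume x', integral_mollifier]
  have h3 : mollify k f x' - f x = ∫ y, mollifier n k (x' - y) • (f y - f x) := by
    simp_rw [smul_sub]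
    rw [integral_sub h1 h2, integral_smul_const, hone, one_smul, mollify_eq_swap]
  have hI : IntegrableOn (fun y => ‖f y - f x‖) (Metric.closedBall x (2 * ρ)) :=
    ((hf.integrableOn_isCompact (isCompact_closedBall _ _)).sub
      (integrableOn_const (measure_closedBall_lt_top).ne)).norm
  set V := volume.real (Metric.closedBall (0 : Space n) ρ) with hV
  have hV2 : volume.real (Metric.closedBall x (2 * ρ)) = 2 ^ n * V := by
    rw [Measure.addHaar_real_closedBall _ _ (by positivity), hV,
      Measure.addHaar_real_closedBall _ _ hρ0.le]
    simp only [finrank_euclideanSpace, Fintype.card_fin]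
    rw [mul_pow, mul_assoc]
  have hV0 : 0 < V := ENNReal.toReal_pos (Metric.measure_closedBall_pos _ _ hρ0).ne'
    measure_closedBall_lt_top.ne
  calc ‖mollify k f x' - f x‖ ≤ ∫ y, ‖mollifier n k (x' - y) • (f y - f x)‖ := by
        rw [h3]; exact norm_integral_le_integral_norm _
    _ ≤ ∫ y, (Metric.closedBall x (2 * ρ)).indicator
          (fun y => 2 ^ n / V * ‖f y - f x‖) y := by
        refine integral_mono_of_nonneg (ae_of_all _ fun y => norm_nonneg _) ?_ (ae_of_all _ ?_)
        · exact (integrable_indicator_iff Metric.isClosed_closedBall.measurableSet).2 (hI.const_mul _)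
        · intro y
          simp only
          rw [norm_smul, Real.norm_of_nonneg (mollifier_nonneg k _)]
          by_cases hy : y ∈ Metric.closedBall x (2 * ρ)
          · rw [indicator_of_mem hy]
            gcongr
            exact mollifier_le k _
          · rw [indicator_of_notMem hy]
            rw [mem_closedBall_iff_norm, not_le] at hy
            have h5 : ρ ≤ ‖x' - y‖ := by
              have h6 := norm_sub_le_norm_sub_add_norm_sub y x' x
              rw [norm_sub_rev y x'] at h6
              linarith
            rw [mollifier_eq_zero h5, zero_mul]
    _ = 2 ^ n / V * ∫ y in Metric.closedBall x (2 * ρ), ‖f y - f x‖ := by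
        rw [integral_indicator Metric.isClosed_closedBall.measurableSet, integral_const_mul]
    _ = _ := by
        rw [setAverage_eq, hV2, smul_eq_mul, show (4 : ℝ) ^ n = 2 ^ n * 2 ^ n by
          rw [← mul_pow]; norm_num]
        field_simp

theorem ae_eventually_mollify_near [CompleteSpace F] {f : Space n → F}
    (hf : LocallyIntegrable f volume) : ∀ᵐ x, ∀ ε > 0, ∀ᶠ k : ℕ in atTop,
      ∀ x' ∈ Metric.ball x (2 / (k + 1)), dist (mollify k f x') (f x) ≤ ε := by
  filter_upwards [(Besicovitch.vitaliFamily volume).ae_tendsto_average_norm_sub hf] with x hx ε hε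
  have h1 := hx.comp (Besicovitch.tendsto_filterAt volume x)
  have h2 : Tendsto (fun k : ℕ => 2 * (2 / ((k : ℝ) + 1))) atTop (𝓝[>] 0) := by
    refine tendsto_nhdsWithin_iff.2 ⟨?_, Eventually.of_forall fun k => ?_⟩
    · simpa using tendsto_two_div_atTop.const_mul 2
    · exact mem_Ioi.2 (by positivity)
  have h3 := ((h1.comp h2).const_mul ((4 : ℝ) ^ n)).eventually
    (gt_mem_nhds (show (4 : ℝ) ^ n * 0 < ε by simpa using hε))
  filter_upwards [h3] with k hk x' hx'
  rw [dist_eq_norm]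
  exact (norm_mollify_sub_le hf k (mem_ball_iff_norm.1 hx')).trans hk.le

lemma ae_tendsto_mollify [CompleteSpace F] {f : Space n → F} (hf : LocallyIntegrable f volume) :
    ∀ᵐ x, Tendsto (fun k => mollify k f x) atTop (𝓝 (f x)) := by
  filter_upwards [ae_eventually_mollify_near hf] with x hx
  refine Metric.tendsto_atTop'.2 fun ε hε => ?_
  obtain ⟨N, hN⟩ := eventually_atTop.1 (hx (ε / 2) (by positivity))
  refine ⟨N, fun k hk => (hN k hk.le x (Metric.mem_ball_self (by positivity))).trans_lt ?_⟩
  linarith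

/-- The second mollification averages the first over a ball of the same radius, on which the first
is already uniformly close to `f x`. -/
lemma ae_tendsto_mollify_mollify [CompleteSpace F] {f : Space n → F}
    (hf : LocallyIntegrable f volume) :
    ∀ᵐ x, Tendsto (fun k => mollify k (mollify k f) x) atTop (𝓝 (f x)) := by
  filter_upwards [ae_eventually_mollify_near hf] with x hx
  refine Metric.tendsto_atTop'.2 fun ε hε => ?_
  obtain ⟨N, hN⟩ := eventually_atTop.1 (hx (ε / 2) (by positivity))
  refine ⟨N, fun k hk => lt_of_le_of_lt ?_ (half_lt_self hε)⟩
  refine dist_convolution_le (by positivity) (R := 2 / (k + 1)) ?_ (mollifier_nonneg k)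
    (integral_mollifier k) (contDiff_mollify k hf).continuous.aestronglyMeasurable (hN k hk.le)
  rw [mollifier, ContDiffBump.support_normed_eq]
  rfl

/-! ### The product estimate for weakly differentiable functions -/

lemma HasWeakGradient.aestronglyMeasurable {f : Space n → ℝ} {H : Space n → Space n}
    (h : HasWeakGradient f H) : AEStronglyMeasurable f volume := h.1.aestronglyMeasurable

/-- Mollification increases neither the `L²` norms nor the oscillations, so the smooth estimate
holds with the same constants for each `k`. Almost everywhere convergence and Fatou pass to the
limit. -/
theorem exists_product_le (n : ℕ) : ∃ C : ℝ≥0∞, C ≠ ∞ ∧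
    ∀ (f g : Space n → ℝ) (Hf Hg : Space n → Space n) (A τ L : ℝ) (E : ℝ≥0∞),
      HasWeakGradient f Hf → HasWeakGradient g Hg → 0 < A →
      OscLe Hf (ENNReal.ofReal A) → OscLe Hg (ENNReal.ofReal A) →
      1 ≤ L → Real.exp (-L) ≤ τ → E ≠ ∞ → ∫⁻ x, ‖f x‖ₑ ^ 2 ≤ E → ∫⁻ x, ‖g x‖ₑ ^ 2 ≤ E →
      ∫⁻ x, ‖f x‖ₑ ^ 2 * ‖Hg x‖ₑ ^ 2 ≤
        C * ENNReal.ofReal A ^ 2 *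
          (ENNReal.ofReal (L ^ 2) * (∫⁻ x, ‖f x‖ₑ ^ 2) + ENNReal.ofReal τ * E) := by
  obtain ⟨C, hC, hprod⟩ := exists_product_le_of_contDiff n
  refine ⟨C, hC, fun f g Hf Hg A τ L E hf hg hA hof hog hL hτL hE hfE hgE => ?_⟩
  have hsf := fun k => lintegral_enorm_mollify_sq_le k hf.1.aestronglyMeasurable
  have hsg := fun k => lintegral_enorm_mollify_sq_le k hg.1.aestronglyMeasurable
  have hk : ∀ k, ∫⁻ x, ‖mollify k f x‖ₑ ^ 2 * ‖mollify k Hg x‖ₑ ^ 2 ≤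
      C * ENNReal.ofReal A ^ 2 *
          (ENNReal.ofReal (L ^ 2) * (∫⁻ x, ‖f x‖ₑ ^ 2) + ENNReal.ofReal τ * E) := by
    intro k
    rw [← gradient_mollify k hg]
    refine (hprod (mollify k f) (mollify k g) A τ L E ((contDiff_mollify k hf.1).of_le (by simp))
      ((contDiff_mollify k hg.1).of_le (by simp)) hA ?_ ?_ hL hτL hE ((hsf k).trans hfE)
      ((hsg k).trans hgE)).trans ?_
    · rw [gradient_mollify k hf]; exact hof.mollify hf.2.1 k
    · rw [gradient_mollify k hg]; exact hog.mollify hg.2.1 k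
    · exact mul_le_mul_right (add_le_add_left (mul_le_mul_right (hsf k) _) _) _
  calc ∫⁻ x, ‖f x‖ₑ ^ 2 * ‖Hg x‖ₑ ^ 2
      = ∫⁻ x, liminf (fun k => ‖mollify k f x‖ₑ ^ 2 * ‖mollify k Hg x‖ₑ ^ 2) atTop := by
        refine lintegral_congr_ae ?_
        filter_upwards [ae_tendsto_mollify hf.1, ae_tendsto_mollify hg.2.1] with x h1 h2
        refine (Tendsto.liminf_eq ?_).symm
        refine ENNReal.Tendsto.mul ((ENNReal.continuous_pow 2).continuousAt.tendsto.comp h1.enorm)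
          (Or.inr (by finiteness)) ((ENNReal.continuous_pow 2).continuousAt.tendsto.comp h2.enorm)
          (Or.inr (by finiteness))
    _ ≤ liminf (fun k => ∫⁻ x, ‖mollify k f x‖ₑ ^ 2 * ‖mollify k Hg x‖ₑ ^ 2) atTop := by
        refine lintegral_liminf_le fun k => ?_
        exact ((contDiff_mollify k hf.1).continuous.enorm.measurable.pow_const 2).mul
          ((contDiff_mollify k hg.2.1).continuous.enorm.measurable.pow_const 2)
    _ ≤ liminf (fun _ : ℕ => C * ENNReal.ofReal A ^ 2 *
          (ENNReal.ofReal (L ^ 2) * (∫⁻ x, ‖f x‖ₑ ^ 2) + ENNReal.ofReal τ * E)) atTop :=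
        liminf_le_liminf (Eventually.of_forall hk)
    _ = _ := by simp

end

section

/-! ### Weak convergence in `L²` from almost everywhere convergence -/

section WeakConvergence

variable {α : Type*} [MeasurableSpace α] {μ : Measure α} {E : Type*} [NormedAddCommGroup E]

lemma memLp_two_iff {f : α → E} (hf : AEStronglyMeasurable f μ) :
    MemLp f 2 μ ↔ ∫⁻ x, ‖f x‖ₑ ^ 2 ∂μ < ∞ := by
  rw [MemLp, and_iff_right hf, eLpNorm_lt_top_iff_lintegral_rpow_enorm_lt_top (by norm_num)
    (by norm_num)]
  simp

lemma enorm_mul_enorm_le_min_add {a b R : ℝ≥0∞} (hR : R ≠ 0) (hR' : R ≠ ∞) :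
    a * b ≤ a * min b (R * a) + R⁻¹ * b ^ 2 := by
  rcases le_total b (R * a) with h | h
  · rw [min_eq_left h]; exact le_self_add
  · have h1 : a ≤ R⁻¹ * b := by
      calc a = R⁻¹ * (R * a) := by rw [← mul_assoc, ENNReal.inv_mul_cancel hR hR', one_mul]
        _ ≤ _ := by gcongr
    calc a * b ≤ R⁻¹ * b * b := by gcongr
      _ = R⁻¹ * b ^ 2 := by ring
      _ ≤ _ := le_add_self

/-- Truncate `|d k|` at `R|φ|`. The truncated product is dominated by `R|φ|²` and tends to zero,
while the excess is at most `R⁻¹|d k|²`, whose integral is at most `R⁻¹K` uniformly in `k`. -/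
lemma tendsto_lintegral_enorm_mul_zero {φ : α → E} {d : ℕ → α → E} {K : ℝ≥0∞}
    (hφ : MemLp φ 2 μ) (hd : ∀ k, AEStronglyMeasurable (d k) μ) (hK : K ≠ ∞)
    (hdK : ∀ k, ∫⁻ x, ‖d k x‖ₑ ^ 2 ∂μ ≤ K)
    (hlim : ∀ᵐ x ∂μ, Tendsto (fun k => d k x) atTop (𝓝 0)) :
    Tendsto (fun k => ∫⁻ x, ‖φ x‖ₑ * ‖d k x‖ₑ ∂μ) atTop (𝓝 0) := by
  rw [ENNReal.tendsto_nhds_zero]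
  intro ε hε
  have hφ2 : ∫⁻ x, ‖φ x‖ₑ ^ 2 ∂μ < ∞ := (memLp_two_iff hφ.1).1 hφ
  obtain ⟨R, hR0, hRt, hRK⟩ : ∃ R : ℝ≥0∞, R ≠ 0 ∧ R ≠ ∞ ∧ R⁻¹ * K ≤ ε / 2 := by
    rcases eq_or_ne ε ∞ with rfl | hεt
    · exact ⟨1, by norm_num, by norm_num, by simp [ENNReal.top_div_of_ne_top]⟩
    · have hε2 : ε / 2 ≠ 0 := (ENNReal.half_pos hε.ne').ne'
      have hε2t : ε / 2 ≠ ∞ := ENNReal.div_ne_top hεt (by norm_num)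
      -- Adding `1` keeps `R` nonzero when `K = 0`.
      refine ⟨(K + 1) / (ε / 2), (ENNReal.div_pos (by simp) hε2t).ne',
        ENNReal.div_ne_top (by finiteness) hε2, ?_⟩
      rw [ENNReal.inv_div (Or.inl hε2t) (Or.inl hε2), mul_comm, ← mul_div_assoc]
      refine ENNReal.div_le_of_le_mul ?_
      rw [mul_comm]
      gcongr
      exact le_self_add
  have h1 : Tendsto (fun k => ∫⁻ x, ‖φ x‖ₑ * min ‖d k x‖ₑ (R * ‖φ x‖ₑ) ∂μ) atTop (𝓝 0) := by
    have := tendsto_lintegral_of_dominated_convergence'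
      (F := fun k x => ‖φ x‖ₑ * min ‖d k x‖ₑ (R * ‖φ x‖ₑ)) (f := fun _ => 0) (μ := μ)
      (fun x => R * ‖φ x‖ₑ ^ 2)
      (fun k => hφ.1.enorm.mul ((hd k).enorm.min (hφ.1.enorm.const_mul R)))
      (fun k => ae_of_all _ fun x => show ‖φ x‖ₑ * min ‖d k x‖ₑ (R * ‖φ x‖ₑ) ≤ _ from ?_) ?_ ?_
    · simpa using this
    · calc ‖φ x‖ₑ * min ‖d k x‖ₑ (R * ‖φ x‖ₑ) ≤ ‖φ x‖ₑ * (R * ‖φ x‖ₑ) :=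
            mul_le_mul_right (min_le_right _ _) _
        _ = _ := by ring
    · rw [lintegral_const_mul' _ _ hRt]
      exact ENNReal.mul_ne_top hRt hφ2.ne
    · filter_upwards [hlim] with x hx
      have h2 : Tendsto (fun k => min ‖d k x‖ₑ (R * ‖φ x‖ₑ)) atTop (𝓝 0) := by
        refine tendsto_of_tendsto_of_tendsto_of_le_of_le tendsto_const_nhds
          (by simpa using hx.enorm) (fun _ => zero_le) fun k => min_le_left _ _
      simpa using ENNReal.Tendsto.const_mul h2 (Or.inr enorm_ne_top)
  have hε2 : 0 < ε / 2 := ENNReal.half_pos hε.ne'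
  filter_upwards [(ENNReal.tendsto_nhds_zero.1 h1) (ε / 2) hε2] with k hk
  calc ∫⁻ x, ‖φ x‖ₑ * ‖d k x‖ₑ ∂μ
      ≤ ∫⁻ x, (‖φ x‖ₑ * min ‖d k x‖ₑ (R * ‖φ x‖ₑ) + R⁻¹ * ‖d k x‖ₑ ^ 2) ∂μ :=
        lintegral_mono fun x => enorm_mul_enorm_le_min_add hR0 hRt
    _ = (∫⁻ x, ‖φ x‖ₑ * min ‖d k x‖ₑ (R * ‖φ x‖ₑ) ∂μ) + R⁻¹ * ∫⁻ x, ‖d k x‖ₑ ^ 2 ∂μ := by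
        rw [lintegral_add_right' _ (((hd k).enorm.pow_const 2).const_mul _),
          lintegral_const_mul' _ _ (ENNReal.inv_ne_top.2 hR0)]
    _ ≤ ε / 2 + ε / 2 := by
        gcongr
        exact (mul_le_mul_right (hdK k) _).trans hRK
    _ = ε := ENNReal.add_halves ε

lemma enorm_sub_sq_le (a b : E) : ‖a - b‖ₑ ^ 2 ≤ 2 * (‖a‖ₑ ^ 2 + ‖b‖ₑ ^ 2) := by
  have h : ‖a - b‖ ^ 2 ≤ 2 * (‖a‖ ^ 2 + ‖b‖ ^ 2) := by
    have := norm_sub_le a b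
    nlinarith [norm_nonneg (a - b), sq_nonneg (‖a‖ - ‖b‖)]
  have h2 := ENNReal.ofReal_le_ofReal h
  rw [ENNReal.ofReal_mul (by norm_num), ENNReal.ofReal_add (by positivity) (by positivity),
    ENNReal.ofReal_pow (norm_nonneg _), ENNReal.ofReal_pow (norm_nonneg _),
    ENNReal.ofReal_pow (norm_nonneg _)] at h2
  simpa using h2

lemma lintegral_enorm_sub_sq_le {f g : α → E} (hf : AEStronglyMeasurable f μ) {K : ℝ≥0∞}
    (hfK : ∫⁻ x, ‖f x‖ₑ ^ 2 ∂μ ≤ K) (hgK : ∫⁻ x, ‖g x‖ₑ ^ 2 ∂μ ≤ K) :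
    ∫⁻ x, ‖f x - g x‖ₑ ^ 2 ∂μ ≤ 4 * K := by
  calc _ ≤ ∫⁻ x, 2 * (‖f x‖ₑ ^ 2 + ‖g x‖ₑ ^ 2) ∂μ := lintegral_mono fun x => enorm_sub_sq_le _ _
    _ = 2 * ((∫⁻ x, ‖f x‖ₑ ^ 2 ∂μ) + ∫⁻ x, ‖g x‖ₑ ^ 2 ∂μ) := by
        rw [lintegral_const_mul' _ _ (by norm_num), lintegral_add_left' (hf.enorm.pow_const 2)]
    _ ≤ 2 * (K + K) := by gcongr
    _ = _ := by ring

lemma lintegral_enorm_sq_le_of_ae_tendsto {h : ℕ → α → E} {h' : α → E} {K : ℝ≥0∞}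
    (hh : ∀ k, AEStronglyMeasurable (h k) μ) (hK : ∀ k, ∫⁻ x, ‖h k x‖ₑ ^ 2 ∂μ ≤ K)
    (hlim : ∀ᵐ x ∂μ, Tendsto (fun k => h k x) atTop (𝓝 (h' x))) :
    ∫⁻ x, ‖h' x‖ₑ ^ 2 ∂μ ≤ K := by
  calc ∫⁻ x, ‖h' x‖ₑ ^ 2 ∂μ = ∫⁻ x, liminf (fun k => ‖h k x‖ₑ ^ 2) atTop ∂μ := by
        refine lintegral_congr_ae ?_
        filter_upwards [hlim] with x hx
        exact (Tendsto.liminf_eq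
          ((ENNReal.continuous_pow 2).continuousAt.tendsto.comp hx.enorm)).symm
    _ ≤ liminf (fun k => ∫⁻ x, ‖h k x‖ₑ ^ 2 ∂μ) atTop :=
        lintegral_liminf_le' fun k => (hh k).enorm.pow_const 2
    _ ≤ liminf (fun _ : ℕ => K) atTop := liminf_le_liminf (Eventually.of_forall hK)
    _ = _ := by simp

variable [InnerProductSpace ℝ E]

lemma enorm_inner_le (a b : E) : ‖inner ℝ a b‖ₑ ≤ ‖a‖ₑ * ‖b‖ₑ := by
  rw [← ofReal_norm, ← ofReal_norm, ← ofReal_norm, ← ENNReal.ofReal_mul (norm_nonneg _)]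
  exact ENNReal.ofReal_le_ofReal (norm_inner_le_norm a b)

lemma MemLp.integrable_inner {φ h : α → E} (hφ : MemLp φ 2 μ) (hh : MemLp h 2 μ) :
    Integrable (fun x => inner ℝ (φ x) (h x)) μ := by
  refine Integrable.mono (g := fun x => ‖φ x‖ * ‖h x‖)
    (MemLp.integrable_mul hφ.norm hh.norm) (hφ.1.inner hh.1) (ae_of_all _ fun x => ?_)
  rw [norm_mul, norm_norm, norm_norm]
  exact norm_inner_le_norm _ _

lemma enorm_integral_inner_sq_le {φ h : α → E} (hφ : AEStronglyMeasurable φ μ)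
    (hh : AEStronglyMeasurable h μ) :
    ‖∫ x, inner ℝ (φ x) (h x) ∂μ‖ₑ ^ 2 ≤ (∫⁻ x, ‖φ x‖ₑ ^ 2 ∂μ) * ∫⁻ x, ‖h x‖ₑ ^ 2 ∂μ := by
  refine (pow_le_pow_left' ?_ 2).trans (lintegral_mul_sq_le hφ.enorm hh.enorm)
  exact (enorm_integral_le_lintegral_enorm _).trans (lintegral_mono fun x => enorm_inner_le _ _)

/-- An `L²` bound and almost everywhere convergence give weak convergence. This is the limit
principle for products of mollified functions, where no integrable dominating function is at hand.
-/
theorem tendsto_integral_inner_of_ae_tendsto {φ h' : α → E} {h : ℕ → α → E} {K : ℝ≥0∞}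
    (hφ : MemLp φ 2 μ) (hh : ∀ k, AEStronglyMeasurable (h k) μ) (hK : K ≠ ∞)
    (hhK : ∀ k, ∫⁻ x, ‖h k x‖ₑ ^ 2 ∂μ ≤ K)
    (hlim : ∀ᵐ x ∂μ, Tendsto (fun k => h k x) atTop (𝓝 (h' x))) :
    Tendsto (fun k => ∫ x, inner ℝ (φ x) (h k x) ∂μ) atTop
      (𝓝 (∫ x, inner ℝ (φ x) (h' x) ∂μ)) := by
  have hh' : AEStronglyMeasurable h' μ := aestronglyMeasurable_of_tendsto_ae atTop hh hlim
  have hK' : ∫⁻ x, ‖h' x‖ₑ ^ 2 ∂μ ≤ K := lintegral_enorm_sq_le_of_ae_tendsto hh hhK hlim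
  have hi : ∀ k, Integrable (fun x => inner ℝ (φ x) (h k x)) μ := fun k =>
    MemLp.integrable_inner hφ ((memLp_two_iff (hh k)).2 ((hhK k).trans_lt hK.lt_top))
  have hi' : Integrable (fun x => inner ℝ (φ x) (h' x)) μ :=
    MemLp.integrable_inner hφ ((memLp_two_iff hh').2 (hK'.trans_lt hK.lt_top))
  rw [tendsto_iff_edist_tendsto_0]
  have h0 := tendsto_lintegral_enorm_mul_zero (d := fun k x => h k x - h' x) (K := 4 * K) hφ
    (fun k => (hh k).sub hh') (by finiteness)
    (fun k => lintegral_enorm_sub_sq_le (hh k) (hhK k) hK') (by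
      filter_upwards [hlim] with x hx
      simpa using hx.sub_const (h' x))
  refine tendsto_of_tendsto_of_tendsto_of_le_of_le tendsto_const_nhds h0 (fun _ => zero_le)
    fun k => ?_
  simp only
  rw [edist_eq_enorm_sub, ← integral_sub (hi k) hi']
  refine (enorm_integral_le_lintegral_enorm _).trans (lintegral_mono fun x => ?_)
  rw [← inner_sub_right]
  exact enorm_inner_le _ _

end WeakConvergence

end

section

variable {n : ℕ}

/-! ### Square integrable functions with a weak gradient of bounded mean oscillation -/

/-- `f` has weak gradient `H`, whose mean oscillations over cubes are at most `A`, and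
`∫ |f|² ≤ E`. -/
structure RegularScalar (f : Space n → ℝ) (H : Space n → Space n) (A : ℝ) (E : ℝ≥0∞) : Prop where
  weak : HasWeakGradient f H
  osc : OscLe H (ENNReal.ofReal A)
  bound : ∫⁻ x, ‖f x‖ₑ ^ 2 ≤ E

lemma RegularScalar.mollify {f : Space n → ℝ} {H : Space n → Space n} {A : ℝ} {E : ℝ≥0∞}
    (hf : RegularScalar f H A E) (k : ℕ) :
    RegularScalar (ActiveScalar.mollify k f) (ActiveScalar.mollify k H) A E :=
  ⟨hf.weak.mollify k, hf.osc.mollify hf.weak.2.1 k,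
    (lintegral_enorm_mollify_sq_le k hf.weak.1.aestronglyMeasurable).trans hf.bound⟩

lemma RegularScalar.mono {f : Space n → ℝ} {H : Space n → Space n} {A A' : ℝ} {E E' : ℝ≥0∞}
    (hf : RegularScalar f H A E) (hA : A ≤ A') (hE : E ≤ E') : RegularScalar f H A' E' :=
  ⟨hf.weak, fun c r hr => (hf.osc c r hr).trans (ENNReal.ofReal_le_ofReal hA), hf.bound.trans hE⟩

lemma HasWeakGradient.sub {f g : Space n → ℝ} {Hf Hg : Space n → Space n}
    (hf : HasWeakGradient f Hf) (hg : HasWeakGradient g Hg) :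
    HasWeakGradient (fun x => f x - g x) (fun x => Hf x - Hg x) := by
  refine ⟨hf.1.sub hg.1, hf.2.1.sub hg.2.1, fun ψ hψ hc => ?_⟩
  have hψ1 : ContDiff ℝ 1 ψ := hψ.of_le (by simp)
  have i1 : ∀ {h : Space n → ℝ}, LocallyIntegrable h volume →
      Integrable fun x => h x • gradient ψ x := fun hh =>
    hh.integrable_smul_right_of_hasCompactSupport (continuous_gradient hψ1)
      (HasCompactSupport.gradient hc)
  have i2 : ∀ {h : Space n → Space n}, LocallyIntegrable h volume →
      Integrable fun x => ψ x • h x := fun hh =>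
    hh.integrable_smul_left_of_hasCompactSupport hψ1.continuous hc
  simp_rw [sub_smul, smul_sub]
  rw [integral_sub (i1 hf.1) (i1 hg.1), integral_sub (i2 hf.2.1) (i2 hg.2.1), hf.2.2 ψ hψ hc,
    hg.2.2 ψ hψ hc]
  abel

lemma meanOscillation_sub_le {F : Type*} [NormedAddCommGroup F] [NormedSpace ℝ F] [CompleteSpace F]
    {f g : Space n → F} {Q : Set (Space n)} (hf : IntegrableOn f Q) (hg : IntegrableOn g Q) :
    meanOscillation (fun x => f x - g x) Q ≤ meanOscillation f Q + meanOscillation g Q := by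
  have havg : ⨍ z in Q, (f z - g z) = (⨍ z in Q, f z) - ⨍ z in Q, g z := by
    rw [setAverage_eq, setAverage_eq, setAverage_eq, integral_sub hf hg, smul_sub]
  rw [meanOscillation, havg, meanOscillation, meanOscillation, ← mul_add]
  refine mul_le_mul_right ?_ _
  rw [← lintegral_add_left' (f := fun x => ‖f x - ⨍ z in Q, f z‖ₑ)
    (hf.aestronglyMeasurable.sub aestronglyMeasurable_const).enorm]
  refine lintegral_mono fun x => ?_
  rw [show f x - g x - ((⨍ z in Q, f z) - ⨍ z in Q, g z)
    = (f x - ⨍ z in Q, f z) - (g x - ⨍ z in Q, g z) by abel]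
  exact enorm_sub_le

lemma RegularScalar.sub {f g : Space n → ℝ} {Hf Hg : Space n → Space n} {A : ℝ} {E : ℝ≥0∞}
    (hA : 0 ≤ A) (hf : RegularScalar f Hf A E) (hg : RegularScalar g Hg A E) :
    RegularScalar (fun x => f x - g x) (fun x => Hf x - Hg x) (2 * A) (4 * E) := by
  refine ⟨hf.weak.sub hg.weak, fun c r hr => ?_,
    lintegral_enorm_sub_sq_le hf.weak.1.aestronglyMeasurable hf.bound hg.bound⟩
  refine (meanOscillation_sub_le
    (LocallyIntegrable.integrableOn_of_isBounded hf.weak.2.1 (isBounded_cube c r))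
    (LocallyIntegrable.integrableOn_of_isBounded hg.weak.2.1 (isBounded_cube c r))).trans
    ((add_le_add (hf.osc c r hr) (hg.osc c r hr)).trans_eq ?_)
  rw [← ENNReal.ofReal_add hA hA, two_mul]

/-- A form of the product estimate without the logarithm. -/
lemma exists_lintegral_smul_sq_le (n : ℕ) : ∃ C : ℝ≥0∞, C ≠ ∞ ∧
    ∀ (f g : Space n → ℝ) (Hf Hg : Space n → Space n) (A : ℝ) (E : ℝ≥0∞), 0 < A → E ≠ ∞ →
      RegularScalar f Hf A E → RegularScalar g Hg A E →
      ∫⁻ x, ‖f x • Hg x‖ₑ ^ 2 ≤ C * ENNReal.ofReal A ^ 2 * E := by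
  obtain ⟨C, hC, hprod⟩ := exists_product_le n
  refine ⟨2 * C, by finiteness, fun f g Hf Hg A E hA hE hf hg => ?_⟩
  have h := hprod f g Hf Hg A 1 1 E hf.weak hg.weak hA hf.osc hg.osc le_rfl
    (Real.exp_le_one_iff.2 (by norm_num)) hE hf.bound hg.bound
  simp_rw [enorm_smul, mul_pow]
  refine h.trans ?_
  simp only [one_pow, ENNReal.ofReal_one, one_mul]
  calc _ ≤ C * ENNReal.ofReal A ^ 2 * (E + E) := by gcongr; exact hf.bound
    _ = _ := by ring

lemma enorm_mollify_sq_le {F : Type*} [NormedAddCommGroup F] [NormedSpace ℝ F] (k : ℕ)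
    {f : Space n → F} (hf : AEStronglyMeasurable f volume) (x : Space n) :
    ‖mollify k f x‖ₑ ^ 2 ≤ (∫⁻ y, ‖mollifier n k y‖ₑ ^ 2) * ∫⁻ y, ‖f y‖ₑ ^ 2 := by
  rw [mollify_eq_swap]
  have hc : Continuous fun y => mollifier n k (x - y) := (continuous_mollifier k).comp (by fun_prop)
  refine (pow_le_pow_left' (enorm_integral_le_lintegral_enorm _) 2).trans ?_
  simp_rw [enorm_smul]
  refine (lintegral_mul_sq_le hc.aestronglyMeasurable.enorm hf.enorm).trans_eq ?_
  rw [lintegral_sub_left_eq_self (fun y => ‖mollifier n k y‖ₑ ^ 2) x]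

lemma lintegral_enorm_mollifier_sq_ne_top (k : ℕ) : ∫⁻ y, ‖mollifier n k y‖ₑ ^ 2 ≠ ∞ :=
  ((memLp_two_iff (continuous_mollifier k).aestronglyMeasurable).1
    ((continuous_mollifier k).memLp_of_hasCompactSupport (hasCompactSupport_mollifier k))).ne

/-! ### Testing the divergence constraint with products -/

lemma exists_cutoff (n : ℕ) : ∃ (χ : ℕ → Space n → ℝ) (B : ℝ≥0∞), B ≠ ∞ ∧
    (∀ j, ContDiff ℝ (⊤ : ℕ∞) (χ j)) ∧ (∀ j, HasCompactSupport (χ j)) ∧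
    (∀ j x, ‖χ j x‖ₑ ≤ 1) ∧ (∀ j x, ‖gradient (χ j) x‖ₑ ≤ B) ∧
    ∀ x, ∀ᶠ j in atTop, χ j =ᶠ[𝓝 x] 1 := by
  let b : ContDiffBump (0 : Space n) := ⟨1, 2, by norm_num, by norm_num⟩
  have hb : ContDiff ℝ 1 b := b.contDiff
  obtain ⟨B, hB⟩ := (continuous_gradient hb).bounded_above_of_compact_support
    (HasCompactSupport.gradient b.hasCompactSupport)
  have hs : ∀ j : ℕ, ((j : ℝ) + 1)⁻¹ ≠ 0 := fun j => by positivity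
  refine ⟨fun j x => b (((j : ℝ) + 1)⁻¹ • x), ENNReal.ofReal B, by simp,
    fun j => b.contDiff.comp (contDiff_const_smul _),
    fun j => b.hasCompactSupport.comp_homeomorph (Homeomorph.smulOfNeZero _ (hs j)),
    fun j x => ?_, fun j x => ?_, fun x => ?_⟩
  · rw [← ofReal_norm, Real.norm_of_nonneg b.nonneg]
    exact ENNReal.ofReal_le_one.2 b.le_one
  · rw [enorm_gradient]
    have h := ((hb.differentiable (by simp)) (((j : ℝ) + 1)⁻¹ • x)).hasFDerivAt.comp x
      ((hasFDerivAt_id x).const_smul ((j : ℝ) + 1)⁻¹)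
    rw [show fderiv ℝ (fun x => b (((j : ℝ) + 1)⁻¹ • x)) x = _ from h.fderiv,
      ContinuousLinearMap.comp_smul, ContinuousLinearMap.comp_id, enorm_smul, ← enorm_gradient]
    calc _ ≤ 1 * ENNReal.ofReal B := by
          gcongr
          · rw [← ofReal_norm, Real.norm_of_nonneg (by positivity)]
            refine ENNReal.ofReal_le_one.2 (inv_le_one_of_one_le₀ ?_)
            have := j.cast_nonneg (α := ℝ)
            linarith
          · rw [← ofReal_norm]
            exact ENNReal.ofReal_le_ofReal (hB _)
      _ = _ := one_mul _
  · obtain ⟨N, hN⟩ := exists_nat_gt ‖x‖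
    filter_upwards [eventually_ge_atTop N] with j hj
    have hxj : ‖x‖ < (j : ℝ) + 1 := by
      have : (N : ℝ) ≤ j := by exact_mod_cast hj
      linarith
    filter_upwards [(isOpen_lt continuous_norm continuous_const).mem_nhds hxj] with y hy
    refine b.one_of_mem_closedBall ?_
    rw [mem_closedBall_zero_iff, norm_smul, Real.norm_of_nonneg (by positivity),
      inv_mul_le_iff₀ (by positivity), mul_one]
    exact le_of_lt hy

lemma gradient_mul {f g : Space n → ℝ} {x : Space n} (hf : DifferentiableAt ℝ f x)
    (hg : DifferentiableAt ℝ g x) :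
    gradient (fun y => f y * g y) x = f x • gradient g x + g x • gradient f x := by
  rw [gradient, show fderiv ℝ (fun y => f y * g y) x = _ from
    (hf.hasFDerivAt.mul hg.hasFDerivAt).fderiv, map_add, map_smul, map_smul]
  rfl

lemma enorm_add_sq_le {E : Type*} [NormedAddCommGroup E] (a b : E) :
    ‖a + b‖ₑ ^ 2 ≤ 2 * (‖a‖ₑ ^ 2 + ‖b‖ₑ ^ 2) := by
  simpa using enorm_sub_sq_le a (-b)

/-- Test the constraint with `χ_j f g`. The gradients of these functions are bounded in `L²`
uniformly in `j`, and near each point they eventually equal `∇(fg)`, so the term with `∇χ_j`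
disappears in the weak limit. -/
lemma WeaklyDivFree.integral_inner_smul_add_of_contDiff {u : Space n → Space n} {f g : Space n → ℝ}
    (hu : WeaklyDivFree u) (hu2 : MemLp u 2 volume) (hf : ContDiff ℝ (⊤ : ℕ∞) f)
    (hg : ContDiff ℝ (⊤ : ℕ∞) g) (hfg : ∫⁻ x, ‖f x • gradient g x‖ₑ ^ 2 ≠ ∞)
    (hgf : ∫⁻ x, ‖g x • gradient f x‖ₑ ^ 2 ≠ ∞) (hp : ∫⁻ x, ‖f x * g x‖ₑ ^ 2 ≠ ∞) :
    ∫ x, inner ℝ (u x) (f x • gradient g x + g x • gradient f x) = 0 := by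
  obtain ⟨χ, B, hB, hχ, hc, hχ1, hχB, hχx⟩ := exists_cutoff n
  have hf1 : ContDiff ℝ 1 f := hf.of_le (by simp)
  have hg1 : ContDiff ℝ 1 g := hg.of_le (by simp)
  have hψ : ∀ j, ContDiff ℝ (⊤ : ℕ∞) fun x => χ j x * (f x * g x) := fun j =>
    (hχ j).mul (hf.mul hg)
  have hlim := tendsto_integral_inner_of_ae_tendsto (μ := volume) (φ := u)
    (h' := fun x => f x • gradient g x + g x • gradient f x)
    (h := fun j => gradient fun x => χ j x * (f x * g x))
    (K := 2 * (2 * ((∫⁻ x, ‖f x • gradient g x‖ₑ ^ 2) + ∫⁻ x, ‖g x • gradient f x‖ₑ ^ 2)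
      + B ^ 2 * ∫⁻ x, ‖f x * g x‖ₑ ^ 2)) hu2
    (fun j => (continuous_gradient ((hψ j).of_le (by simp))).aestronglyMeasurable)
    (by finiteness) (fun j => ?_) (ae_of_all _ fun x => ?_)
  · have h0 : ∀ j, ∫ x, inner ℝ (u x) (gradient (fun x => χ j x * (f x * g x)) x) = 0 := fun j =>
      hu.2 _ (hψ j) (hc j).mul_right
    simp_rw [h0] at hlim
    exact tendsto_nhds_unique hlim tendsto_const_nhds
  · have hcf := hf.continuous
    have hcg := hg.continuous
    have hdf := continuous_gradient hf1
    have hdg := continuous_gradient hg1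
    rw [← lintegral_add_left (by fun_prop), ← lintegral_const_mul' _ _ (by norm_num),
      ← lintegral_const_mul' _ _ (by finiteness), ← lintegral_add_left (by fun_prop),
      ← lintegral_const_mul' _ _ (by norm_num)]
    refine lintegral_mono fun x => ?_
    have dj := (hχ j).differentiable (by simp) x
    have df := hf.differentiable (by simp) x
    have dg := hg.differentiable (by simp) x
    rw [gradient_mul dj (show DifferentiableAt ℝ (fun x => f x * g x) x from df.mul dg)]
    refine (enorm_add_sq_le _ _).trans ?_
    gcongr 2 * (?_ + ?_)
    · rw [enorm_smul, mul_pow]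
      calc _ ≤ 1 ^ 2 * ‖gradient (fun x => f x * g x) x‖ₑ ^ 2 := by gcongr; exact hχ1 j x
        _ ≤ _ := by
          rw [one_pow, one_mul, gradient_mul df dg]
          exact enorm_add_sq_le _ _
    · rw [enorm_smul, mul_pow, mul_comm]
      gcongr
      exact hχB j x
  · refine tendsto_const_nhds.congr' ?_
    filter_upwards [hχx x] with j hj
    have : (fun x => χ j x * (f x * g x)) =ᶠ[𝓝 x] fun x => f x * g x := by
      filter_upwards [hj] with y hy
      rw [hy, Pi.one_apply, one_mul]
    rw [← gradient_mul (hf.differentiable (by simp) x) (hg.differentiable (by simp) x)]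
    exact congrArg _ this.fderiv_eq.symm

/-- The formal identity `∫ u · ∇(fg) = 0`. It holds for the mollified pair, and the product estimate
bounds both halves of the Leibniz rule in `L²` uniformly in `k`, so it survives the weak limit. -/
theorem WeaklyDivFree.integral_inner_smul_add {u : Space n → Space n} {f g : Space n → ℝ}
    {Hf Hg : Space n → Space n} {A : ℝ} {E : ℝ≥0∞} (hu : WeaklyDivFree u)
    (hu2 : MemLp u 2 volume) (hA : 0 < A) (hE : E ≠ ∞) (hf : RegularScalar f Hf A E)
    (hg : RegularScalar g Hg A E) :
    ∫ x, inner ℝ (u x) (f x • Hg x + g x • Hf x) = 0 := by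
  obtain ⟨C, hC, hprod⟩ := exists_lintegral_smul_sq_le n
  have hb := hprod f g Hf Hg A E hA hE hf hg
  have hlim := tendsto_integral_inner_of_ae_tendsto (μ := volume) (φ := u)
    (h' := fun x => f x • Hg x + g x • Hf x)
    (h := fun k x => mollify k f x • mollify k Hg x + mollify k g x • mollify k Hf x)
    (K := 2 * (C * ENNReal.ofReal A ^ 2 * E + C * ENNReal.ofReal A ^ 2 * E)) hu2
    (fun k => ?_) (by finiteness) (fun k => ?_) ?_
  · have h0 : ∀ k, ∫ x, inner ℝ (u x) (mollify k f x • mollify k Hg x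
        + mollify k g x • mollify k Hf x) = 0 := fun k => by
      have hfk := hf.mollify k
      have hgk := hg.mollify k
      have h1 := hprod _ _ _ _ A E hA hE hfk hgk
      have h2 := hprod _ _ _ _ A E hA hE hgk hfk
      rw [← gradient_mollify k hf.weak] at h2 ⊢
      rw [← gradient_mollify k hg.weak] at h1 ⊢
      refine hu.integral_inner_smul_add_of_contDiff hu2 (contDiff_mollify k hf.weak.1)
        (contDiff_mollify k hg.weak.1) (ne_top_of_le_ne_top (by finiteness) h1)
        (ne_top_of_le_ne_top (by finiteness) h2) ?_
      -- The product of the mollifications is square integrable because the first factor is bounded,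
      -- by Cauchy–Schwarz against the mollifier, and the second is in `L²`.
      refine ne_top_of_le_ne_top (b := (∫⁻ y, ‖mollifier n k y‖ₑ ^ 2) * E * E)
        (ENNReal.mul_ne_top (ENNReal.mul_ne_top (lintegral_enorm_mollifier_sq_ne_top k) hE) hE) ?_
      calc _ ≤ ∫⁻ x, ((∫⁻ y, ‖mollifier n k y‖ₑ ^ 2) * E) * ‖mollify k g x‖ₑ ^ 2 := by
            refine lintegral_mono fun x => ?_
            rw [enorm_mul, mul_pow]
            gcongr
            exact (enorm_mollify_sq_le k hf.weak.1.aestronglyMeasurable x).trans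
              (mul_le_mul_right hf.bound _)
        _ ≤ _ := by
            rw [lintegral_const_mul' _ _
              (ENNReal.mul_ne_top (lintegral_enorm_mollifier_sq_ne_top k) hE)]
            exact mul_le_mul_right hgk.bound _
    simp_rw [h0] at hlim
    exact tendsto_nhds_unique hlim tendsto_const_nhds
  · have c1 := (contDiff_mollify k hf.weak.1).continuous
    have c2 := (contDiff_mollify k hg.weak.1).continuous
    have c3 := (contDiff_mollify k hf.weak.2.1).continuous
    have c4 := (contDiff_mollify k hg.weak.2.1).continuous
    exact ((c1.smul c4).add (c2.smul c3)).aestronglyMeasurable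
  · have c1 := (contDiff_mollify k hf.weak.1).continuous
    have c4 := (contDiff_mollify k hg.weak.2.1).continuous
    calc _ ≤ ∫⁻ x, 2 * (‖mollify k f x • mollify k Hg x‖ₑ ^ 2
          + ‖mollify k g x • mollify k Hf x‖ₑ ^ 2) := lintegral_mono fun x => enorm_add_sq_le _ _
      _ = 2 * ((∫⁻ x, ‖mollify k f x • mollify k Hg x‖ₑ ^ 2)
          + ∫⁻ x, ‖mollify k g x • mollify k Hf x‖ₑ ^ 2) := by
        rw [lintegral_const_mul' _ _ (by norm_num), lintegral_add_left (by fun_prop)]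
      _ ≤ _ := by
        gcongr
        · exact hprod _ _ _ _ A E hA hE (hf.mollify k) (hg.mollify k)
        · exact hprod _ _ _ _ A E hA hE (hg.mollify k) (hf.mollify k)
  · filter_upwards [ae_tendsto_mollify hf.weak.1, ae_tendsto_mollify hg.weak.1,
      ae_tendsto_mollify hf.weak.2.1, ae_tendsto_mollify hg.weak.2.1] with x h1 h2 h3 h4
    exact (h1.smul h4).add (h2.smul h3)

end

section

variable {n : ℕ}

/-! ### The flux of the difference of two solutions at a fixed time -/

lemma abs_le_of_enorm_sq_le {x y : ℝ} (hy : 0 ≤ y) (h : ‖x‖ₑ ^ 2 ≤ ENNReal.ofReal (y ^ 2)) :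
    |x| ≤ y := by
  rw [← ofReal_norm, ← ENNReal.ofReal_pow (norm_nonneg _),
    ENNReal.ofReal_le_ofReal_iff (by positivity), Real.norm_eq_abs] at h
  exact (sq_le_sq₀ (abs_nonneg x) hy).1 h

lemma inner_smul_sub_smul_left {E : Type*} [NormedAddCommGroup E] [InnerProductSpace ℝ E]
    (a b : ℝ) (u v d : E) :
    inner ℝ (a • u - b • v) d = inner ℝ u (a • d) - inner ℝ v (b • d) := by
  simp only [inner_sub_left, real_inner_smul_left, real_inner_smul_right]

/-- The mollified fluxes converge to `∫ u₁ · θ₁H - ∫ u₂ · θ₂H` with `H = H₁ - H₂`. The divergence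
constraints turn this into `-∫ (u₁ - u₂) · wH₂`, where `w = θ₁ - θ₂`. The difference of the
velocities is controlled by `c‖w‖₂` and `wH₂` by the logarithmic product estimate. The bound uniform
in `k` uses the estimate without the logarithm and provides a dominating function in time. -/
theorem exists_flux_bound (n : ℕ) : ∃ K : ℝ, 0 ≤ K ∧
    ∀ (θ₁ θ₂ : Space n → ℝ) (H₁ H₂ u₁ u₂ : Space n → Space n) (A M c : ℝ),
      0 < A → 0 ≤ M → 0 ≤ c → RegularScalar θ₁ H₁ A (ENNReal.ofReal M) →
      RegularScalar θ₂ H₂ A (ENNReal.ofReal M) → WeaklyDivFree u₁ → WeaklyDivFree u₂ →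
      MemLp u₁ 2 volume → MemLp u₂ 2 volume →
      ∫⁻ x, ‖u₁ x‖ₑ ^ 2 ≤ ENNReal.ofReal (c ^ 2 * M) →
      ∫⁻ x, ‖u₂ x‖ₑ ^ 2 ≤ ENNReal.ofReal (c ^ 2 * M) →
      ∫⁻ x, ‖u₁ x - u₂ x‖ₑ ^ 2 ≤ ENNReal.ofReal (c ^ 2) * ∫⁻ x, ‖θ₁ x - θ₂ x‖ₑ ^ 2 →
      ∃ J : ℝ, Tendsto (fun k => ∫ x, inner ℝ (θ₁ x • u₁ x - θ₂ x • u₂ x)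
          (mollify k (mollify k fun y => H₁ y - H₂ y) x)) atTop (𝓝 J) ∧
        (∀ k, |∫ x, inner ℝ (θ₁ x • u₁ x - θ₂ x • u₂ x)
          (mollify k (mollify k fun y => H₁ y - H₂ y) x)| ≤ K * A * c * M) ∧
        ∀ τ L : ℝ, 1 ≤ L → Real.exp (-L) ≤ τ →
          |J| ≤ K * A * c * (L * (∫⁻ x, ‖θ₁ x - θ₂ x‖ₑ ^ 2).toReal + 2 * τ * M) := by
  obtain ⟨C, hC, hprod⟩ := exists_product_le n
  obtain ⟨C', hC', hprod'⟩ := exists_lintegral_smul_sq_le n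
  lift C to NNReal using hC
  lift C' to NNReal using hC'
  refine ⟨2 * √C + 8 * √C', by positivity, fun θ₁ θ₂ H₁ H₂ u₁ u₂ A M c hA hM hc hr₁ hr₂ hd₁ hd₂
    hu₁ hu₂ hb₁ hb₂ hb => ?_⟩
  have hw := hr₁.sub hA.le hr₂
  have h4 : (1 : ℝ≥0∞) ≤ 4 := by norm_num
  -- The difference has oscillation `2A` and energy `4M`; both solutions are placed in the same
  -- larger class so that one estimate covers every product.
  have hr₁' : RegularScalar θ₁ H₁ (2 * A) (4 * ENNReal.ofReal M) :=
    hr₁.mono (by linarith) (le_mul_of_one_le_left' h4)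
  have hr₂' : RegularScalar θ₂ H₂ (2 * A) (4 * ENNReal.ofReal M) :=
    hr₂.mono (by linarith) (le_mul_of_one_le_left' h4)
  have h2A : 0 < 2 * A := by linarith
  have h4M : 4 * ENNReal.ofReal M ≠ ∞ := by finiteness
  generalize hwdef : (fun x => θ₁ x - θ₂ x) = w at hw
  generalize hHdef : (fun x => H₁ x - H₂ x) = H at hw ⊢
  have hwx : ∀ x, θ₁ x - θ₂ x = w x := fun x => congrFun hwdef x
  have hHx : ∀ x, H₁ x - H₂ x = H x := fun x => congrFun hHdef x
  simp_rw [hwx] at hb ⊢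
  have hDk : ∀ k, Continuous (mollify k (mollify k H)) := fun k =>
    (contDiff_mollify k (contDiff_mollify k hw.weak.2.1).continuous.locallyIntegrable).continuous
  have hR : 4 * (C' : ℝ≥0∞) * ENNReal.ofReal (2 * A) ^ 2 * ENNReal.ofReal M
      = ENNReal.ofReal (16 * C' * A ^ 2 * M) := by
    rw [← ENNReal.ofReal_pow h2A.le, show (C' : ℝ≥0∞) = ENNReal.ofReal C' by simp,
      show (4 : ℝ≥0∞) = ENNReal.ofReal 4 by simp, ← ENNReal.ofReal_mul (by norm_num),
      ← ENNReal.ofReal_mul (by positivity), ← ENNReal.ofReal_mul (by positivity)]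
    congr 1
    ring
  have hprodM : ∀ {θ : Space n → ℝ} {G : Space n → Space n},
      RegularScalar θ G (2 * A) (4 * ENNReal.ofReal M) → ∀ {g : Space n → ℝ}
      {D : Space n → Space n}, RegularScalar g D (2 * A) (4 * ENNReal.ofReal M) →
      ∫⁻ x, ‖θ x • D x‖ₑ ^ 2 ≤ ENNReal.ofReal (16 * C' * A ^ 2 * M) := by
    intro θ G hθ g D hg
    refine (hprod' θ g G D _ _ h2A h4M hθ hg).trans_eq ?_
    rw [← hR]
    ring
  have hmemM : ∀ {θ : Space n → ℝ} {G : Space n → Space n},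
      RegularScalar θ G (2 * A) (4 * ENNReal.ofReal M) → ∀ {g : Space n → ℝ}
      {D : Space n → Space n}, RegularScalar g D (2 * A) (4 * ENNReal.ofReal M) →
      MemLp (fun x => θ x • D x) 2 volume := by
    intro θ G hθ g D hg
    exact (memLp_two_iff (hθ.weak.1.aestronglyMeasurable.smul
      hg.weak.2.1.aestronglyMeasurable)).2 ((hprodM hθ hg).trans_lt ENNReal.ofReal_lt_top)
  have hwk := fun k => (hw.mollify k).mollify k
  have hsplit : ∀ k, ∫ x, inner ℝ (θ₁ x • u₁ x - θ₂ x • u₂ x) (mollify k (mollify k H) x)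
      = (∫ x, inner ℝ (u₁ x) (θ₁ x • mollify k (mollify k H) x))
        - ∫ x, inner ℝ (u₂ x) (θ₂ x • mollify k (mollify k H) x) := by
    intro k
    simp_rw [inner_smul_sub_smul_left]
    exact integral_sub (MemLp.integrable_inner hu₁ (hmemM hr₁' (hwk k)))
      (MemLp.integrable_inner hu₂ (hmemM hr₂' (hwk k)))
  have hpiece : ∀ {θ : Space n → ℝ} {G u : Space n → Space n},
      RegularScalar θ G (2 * A) (4 * ENNReal.ofReal M) → MemLp u 2 volume →
      ∫⁻ x, ‖u x‖ₑ ^ 2 ≤ ENNReal.ofReal (c ^ 2 * M) → ∀ k,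
      |∫ x, inner ℝ (u x) (θ x • mollify k (mollify k H) x)| ≤ 4 * √C' * A * c * M := by
    intro θ G u hθ hu hub k
    refine abs_le_of_enorm_sq_le (by positivity) ?_
    refine (enorm_integral_inner_sq_le hu.1 (hmemM hθ (hwk k)).1).trans
      ((mul_le_mul' hub (hprodM hθ (hwk k))).trans_eq ?_)
    rw [← ENNReal.ofReal_mul (by positivity)]
    congr 1
    linear_combination (-16 * A ^ 2 * c ^ 2 * M ^ 2) * Real.sq_sqrt C'.coe_nonneg
  have hlimpiece : ∀ {θ : Space n → ℝ} {G u : Space n → Space n},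
      RegularScalar θ G (2 * A) (4 * ENNReal.ofReal M) → MemLp u 2 volume →
      Tendsto (fun k => ∫ x, inner ℝ (u x) (θ x • mollify k (mollify k H) x)) atTop
        (𝓝 (∫ x, inner ℝ (u x) (θ x • H x))) := by
    intro θ G u hθ hu
    refine tendsto_integral_inner_of_ae_tendsto hu (fun k => (hmemM hθ (hwk k)).1)
      ENNReal.ofReal_ne_top (fun k => hprodM hθ (hwk k)) ?_
    filter_upwards [ae_tendsto_mollify_mollify hw.weak.2.1] with x hx
    exact hx.const_smul _
  have hJ : (∫ x, inner ℝ (u₁ x) (θ₁ x • H x)) - (∫ x, inner ℝ (u₂ x) (θ₂ x • H x))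
      = -∫ x, inner ℝ (u₁ x - u₂ x) (w x • H₂ x) := by
    -- Testing `u₁` with `w²` removes `∫ u₁ · wH`. Testing `u₁` and `u₂` with `θ₂w` moves the
    -- gradient from `w` onto `θ₂`.
    have d1 := hd₁.integral_inner_smul_add hu₁ h2A h4M hw hw
    have d2 := hd₁.integral_inner_smul_add hu₁ h2A h4M hr₂' hw
    have d3 := hd₂.integral_inner_smul_add hu₂ h2A h4M hr₂' hw
    have i1 := MemLp.integrable_inner hu₁ (hmemM hw hw)
    have i2 := MemLp.integrable_inner hu₁ (hmemM hr₂' hw)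
    have i3 := MemLp.integrable_inner hu₂ (hmemM hr₂' hw)
    have i4 := MemLp.integrable_inner hu₁ (hmemM hw hr₂')
    have i5 := MemLp.integrable_inner hu₂ (hmemM hw hr₂')
    simp_rw [inner_add_right] at d1 d2 d3
    rw [integral_add i1 i1] at d1
    rw [integral_add i2 i4] at d2
    rw [integral_add i3 i5] at d3
    simp_rw [inner_sub_left]
    rw [integral_sub i4 i5]
    have e1 : ∫ x, inner ℝ (u₁ x) (θ₁ x • H x) = (∫ x, inner ℝ (u₁ x) (w x • H x))
        + ∫ x, inner ℝ (u₁ x) (θ₂ x • H x) := by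
      rw [← integral_add i1 i2]
      refine integral_congr_ae (ae_of_all _ fun x => ?_)
      simp only
      rw [← inner_add_right, ← add_smul, ← hwx x, sub_add_cancel]
    rw [e1]
    linarith
  refine ⟨-∫ x, inner ℝ (u₁ x - u₂ x) (w x • H₂ x), ?_, fun k => ?_, fun τ L hL hτL => ?_⟩
  · simp_rw [hsplit, ← hJ]
    exact (hlimpiece hr₁' hu₁).sub (hlimpiece hr₂' hu₂)
  · rw [hsplit]
    refine (abs_sub _ _).trans ((add_le_add (hpiece hr₁' hu₁ hb₁ k) (hpiece hr₂' hu₂ hb₂ k)).trans ?_)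
    have : 0 ≤ 2 * √C * (A * c * M) := by positivity
    linarith
  · have hτ : 0 < τ := (Real.exp_pos _).trans_le hτL
    have hwt : ∫⁻ x, ‖w x‖ₑ ^ 2 ≠ ∞ := ne_top_of_le_ne_top h4M hw.bound
    generalize hy : ∫⁻ x, ‖w x‖ₑ ^ 2 = Y at hb hwt ⊢
    lift Y to NNReal using hwt
    rw [ENNReal.coe_toReal]
    have hp := hprod w θ₂ H H₂ (2 * A) τ L _ hw.weak hr₂'.weak h2A hw.osc hr₂'.osc hL hτL h4M
      hw.bound hr₂'.bound
    rw [hy] at hp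
    have hL0 : 0 ≤ L := by linarith
    rw [abs_neg]
    refine (abs_le_of_enorm_sq_le (y := 2 * √C * A * c * (L * Y + 2 * τ * M))
      (by positivity) ?_).trans ?_
    · refine (enorm_integral_inner_sq_le (hu₁.1.sub hu₂.1) (hmemM hw hr₂').1).trans ?_
      simp_rw [enorm_smul, mul_pow ‖_‖ₑ ‖_‖ₑ 2]
      refine (mul_le_mul' hb hp).trans ?_
      rw [← ENNReal.ofReal_pow h2A.le, show (C : ℝ≥0∞) = ENNReal.ofReal C by simp,
        show (Y : ℝ≥0∞) = ENNReal.ofReal Y by simp, show (4 : ℝ≥0∞) = ENNReal.ofReal 4 by simp,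
        ← ENNReal.ofReal_mul (by positivity), ← ENNReal.ofReal_mul (by positivity),
        ← ENNReal.ofReal_mul (by positivity), ← ENNReal.ofReal_mul (by positivity),
        ← ENNReal.ofReal_mul (by positivity), ← ENNReal.ofReal_add (by positivity) (by positivity),
        ← ENNReal.ofReal_mul (by positivity), ← ENNReal.ofReal_mul (by positivity)]
      refine ENNReal.ofReal_le_ofReal ?_
      have hs := Real.sq_sqrt C.coe_nonneg
      -- Since `L ≥ 1`, this term fits under the cross term of `(LY + 2τM)²`, which makes the square
      -- root harmless.
      have hYL : (Y : ℝ) * (4 * τ * M) ≤ L * Y * (4 * τ * M) := by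
        have : 0 ≤ (Y : ℝ) * (4 * τ * M) := by positivity
        nlinarith
      calc c ^ 2 * Y * (C * (2 * A) ^ 2 * (L ^ 2 * Y + τ * (4 * M)))
          = 4 * C * A ^ 2 * c ^ 2 * ((L * Y) ^ 2 + Y * (4 * τ * M)) := by ring
        _ ≤ 4 * C * A ^ 2 * c ^ 2 * (L * Y + 2 * τ * M) ^ 2 := by
          refine mul_le_mul_of_nonneg_left ?_ (by positivity)
          nlinarith [sq_nonneg (τ * M)]
        _ = _ := by linear_combination (-4 * A ^ 2 * c ^ 2 * (L * Y + 2 * τ * M) ^ 2) * hs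
    · have : 0 ≤ 8 * √C' * (A * c * (L * Y + 2 * τ * M)) := by positivity
      linarith

end

section

/-! ### Primitives and weak derivatives in one variable -/

lemma integral_mul_primitive_add {r ρ : ℝ → ℝ} {a b c d : ℝ}
    (hr : IntervalIntegrable r volume a b) (hρ : IntervalIntegrable ρ volume a b)
    (hc : c ∈ uIcc a b) (hd : d ∈ uIcc a b) :
    ∫ x in a..b, (r x * (∫ s in d..x, ρ s) + (∫ s in c..x, r s) * ρ x)
      = (∫ s in c..b, r s) * (∫ s in d..b, ρ s) - (∫ s in c..a, r s) * ∫ s in d..a, ρ s := by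
  rw [← (hr.absolutelyContinuousOnInterval_intervalIntegral hc).integral_deriv_mul_eq_sub
    (hρ.absolutelyContinuousOnInterval_intervalIntegral hd)]
  refine intervalIntegral.integral_congr_ae ?_
  filter_upwards [hr.ae_hasDerivAt_integral, hρ.ae_hasDerivAt_integral] with x h1 h2 hx
  have hx' := uIoc_subset_uIcc hx
  rw [(h1 hx' c hc).deriv, (h2 hx' d hd).deriv]

lemma sq_primitive_eq {r : ℝ → ℝ} {t : ℝ} (hr : IntervalIntegrable r volume 0 t) :
    (∫ s in (0)..t, r s) ^ 2 = 2 * ∫ x in (0)..t, (∫ s in (0)..x, r s) * r x := by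
  have h := integral_mul_primitive_add hr hr left_mem_uIcc left_mem_uIcc
  rw [intervalIntegral.integral_same, zero_mul, sub_zero] at h
  rw [sq, ← h, ← intervalIntegral.integral_const_mul]
  refine intervalIntegral.integral_congr fun x _ => ?_
  ring

/-- Test functions need not vanish at `0`, so the identity encodes both `a' = r` and `a(0) = 0`. For
`ρ` supported in `(0,T)`, its primitive `P` from `T` vanishes from some point before `T` onwards and
serves as test function. Integration by parts turns `∫ rP` into `-∫ Vρ`, where `V` is the primitive
of `r` from `0`, so `a - V` is orthogonal to every `ρ`. -/
theorem ae_eq_primitive_of_test {T : ℝ} (hT : 0 < T) {a r : ℝ → ℝ}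
    (ha : IntegrableOn a (Ioo 0 T)) (hr : IntegrableOn r (Ioo 0 T))
    (h : ∀ χ : ℝ → ℝ, ContDiff ℝ (⊤ : ℕ∞) χ → HasCompactSupport χ → tsupport χ ⊆ Iio T →
      ∫ t in Ioo 0 T, (a t * deriv χ t + r t * χ t) = 0) :
    ∀ᵐ t ∂(volume.restrict (Ioo 0 T)), a t = ∫ s in (0)..t, r s := by
  have hri : IntervalIntegrable r volume 0 T := by
    rw [intervalIntegrable_iff_integrableOn_Ioo_of_le hT.le]; exact hr
  have hV : ContinuousOn (fun t => ∫ s in (0)..t, r s) (Icc 0 T) := by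
    have := (hri.absolutelyContinuousOnInterval_intervalIntegral left_mem_uIcc).continuousOn
    rwa [uIcc_of_le hT.le] at this
  have hVi : IntegrableOn (fun t => ∫ s in (0)..t, r s) (Ioo 0 T) :=
    (hV.integrableOn_compact isCompact_Icc).mono_set Ioo_subset_Icc_self
  suffices ∀ᵐ t, t ∈ Ioo 0 T → a t - ∫ s in (0)..t, r s = 0 by
    rw [ae_restrict_iff' measurableSet_Ioo]
    filter_upwards [this] with t ht hmem
    exact sub_eq_zero.1 (ht hmem)
  refine isOpen_Ioo.ae_eq_zero_of_integral_contDiff_smul_eq_zero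
    (ha.sub hVi).locallyIntegrableOn fun ρ hρ hρc hρT => ?_
  have hρi : ∀ x y, IntervalIntegrable ρ volume x y := fun x y =>
    hρ.continuous.intervalIntegrable x y
  let P : ℝ → ℝ := fun t => ∫ s in T..t, ρ s
  have hPd : ∀ t, HasDerivAt P (ρ t) t := fun t =>
    intervalIntegral.integral_hasDerivAt_right (hρi T t)
      hρ.continuous.stronglyMeasurable.stronglyMeasurableAtFilter hρ.continuous.continuousAt
  have hPs : ContDiff ℝ (⊤ : ℕ∞) P := by
    refine contDiff_infty_iff_deriv.2 ⟨fun t => (hPd t).differentiableAt, ?_⟩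
    rwa [show deriv P = ρ from funext fun t => (hPd t).deriv]
  obtain ⟨b, hbT, hb⟩ : ∃ b < T, ∀ t, b < t → ρ t = 0 := by
    rcases (tsupport ρ).eq_empty_or_nonempty with he | hne
    · exact ⟨T - 1, by linarith, fun t _ => image_eq_zero_of_notMem_tsupport (by simp [he])⟩
    · obtain ⟨b, hbm, hbmax⟩ := IsCompact.exists_isGreatest hρc hne
      exact ⟨b, (hρT hbm).2, fun t ht => image_eq_zero_of_notMem_tsupport fun hmem =>
        absurd (hbmax hmem) (not_le.2 ht)⟩
  have hPb : ∀ t, b < t → P t = 0 := by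
    intro t ht
    refine intervalIntegral.integral_zero_ae (ae_of_all _ fun s hs => hb s ?_)
    exact (lt_min hbT ht).trans hs.1
  -- This cutoff equals `1` on `[0,∞)` and `0` on `(-∞,-1]`; it makes the test function compactly
  -- supported without changing it on `(0,T)`.
  let κ : ℝ → ℝ := fun t => Real.smoothTransition (t + 1)
  have hχs : ContDiff ℝ (⊤ : ℕ∞) fun t => κ t * P t :=
    (Real.smoothTransition.contDiff.comp (contDiff_id.add contDiff_const)).mul hPs
  have hsub : Function.support (fun t => κ t * P t) ⊆ Icc (-1) b := by
    intro t ht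
    rw [Function.mem_support] at ht
    refine ⟨?_, ?_⟩
    · by_contra hlt
      exact ht (by simp only [κ]; rw [Real.smoothTransition.zero_of_nonpos (by linarith), zero_mul])
    · by_contra hlt
      exact ht (by rw [hPb t (not_le.1 hlt), mul_zero])
  have hts : tsupport (fun t => κ t * P t) ⊆ Icc (-1) b := closure_minimal hsub isClosed_Icc
  have key := h _ hχs (HasCompactSupport.of_support_subset_isCompact isCompact_Icc hsub)
    (hts.trans fun t ht => lt_of_le_of_lt ht.2 hbT)
  have hκ1 : ∀ t : ℝ, 0 ≤ t → κ t = 1 := fun t ht =>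
    Real.smoothTransition.one_of_one_le (show 1 ≤ t + 1 by linarith)
  have key2 : ∫ t in Ioo 0 T, (a t * ρ t + r t * P t) = 0 := by
    refine Eq.trans ?_ key
    refine setIntegral_congr_fun measurableSet_Ioo fun t ht => ?_
    have he : (fun t => κ t * P t) =ᶠ[𝓝 t] P := by
      filter_upwards [Ioi_mem_nhds ht.1] with s hs
      rw [hκ1 s (le_of_lt hs), one_mul]
    rw [he.deriv_eq, (hPd t).deriv, hκ1 t ht.1.le, one_mul]
  have hibp := integral_mul_primitive_add hri (hρi 0 T) left_mem_uIcc right_mem_uIcc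
  rw [intervalIntegral.integral_same, intervalIntegral.integral_same, mul_zero, zero_mul, sub_zero,
    intervalIntegral.integral_of_le hT.le, integral_Ioc_eq_integral_Ioo] at hibp
  have hρt : ∃ B, ∀ t, ‖ρ t‖ ≤ B := hρ.continuous.bounded_above_of_compact_support hρc
  obtain ⟨B, hB⟩ := hρt
  have i1 : IntegrableOn (fun t => a t * ρ t) (Ioo 0 T) :=
    ha.mul_bdd hρ.continuous.aestronglyMeasurable (ae_of_all _ hB)
  have i2 : IntegrableOn (fun t => (∫ s in (0)..t, r s) * ρ t) (Ioo 0 T) :=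
    hVi.mul_bdd hρ.continuous.aestronglyMeasurable (ae_of_all _ hB)
  have i3 : IntegrableOn (fun t => r t * P t) (Ioo 0 T) := by
    have := hri.mul_continuousOn (g := P) hPs.continuous.continuousOn
    rwa [intervalIntegrable_iff_integrableOn_Ioo_of_le hT.le] at this
  have hz : ∫ t in Ioo 0 T, ρ t • (a t - ∫ s in (0)..t, r s) = 0 := by
    rw [integral_add i1 i3] at key2
    rw [integral_add i3 i2] at hibp
    have : ∀ t, ρ t • (a t - ∫ s in (0)..t, r s) = a t * ρ t - (∫ s in (0)..t, r s) * ρ t :=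
      fun t => by rw [smul_eq_mul]; ring
    simp_rw [this]
    rw [integral_sub i1 i2]
    linarith
  refine Eq.trans ?_ hz
  refine (setIntegral_eq_integral_of_forall_compl_eq_zero fun t ht => ?_).symm
  rw [image_eq_zero_of_notMem_tsupport fun hm => ht (hρT hm), zero_smul]

end

section

variable {n : ℕ}

/-! ### Mollified continuity equations -/

/-- Bounds an integral by its square without roots, where finiteness is all that matters. -/
lemma le_one_add_sq (x : ℝ≥0∞) : x ≤ 1 + x ^ 2 := by
  rcases le_total x 1 with h | h
  · exact h.trans le_self_add
  · calc x = x * 1 := (mul_one x).symm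
      _ ≤ x * x := mul_le_mul_right h x
      _ ≤ 1 + x ^ 2 := by rw [← sq]; exact le_add_self

/-- The flux of the vector field `f`, tested against the `k`-th mollifier centred at `y`. -/
def mollifiedFlux (k : ℕ) (f : Space n → Space n) (y : Space n) : ℝ :=
  ∫ x, inner ℝ (f x) (gradient (mollifier n k) (x - y))

lemma continuous_gradient_mollifier (k : ℕ) : Continuous (gradient (mollifier n k)) :=
  continuous_gradient ((contDiff_mollifier k).of_le (by simp))

lemma exists_enorm_gradient_mollifier_le (n k : ℕ) : ∃ B : ℝ≥0∞, B ≠ ∞ ∧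
    (∀ x, ‖gradient (mollifier n k) x‖ₑ ≤ B) ∧ ∫⁻ x, ‖gradient (mollifier n k) x‖ₑ ≤ B := by
  have hc := continuous_gradient_mollifier (n := n) k
  have hs := HasCompactSupport.gradient (hasCompactSupport_mollifier (n := n) k)
  obtain ⟨B, hB⟩ := hc.bounded_above_of_compact_support hs
  refine ⟨ENNReal.ofReal B + ∫⁻ x, ‖gradient (mollifier n k) x‖ₑ,
    ENNReal.add_ne_top.2 ⟨ENNReal.ofReal_ne_top,
      (hc.integrable_of_hasCompactSupport hs).2.ne⟩, fun x => ?_, le_add_self⟩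
  refine le_trans ?_ le_self_add
  rw [← ofReal_norm]
  exact ENNReal.ofReal_le_ofReal (hB x)

lemma lintegral_enorm_inner_le {f : Space n → Space n} {h : Space n → Space n} {B : ℝ≥0∞}
    (hB : B ≠ ∞) (hh : ∀ x, ‖h x‖ₑ ≤ B) :
    ∫⁻ x, ‖(inner ℝ (f x) (h x) : ℝ)‖ₑ ≤ (∫⁻ x, ‖f x‖ₑ) * B := by
  rw [← lintegral_mul_const' _ _ hB]
  exact lintegral_mono fun x => (enorm_inner_le _ _).trans (mul_le_mul_right (hh x) _)

lemma lintegral_prod_enorm_inner_gradient_le {k : ℕ} {B : ℝ≥0∞} (hB : B ≠ ∞)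
    (hB2 : ∫⁻ x, ‖gradient (mollifier n k) x‖ₑ ≤ B) {f : Space n → Space n}
    (hf : AEStronglyMeasurable f volume) :
    ∫⁻ y, ∫⁻ x, ‖(inner ℝ (f x) (gradient (mollifier n k) (x - y)) : ℝ)‖ₑ
      ≤ (∫⁻ x, ‖f x‖ₑ) * B := by
  have hm : AEMeasurable (fun q : Space n × Space n =>
      ‖(inner ℝ (f q.2) (gradient (mollifier n k) (q.2 - q.1)) : ℝ)‖ₑ)
      ((volume : Measure (Space n)).prod volume) :=
    (hf.comp_snd.inner ((continuous_gradient_mollifier k).comp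
      (continuous_snd.sub continuous_fst)).aestronglyMeasurable).enorm
  calc _ = ∫⁻ x, ∫⁻ y, ‖(inner ℝ (f x) (gradient (mollifier n k) (x - y)) : ℝ)‖ₑ :=
        lintegral_lintegral_swap hm
    _ ≤ ∫⁻ x, ‖f x‖ₑ * B := by
        refine lintegral_mono fun x => ?_
        calc _ ≤ ∫⁻ y, ‖f x‖ₑ * ‖gradient (mollifier n k) (x - y)‖ₑ :=
              lintegral_mono fun y => enorm_inner_le _ _
          _ = ‖f x‖ₑ * ∫⁻ y, ‖gradient (mollifier n k) (x - y)‖ₑ := by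
              rw [lintegral_const_mul' _ _ enorm_ne_top]
          _ ≤ _ := by
              rw [lintegral_sub_left_eq_self (fun y => ‖gradient (mollifier n k) y‖ₑ) x]
              exact mul_le_mul_right hB2 _
    _ = _ := lintegral_mul_const' _ _ hB

/-- Fubini moves the mollifier from the flux onto `v`. Applied to `v = mollify k w`, it produces the
double mollification in the energy identity. -/
lemma integral_mul_mollifiedFlux (k : ℕ) {v : Space n → ℝ} {f : Space n → Space n}
    (hv : Continuous v) {V : ℝ≥0∞} (hV : V ≠ ∞) (hvV : ∀ x, ‖v x‖ₑ ≤ V) (hf : Integrable f) :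
    ∫ y, v y * mollifiedFlux k f y = ∫ x, inner ℝ (f x) (gradient (mollify k v) x) := by
  obtain ⟨B, hB, hB1, hB2⟩ := exists_enorm_gradient_mollifier_le n k
  have hm : AEStronglyMeasurable (fun q : Space n × Space n =>
      v q.1 * inner ℝ (f q.2) (gradient (mollifier n k) (q.2 - q.1)))
      ((volume : Measure (Space n)).prod volume) :=
    (hv.comp continuous_fst).aestronglyMeasurable.mul
      (hf.1.comp_snd.inner ((continuous_gradient_mollifier k).comp
        (continuous_snd.sub continuous_fst)).aestronglyMeasurable)
  have hint : Integrable (Function.uncurry fun y x =>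
      v y * inner ℝ (f x) (gradient (mollifier n k) (x - y)))
      ((volume : Measure (Space n)).prod volume) := by
    refine ⟨hm, ?_⟩
    refine (lintegral_prod _ hm.enorm).trans_lt ?_
    calc _ ≤ ∫⁻ y, V * ∫⁻ x, ‖(inner ℝ (f x) (gradient (mollifier n k) (x - y)) : ℝ)‖ₑ := by
          refine lintegral_mono fun y => ?_
          rw [← lintegral_const_mul' _ _ hV]
          refine lintegral_mono fun x => ?_
          rw [enorm_mul]
          exact mul_le_mul_left (hvV y) _
      _ ≤ V * ((∫⁻ x, ‖f x‖ₑ) * B) := by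
          rw [lintegral_const_mul' _ _ hV]
          exact mul_le_mul_right (lintegral_prod_enorm_inner_gradient_le hB hB2 hf.1) _
      _ < ∞ := (ENNReal.mul_ne_top hV (ENNReal.mul_ne_top hf.2.ne hB)).lt_top
  calc _ = ∫ y, ∫ x, v y * inner ℝ (f x) (gradient (mollifier n k) (x - y)) := by
        simp_rw [mollifiedFlux, ← integral_const_mul]
    _ = ∫ x, ∫ y, v y * inner ℝ (f x) (gradient (mollifier n k) (x - y)) :=
        integral_integral_swap hint
    _ = _ := by
        refine integral_congr_ae (ae_of_all _ fun x => ?_)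
        have hi : Integrable fun y => v y • gradient (mollifier n k) (x - y) :=
          hv.locallyIntegrable.integrable_smul_right_of_hasCompactSupport
            ((continuous_gradient_mollifier k).comp (by fun_prop))
            ((HasCompactSupport.gradient (hasCompactSupport_mollifier k)).comp_homeomorph
              (Homeomorph.subLeft x))
        simp only
        rw [gradient_mollify_eq_integral k hv.locallyIntegrable, ← integral_inner hi]
        simp_rw [real_inner_smul_right]

lemma gradient_comp_sub_const (ψ : Space n → ℝ) (y x : Space n) :
    gradient (fun x => ψ (x - y)) x = gradient ψ (x - y) := by
  rw [gradient, fderiv_comp_sub, gradient]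

lemma integrable_slab {F : Type*} [NormedAddCommGroup F] {T : ℝ} {G : ℝ × Space n → F}
    {B : ℝ≥0∞} (hB : B ≠ ∞) (hG : AEStronglyMeasurable G (slab n T))
    (h : ∀ᵐ t ∂(volume.restrict (Ioo 0 T)), ∫⁻ x, ‖G (t, x)‖ₑ ≤ B) : Integrable G (slab n T) := by
  refine ⟨hG, ?_⟩
  rw [HasFiniteIntegral, slab, lintegral_prod _ hG.enorm]
  calc _ ≤ ∫⁻ _t in Ioo 0 T, B := lintegral_mono_ae h
    _ < ∞ := by
      rw [lintegral_const, Measure.restrict_apply_univ]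
      exact (ENNReal.mul_ne_top hB (by simp)).lt_top

variable {T : ℝ} {w : ℝ × Space n → ℝ} {F : ℝ × Space n → Space n}

/-- `(w, F)` is a weak solution of `∂ₜ w + div F = 0` on `(0,T) × ℝⁿ` with zero initial datum. -/
def SolvesContinuity (T : ℝ) (w : ℝ × Space n → ℝ) (F : ℝ × Space n → Space n) : Prop :=
  ∀ φ : ℝ × Space n → ℝ, ContDiff ℝ (⊤ : ℕ∞) φ → HasCompactSupport φ →
    tsupport φ ⊆ Iio T ×ˢ univ →
    ∫ z, (w z * deriv (fun s => φ (s, z.2)) z.1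
      + inner ℝ (F z) (gradient (fun y => φ (z.1, y)) z.2)) ∂(slab n T) = 0

lemma lintegral_mollifier_mul_le (k : ℕ) {v : Space n → ℝ} (hv : AEStronglyMeasurable v volume)
    {M : ℝ≥0∞} (hM : ∫⁻ x, ‖v x‖ₑ ^ 2 ≤ M) (y : Space n) :
    ∫⁻ x, ‖v x * mollifier n k (x - y)‖ₑ ≤ 1 + M * ∫⁻ x, ‖mollifier n k x‖ₑ ^ 2 := by
  simp_rw [enorm_mul]
  refine (le_one_add_sq _).trans (add_le_add_right ?_ _)
  refine (lintegral_mul_sq_le hv.enorm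
    ((continuous_mollifier k).comp (by fun_prop)).aestronglyMeasurable.enorm).trans ?_
  exact mul_le_mul' hM (lintegral_sub_right_eq_self (fun x => ‖mollifier n k x‖ₑ ^ 2) y).le

lemma mollify_eq_integral_mul (k : ℕ) (v : Space n → ℝ) (y : Space n) :
    mollify k v y = ∫ x, v x * mollifier n k (x - y) := by
  rw [mollify_eq_swap]
  refine integral_congr_ae (ae_of_all _ fun x => ?_)
  simp only
  rw [smul_eq_mul, mul_comm, ← mollifier_neg, neg_sub]

/-- Test the equation with `χ(t) η(x - y)` for fixed `y`. Fubini leaves a one-variable weak equation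
with zero initial value. -/
theorem SolvesContinuity.mollify_eq (hsol : SolvesContinuity T w F) (hT : 0 < T)
    (hw : StronglyMeasurable w) (hF : StronglyMeasurable F) {M M' : ℝ≥0∞} (hM : M ≠ ∞)
    (hM' : M' ≠ ∞) (hwM : ∀ᵐ t ∂(volume.restrict (Ioo 0 T)), ∫⁻ x, ‖w (t, x)‖ₑ ^ 2 ≤ M)
    (hFM : ∀ᵐ t ∂(volume.restrict (Ioo 0 T)), ∫⁻ x, ‖F (t, x)‖ₑ ≤ M') (k : ℕ) (y : Space n) :
    ∀ᵐ t ∂(volume.restrict (Ioo 0 T)), mollify k (fun x => w (t, x)) y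
      = ∫ s in (0)..t, mollifiedFlux k (fun x => F (s, x)) y := by
  obtain ⟨B, hB, hB1, hB2⟩ := exists_enorm_gradient_mollifier_le n k
  have hN := lintegral_enorm_mollifier_sq_ne_top (n := n) k
  have cη : Continuous fun z : ℝ × Space n => mollifier n k (z.2 - y) :=
    (continuous_mollifier k).comp (by fun_prop)
  have cdη : Continuous fun z : ℝ × Space n => gradient (mollifier n k) (z.2 - y) :=
    (continuous_gradient_mollifier k).comp (by fun_prop)
  have hwt : ∀ t, StronglyMeasurable fun x => w (t, x) := fun t =>
    hw.comp_measurable measurable_prodMk_left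
  have i1 : Integrable (fun z : ℝ × Space n => w z * mollifier n k (z.2 - y)) (slab n T) := by
    refine integrable_slab (B := 1 + M * ∫⁻ x, ‖mollifier n k x‖ₑ ^ 2)
      (ENNReal.add_ne_top.2 ⟨by simp, ENNReal.mul_ne_top hM hN⟩)
      (hw.aestronglyMeasurable.mul cη.aestronglyMeasurable) ?_
    filter_upwards [hwM] with t ht
    exact lintegral_mollifier_mul_le k (hwt t).aestronglyMeasurable ht y
  have i2 : Integrable (fun z : ℝ × Space n => (inner ℝ (F z)
      (gradient (mollifier n k) (z.2 - y)) : ℝ)) (slab n T) := by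
    refine integrable_slab (B := M' * B) (ENNReal.mul_ne_top hM' hB)
      (hF.aestronglyMeasurable.inner cdη.aestronglyMeasurable) ?_
    filter_upwards [hFM] with t ht
    exact (lintegral_enorm_inner_le hB fun x => hB1 (x - y)).trans (mul_le_mul_left ht _)
  have e1 : ∀ t, mollify k (fun x => w (t, x)) y = ∫ x, w (t, x) * mollifier n k (x - y) :=
    fun t => mollify_eq_integral_mul k _ y
  refine ae_eq_primitive_of_test hT ?_ ?_ fun χ hχ hχc hχT => ?_
  · simp_rw [e1]
    exact i1.integral_prod_left
  · exact i2.integral_prod_left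
  · have hφ : ContDiff ℝ (⊤ : ℕ∞) fun z : ℝ × Space n => χ z.1 * mollifier n k (z.2 - y) :=
      (hχ.comp contDiff_fst).mul ((contDiff_mollifier k).comp (contDiff_snd.sub contDiff_const))
    have hφc : HasCompactSupport fun z : ℝ × Space n => χ z.1 * mollifier n k (z.2 - y) := by
      have hk2 : HasCompactSupport fun x => mollifier n k (x - y) :=
        (hasCompactSupport_mollifier k).comp_homeomorph (Homeomorph.subRight y)
      refine HasCompactSupport.intro (IsCompact.prod hχc hk2) fun z hz => ?_
      by_contra hne
      refine hz ⟨subset_tsupport _ (left_ne_zero_of_mul hne),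
        subset_tsupport (fun x => mollifier n k (x - y)) (right_ne_zero_of_mul hne)⟩
    have hφT : tsupport (fun z : ℝ × Space n => χ z.1 * mollifier n k (z.2 - y))
        ⊆ Iio T ×ˢ univ := by
      refine (closure_minimal (t := Prod.fst ⁻¹' tsupport χ) (fun z hz => ?_)
        ((isClosed_tsupport χ).preimage continuous_fst)).trans fun z hz => ⟨hχT hz, mem_univ _⟩
      exact subset_tsupport _ (left_ne_zero_of_mul hz)
    have h := hsol _ hφ hφc hφT
    obtain ⟨B1, hχB⟩ := hχ.continuous.bounded_above_of_compact_support hχc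
    have hχd : Continuous (deriv χ) := hχ.continuous_deriv (by simp)
    obtain ⟨B2, hχB'⟩ := hχd.bounded_above_of_compact_support hχc.deriv
    have hd : ∀ z : ℝ × Space n, deriv (fun s => χ s * mollifier n k (z.2 - y)) z.1
        = deriv χ z.1 * mollifier n k (z.2 - y) := fun z =>
      deriv_mul_const ((hχ.differentiable (by simp)) _) _
    have hg : ∀ z : ℝ × Space n, gradient (fun x => χ z.1 * mollifier n k (x - y)) z.2
        = χ z.1 • gradient (mollifier n k) (z.2 - y) := fun z => by
      have hs : ContDiff ℝ 1 fun x => mollifier n k (x - y) :=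
        ((contDiff_mollifier k).comp (contDiff_id.sub contDiff_const)).of_le (by simp)
      rw [congrFun (gradient_const_mul hs (χ z.1)) z.2, gradient_comp_sub_const]
    simp_rw [hd, hg, real_inner_smul_right] at h
    have j1 : Integrable (fun z : ℝ × Space n => w z * (deriv χ z.1 * mollifier n k (z.2 - y)))
        (slab n T) := by
      refine (i1.mul_bdd (g := fun z => deriv χ z.1) (c := B2)
        (hχd.comp continuous_fst).aestronglyMeasurable (ae_of_all _ fun z => hχB' _)).congr
        (ae_of_all _ fun z => ?_)
      simp only
      ring
    have j2 : Integrable (fun z : ℝ × Space n => χ z.1 * (inner ℝ (F z)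
        (gradient (mollifier n k) (z.2 - y)) : ℝ)) (slab n T) :=
      i2.bdd_mul (hχ.continuous.comp continuous_fst).aestronglyMeasurable
        (ae_of_all _ fun z => hχB _)
    rw [integral_add j1 j2] at h
    rw [slab] at j1 j2 h
    rw [integral_prod _ j1, integral_prod _ j2,
      ← integral_add j1.integral_prod_left j2.integral_prod_left] at h
    refine Eq.trans ?_ h
    refine integral_congr_ae (ae_of_all _ fun t => ?_)
    simp only
    rw [e1, mollifiedFlux, ← integral_mul_const, ← integral_mul_const]
    congr 1
    · refine integral_congr_ae (ae_of_all _ fun x => ?_)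
      simp only
      ring
    · refine integral_congr_ae (ae_of_all _ fun x => ?_)
      simp only
      ring

end

section

variable {n : ℕ}

/-! ### The energy identity for mollified solutions -/

variable {T : ℝ} {w : ℝ × Space n → ℝ} {F : ℝ × Space n → Space n}

lemma stronglyMeasurable_mollify (hw : StronglyMeasurable w) (k : ℕ) :
    StronglyMeasurable fun z : ℝ × Space n => mollify k (fun x => w (z.1, x)) z.2 := by
  simp_rw [mollify_eq_integral_mul]
  refine StronglyMeasurable.integral_prod_right' (f := fun p : (ℝ × Space n) × Space n =>
    w (p.1.1, p.2) * mollifier n k (p.2 - p.1.2)) ?_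
  exact (hw.comp_measurable (by fun_prop)).mul
    ((continuous_mollifier k).comp (by fun_prop)).stronglyMeasurable

lemma stronglyMeasurable_mollifiedFlux (hF : StronglyMeasurable F) (k : ℕ) :
    StronglyMeasurable fun z : ℝ × Space n => mollifiedFlux k (fun x => F (z.1, x)) z.2 := by
  refine StronglyMeasurable.integral_prod_right' (f := fun p : (ℝ × Space n) × Space n =>
    (inner ℝ (F (p.1.1, p.2)) (gradient (mollifier n k) (p.2 - p.1.2)) : ℝ)) ?_
  exact (hF.comp_measurable (by fun_prop)).inner
    ((continuous_gradient_mollifier k).comp (by fun_prop)).stronglyMeasurable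

lemma stronglyMeasurable_primitive {R : ℝ × Space n → ℝ} (hR : StronglyMeasurable R) :
    StronglyMeasurable fun z : ℝ × Space n => ∫ s in Ioc 0 z.1, R (s, z.2) := by
  have h : ∀ z : ℝ × Space n, ∫ s in Ioc 0 z.1, R (s, z.2)
      = ∫ s, {p : (ℝ × Space n) × ℝ | 0 < p.2 ∧ p.2 ≤ p.1.1}.indicator
        (fun p => R (p.2, p.1.2)) (z, s) := fun z => by
    rw [← integral_indicator measurableSet_Ioc]
    rfl
  simp_rw [h]
  refine StronglyMeasurable.integral_prod_right' (StronglyMeasurable.indicator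
    (hR.comp_measurable (by fun_prop)) ?_)
  exact (measurableSet_lt measurable_const measurable_snd).inter
    (measurableSet_le measurable_snd (by fun_prop))

lemma enorm_mollifiedFlux_le {k : ℕ} {B : ℝ≥0∞} (hB : B ≠ ∞)
    (hB1 : ∀ x, ‖gradient (mollifier n k) x‖ₑ ≤ B) (f : Space n → Space n) (y : Space n) :
    ‖mollifiedFlux k f y‖ₑ ≤ (∫⁻ x, ‖f x‖ₑ) * B :=
  (enorm_integral_le_lintegral_enorm _).trans
    (lintegral_enorm_inner_le hB fun x => hB1 (x - y))

lemma ae_integral_mollify_mul_mollifiedFlux (hw : StronglyMeasurable w) (hF : StronglyMeasurable F)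
    {M M' : ℝ≥0∞} (hM : M ≠ ∞) (hM' : M' ≠ ∞)
    (hwM : ∀ᵐ t ∂(volume.restrict (Ioo 0 T)), ∫⁻ x, ‖w (t, x)‖ₑ ^ 2 ≤ M)
    (hFM : ∀ᵐ t ∂(volume.restrict (Ioo 0 T)), ∫⁻ x, ‖F (t, x)‖ₑ ≤ M') (k : ℕ) :
    ∀ᵐ s ∂(volume.restrict (Ioo 0 T)),
      ∫ y, mollify k (fun x => w (s, x)) y * mollifiedFlux k (fun x => F (s, x)) y
        = ∫ x, inner ℝ (F (s, x)) (gradient (mollify k (mollify k fun x => w (s, x))) x) := by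
  have hN := lintegral_enorm_mollifier_sq_ne_top (n := n) k
  have hFt : ∀ t, AEStronglyMeasurable (fun x => F (t, x)) volume := fun t =>
    (hF.comp_measurable measurable_prodMk_left).aestronglyMeasurable
  have hwt : ∀ t, AEStronglyMeasurable (fun x => w (t, x)) volume := fun t =>
    (hw.comp_measurable measurable_prodMk_left).aestronglyMeasurable
  filter_upwards [hwM, hFM] with s h2 h3
  have hl : LocallyIntegrable (fun x => w (s, x)) volume :=
    ((memLp_two_iff (hwt s)).2 (h2.trans_lt hM.lt_top)).locallyIntegrable (by norm_num)
  refine integral_mul_mollifiedFlux k (contDiff_mollify k hl).continuous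
    (V := 1 + (∫⁻ y, ‖mollifier n k y‖ₑ ^ 2) * M)
    (ENNReal.add_ne_top.2 ⟨by simp, ENNReal.mul_ne_top hN hM⟩) (fun x => ?_)
    ⟨hFt s, h3.trans_lt hM'.lt_top⟩
  refine (le_one_add_sq _).trans (add_le_add_right ?_ _)
  exact (enorm_mollify_sq_le k (hwt s) x).trans (mul_le_mul_right h2 _)

/-- Measurability in time is read off from the other side of the Fubini identity, an integral of a
jointly measurable product. -/
lemma aestronglyMeasurable_integral_inner_gradient (hw : StronglyMeasurable w)
    (hF : StronglyMeasurable F) {M M' : ℝ≥0∞} (hM : M ≠ ∞) (hM' : M' ≠ ∞)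
    (hwM : ∀ᵐ t ∂(volume.restrict (Ioo 0 T)), ∫⁻ x, ‖w (t, x)‖ₑ ^ 2 ≤ M)
    (hFM : ∀ᵐ t ∂(volume.restrict (Ioo 0 T)), ∫⁻ x, ‖F (t, x)‖ₑ ≤ M') (k : ℕ) :
    AEStronglyMeasurable (fun s => ∫ x, (inner ℝ (F (s, x))
      (gradient (mollify k (mollify k fun x => w (s, x))) x) : ℝ)) (volume.restrict (Ioo 0 T)) := by
  refine AEStronglyMeasurable.congr (StronglyMeasurable.aestronglyMeasurable ?_)
    (ae_integral_mollify_mul_mollifiedFlux hw hF hM hM' hwM hFM k)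
  exact ((stronglyMeasurable_mollify hw k).mul
    (stronglyMeasurable_mollifiedFlux hF k)).integral_prod_right'

/-- For each `y` the mollified solution is the time primitive `W` of the mollified flux `R`, so `W²
= 2 ∫ WR` by the chain rule for absolutely continuous functions. Integrating in `y` and moving the
mollifier back gives the identity. The double integral converges because `W` is bounded and `R` is
integrable. -/
theorem SolvesContinuity.energy (hsol : SolvesContinuity T w F) (hT : 0 < T)
    (hw : StronglyMeasurable w) (hF : StronglyMeasurable F) {M M' : ℝ≥0∞} (hM : M ≠ ∞)
    (hM' : M' ≠ ∞) (hwM : ∀ᵐ t ∂(volume.restrict (Ioo 0 T)), ∫⁻ x, ‖w (t, x)‖ₑ ^ 2 ≤ M)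
    (hFM : ∀ᵐ t ∂(volume.restrict (Ioo 0 T)), ∫⁻ x, ‖F (t, x)‖ₑ ≤ M') (k : ℕ) :
    ∀ᵐ t ∂(volume.restrict (Ioo 0 T)), ∫⁻ y, ‖mollify k (fun x => w (t, x)) y‖ₑ ^ 2
      = ENNReal.ofReal (2 * ∫ s in (0)..t, ∫ x, inner ℝ (F (s, x))
        (gradient (mollify k (mollify k fun x => w (s, x))) x)) := by
  obtain ⟨B, hB, hB1, hB2⟩ := exists_enorm_gradient_mollifier_le n k
  let R : ℝ × Space n → ℝ := fun z => mollifiedFlux k (fun x => F (z.1, x)) z.2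
  let W : ℝ × Space n → ℝ := fun z => ∫ s in Ioc 0 z.1, R (s, z.2)
  have hRm : StronglyMeasurable R := stronglyMeasurable_mollifiedFlux hF k
  have hWm : StronglyMeasurable W := stronglyMeasurable_primitive hRm
  have ham := stronglyMeasurable_mollify hw k
  have hMB : M' * B ≠ ∞ := ENNReal.mul_ne_top hM' hB
  have hFt : ∀ t, AEStronglyMeasurable (fun x => F (t, x)) volume := fun t =>
    (hF.comp_measurable measurable_prodMk_left).aestronglyMeasurable
  have hRb : ∀ᵐ t ∂(volume.restrict (Ioo 0 T)), ∀ y, ‖R (t, y)‖ₑ ≤ M' * B := by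
    filter_upwards [hFM] with t ht y
    exact (enorm_mollifiedFlux_le hB hB1 _ y).trans (mul_le_mul_left ht _)
  have hRint : ∀ y, ∫⁻ s in Ioo 0 T, ‖R (s, y)‖ₑ ≤ M' * B * volume (Ioo 0 T) := fun y => by
    rw [← setLIntegral_const]
    refine lintegral_mono_ae ?_
    filter_upwards [hRb] with t ht
    exact ht y
  have hRfin : M' * B * volume (Ioo 0 T) ≠ ∞ := ENNReal.mul_ne_top hMB (by simp)
  have hRi : ∀ y, IntegrableOn (fun s => R (s, y)) (Ioo 0 T) := fun y =>
    ⟨(hRm.comp_measurable measurable_prodMk_right).aestronglyMeasurable,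
      (hRint y).trans_lt hRfin.lt_top⟩
  have hsub : ∀ {t}, t < T → Ioc 0 t ⊆ Ioo 0 T := fun ht s hs => ⟨hs.1, hs.2.trans_lt ht⟩
  have hWb : ∀ t < T, ∀ y, ‖W (t, y)‖ₑ ≤ M' * B * volume (Ioo 0 T) := fun t ht y =>
    (enorm_integral_le_lintegral_enorm _).trans ((lintegral_mono_set (hsub ht)).trans (hRint y))
  have hWR : Integrable (fun z => W z * R z) (slab n T) := by
    refine integrable_slab (B := M' * B * volume (Ioo 0 T) * (M' * B))
      (ENNReal.mul_ne_top hRfin hMB) (hWm.mul hRm).aestronglyMeasurable ?_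
    filter_upwards [hFM, ae_restrict_mem measurableSet_Ioo] with t ht htT
    calc _ ≤ ∫⁻ y, M' * B * volume (Ioo 0 T) * ‖R (t, y)‖ₑ := by
          refine lintegral_mono fun y => ?_
          rw [enorm_mul]
          exact mul_le_mul_left (hWb t htT.2 y) _
      _ = M' * B * volume (Ioo 0 T) * ∫⁻ y, ‖R (t, y)‖ₑ := lintegral_const_mul' _ _ hRfin
      _ ≤ _ := by
          refine mul_le_mul_right ?_ _
          refine (lintegral_mono fun y => enorm_integral_le_lintegral_enorm _).trans
            ((lintegral_prod_enorm_inner_gradient_le hB hB2 (hFt t)).trans (mul_le_mul_left ht _))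
  have haW : ∀ᵐ t ∂(volume.restrict (Ioo 0 T)), ∀ᵐ y,
      mollify k (fun x => w (t, x)) y = W (t, y) := by
    have hms : MeasurableSet {z : ℝ × Space n | mollify k (fun x => w (z.1, x)) z.2 = W (z.1, z.2)} :=
      measurableSet_eq_fun ham.measurable hWm.measurable
    -- The exceptional times depend on `y`; joint measurability allows the order of the two almost
    -- everywhere quantifiers to be exchanged.
    refine (Measure.ae_ae_comm hms).2 (ae_of_all _ fun y => ?_)
    filter_upwards [hsol.mollify_eq hT hw hF hM hM' hwM hFM k y,
      ae_restrict_mem measurableSet_Ioo] with t ht htT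
    rw [ht, intervalIntegral.integral_of_le htT.1.le]
  have hid : ∀ᵐ s ∂(volume.restrict (Ioo 0 T)), ∫ y, W (s, y) * R (s, y)
      = ∫ x, inner ℝ (F (s, x)) (gradient (mollify k (mollify k fun x => w (s, x))) x) := by
    filter_upwards [haW, ae_integral_mollify_mul_mollifiedFlux hw hF hM hM' hwM hFM k] with s h1 h2
    rw [← h2]
    refine integral_congr_ae ?_
    filter_upwards [h1] with y hy
    rw [hy]
  filter_upwards [haW, ae_restrict_mem measurableSet_Ioo] with t h1 htT
  have hsq : ∀ y, W (t, y) ^ 2 = 2 * ∫ s in Ioc 0 t, W (s, y) * R (s, y) := fun y => by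
    have hi : IntervalIntegrable (fun s => R (s, y)) volume 0 t :=
      (intervalIntegrable_iff_integrableOn_Ioc_of_le htT.1.le).2 ((hRi y).mono_set (hsub htT.2))
    have h := sq_primitive_eq hi
    rw [intervalIntegral.integral_of_le htT.1.le, intervalIntegral.integral_of_le htT.1.le] at h
    refine h.trans (congrArg _ (setIntegral_congr_fun measurableSet_Ioc fun s hs => ?_))
    simp only [W]
    rw [intervalIntegral.integral_of_le hs.1.le]
  have hres : Integrable (fun z => W z * R z)
      ((volume.restrict (Ioc 0 t)).prod (volume : Measure (Space n))) := by
    have h := hWR.restrict (s := Ioc 0 t ×ˢ univ)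
    rwa [slab, ← Measure.prod_restrict, Measure.restrict_restrict measurableSet_Ioc,
      inter_eq_left.2 (hsub htT.2), Measure.restrict_univ] at h
  have hW2 : Integrable fun y => W (t, y) ^ 2 := by
    simp_rw [hsq]
    exact hres.integral_prod_right.const_mul 2
  calc ∫⁻ y, ‖mollify k (fun x => w (t, x)) y‖ₑ ^ 2 = ∫⁻ y, ENNReal.ofReal (W (t, y) ^ 2) := by
        refine lintegral_congr_ae ?_
        filter_upwards [h1] with y hy
        rw [hy, ← ofReal_norm, ← ENNReal.ofReal_pow (norm_nonneg _), Real.norm_eq_abs, sq_abs]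
    _ = ENNReal.ofReal (∫ y, W (t, y) ^ 2) :=
        (ofReal_integral_eq_lintegral_ofReal hW2 (ae_of_all _ fun y => sq_nonneg _)).symm
    _ = _ := by
        congr 1
        simp_rw [hsq]
        rw [integral_const_mul, intervalIntegral.integral_of_le htT.1.le,
          ← integral_integral_swap hres]
        congr 1
        exact integral_congr_ae (ae_restrict_of_ae_restrict_of_subset (hsub htT.2) hid)

end

section

/-! ### Gronwall's inequality with integrable coefficients and an Osgood criterion -/

/-- The power rule for a primitive of a merely integrable `g`, by induction through integration by
parts. -/
lemma integral_mul_pow_primitive {g : ℝ → ℝ} {a b : ℝ} (hg : IntervalIntegrable g volume a b)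
    (hab : a ≤ b) (j : ℕ) : ∀ x ∈ Icc a b, ∫ s in a..x, g s * (∫ r in a..s, g r) ^ j
      = (∫ r in a..x, g r) ^ (j + 1) / (j + 1) := by
  have hG : ContinuousOn (fun s => ∫ r in a..s, g r) (uIcc a b) :=
    (hg.absolutelyContinuousOnInterval_intervalIntegral left_mem_uIcc).continuousOn
  induction j with
  | zero => intro x _; simp
  | succ j ih =>
    intro x hx
    have hsub : uIcc a x ⊆ uIcc a b := by
      rw [uIcc_of_le hx.1, uIcc_of_le hab]; exact Icc_subset_Icc_right hx.2
    have hgx : IntervalIntegrable g volume a x := hg.mono_set hsub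
    have hρ : IntervalIntegrable (fun s => g s * (∫ r in a..s, g r) ^ j) volume a x :=
      hgx.mul_continuousOn ((hG.mono hsub).pow j)
    have h := integral_mul_primitive_add hgx hρ left_mem_uIcc left_mem_uIcc
    rw [intervalIntegral.integral_same, zero_mul, sub_zero, ih x hx] at h
    have hj : (j : ℝ) + 1 ≠ 0 := by positivity
    have hj2 : (j : ℝ) + 1 + 1 ≠ 0 := by positivity
    have e : ∀ s ∈ uIcc a x, g s * (∫ u in a..s, g u * (∫ r in a..u, g r) ^ j)
        + (∫ r in a..s, g r) * (g s * (∫ r in a..s, g r) ^ j)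
        = (((j : ℝ) + 1 + 1) / (j + 1)) * (g s * (∫ r in a..s, g r) ^ (j + 1)) := by
      intro s hs
      rw [uIcc_of_le hx.1] at hs
      rw [ih s ⟨hs.1, hs.2.trans hx.2⟩]
      field_simp
      ring
    rw [intervalIntegral.integral_congr e, intervalIntegral.integral_const_mul] at h
    push_cast
    field_simp at h ⊢
    linear_combination h

/-- Picard iteration: inserting the inequality into itself `j` times produces the partial sums of
the exponential and a remainder `D G^j / j!`, where `G` is the primitive of `g`. No continuity of
`v` is needed, and each step tolerates null sets. -/
theorem gronwall_of_ae_le {g v : ℝ → ℝ} {a b c D : ℝ} (hab : a < b)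
    (hg : IntervalIntegrable g volume a b) (hg0 : ∀ s, 0 ≤ g s)
    (hv : AEStronglyMeasurable v (volume.restrict (Ioo a b))) (hc : 0 ≤ c)
    (hvD : ∀ᵐ t ∂(volume.restrict (Ioo a b)), ‖v t‖ ≤ D)
    (h : ∀ᵐ t ∂(volume.restrict (Ioo a b)), v t ≤ c + ∫ s in a..t, g s * v s) :
    ∀ᵐ t ∂(volume.restrict (Ioo a b)), v t ≤ c * Real.exp (∫ s in a..t, g s) := by
  have hG : ContinuousOn (fun s => ∫ r in a..s, g r) (Icc a b) := by
    have := (hg.absolutelyContinuousOnInterval_intervalIntegral left_mem_uIcc).continuousOn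
    rwa [uIcc_of_le hab.le] at this
  have hsub : ∀ {t}, t ∈ Ioo a b → Ioc a t ⊆ Ioo a b := fun ht s hs => ⟨hs.1, hs.2.trans_lt ht.2⟩
  have hgi : IntegrableOn g (Ioo a b) :=
    (intervalIntegrable_iff_integrableOn_Ioo_of_le hab.le).1 hg
  have hgv : IntegrableOn (fun s => g s * v s) (Ioo a b) := hgi.mul_bdd hv hvD
  have key : ∀ j : ℕ, ∀ᵐ t ∂(volume.restrict (Ioo a b)),
      v t ≤ c * (∑ i ∈ Finset.range j, (∫ s in a..t, g s) ^ i / i.factorial)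
        + D * ((∫ s in a..t, g s) ^ j / j.factorial) := by
    intro j
    induction j with
    | zero =>
      filter_upwards [hvD] with t ht
      simpa using (le_abs_self _).trans ht
    | succ j ih =>
      filter_upwards [h, ae_restrict_mem measurableSet_Ioo] with t ht htm
      have hgt : IntervalIntegrable g volume a t := by
        refine hg.mono_set ?_
        rw [uIcc_of_le htm.1.le, uIcc_of_le hab.le]
        exact Icc_subset_Icc_right htm.2.le
      have hGt : ContinuousOn (fun s => ∫ r in a..s, g r) (uIcc a t) := by
        rw [uIcc_of_le htm.1.le]
        exact hG.mono (Icc_subset_Icc_right htm.2.le)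
      have hpi : ∀ i : ℕ, IntervalIntegrable (fun s => g s * (∫ r in a..s, g r) ^ i) volume a t :=
        fun i => hgt.mul_continuousOn (hGt.pow i)
      have hint : ∀ (i : ℕ) (e : ℝ), ∫ s in a..t, e * (g s * (∫ r in a..s, g r) ^ i) / i.factorial
          = e * ((∫ r in a..t, g r) ^ (i + 1) / (i + 1).factorial) := by
        intro i e
        rw [intervalIntegral.integral_div, intervalIntegral.integral_const_mul,
          integral_mul_pow_primitive hg hab.le i t ⟨htm.1.le, htm.2.le⟩, Nat.factorial_succ]
        push_cast
        have : (i.factorial : ℝ) ≠ 0 := by exact_mod_cast i.factorial_ne_zero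
        field_simp
      have hsumi : IntervalIntegrable (fun s => ∑ i ∈ Finset.range j,
          c * (g s * (∫ r in a..s, g r) ^ i) / i.factorial) volume a t := by
        have := IntervalIntegrable.sum (Finset.range j) (f := fun (i : ℕ) s =>
          c * (g s * (∫ r in a..s, g r) ^ i) / i.factorial)
          fun i _ => ((hpi i).const_mul c).div_const _
        simpa only [Finset.sum_fn] using this
      have hmono : ∫ s in a..t, g s * v s ≤ ∫ s in a..t,
          ((∑ i ∈ Finset.range j, c * (g s * (∫ r in a..s, g r) ^ i) / i.factorial)
            + D * (g s * (∫ r in a..s, g r) ^ j) / j.factorial) := by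
        refine intervalIntegral.integral_mono_ae_restrict htm.1.le
          ((intervalIntegrable_iff_integrableOn_Ioc_of_le htm.1.le).2 (hgv.mono_set (hsub htm)))
          ?_ ?_
        · exact hsumi.add (((hpi j).const_mul D).div_const _)
        · rw [← restrict_Ioc_eq_restrict_Icc]
          filter_upwards [ae_restrict_of_ae_restrict_of_subset (hsub htm) ih] with s hs
          refine (mul_le_mul_of_nonneg_left hs (hg0 s)).trans_eq ?_
          rw [mul_add, Finset.mul_sum, Finset.mul_sum]
          congr 1
          · exact Finset.sum_congr rfl fun i _ => by ring
          · ring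
      refine ht.trans ((add_le_add_right hmono c).trans_eq ?_)
      rw [intervalIntegral.integral_add hsumi
        (((hpi j).const_mul D).div_const _), intervalIntegral.integral_finsetSum
        fun i _ => ((hpi i).const_mul c).div_const _, hint, Finset.sum_congr rfl fun i _ => hint i c,
        Finset.sum_range_succ', ← Finset.mul_sum]
      simp
      ring
  filter_upwards [ae_all_iff.2 key, ae_restrict_mem measurableSet_Ioo] with t ht htm
  have hG0 : 0 ≤ ∫ s in a..t, g s :=
    intervalIntegral.integral_nonneg htm.1.le fun s _ => hg0 s
  have hlim : Tendsto (fun j : ℕ => c * Real.exp (∫ s in a..t, g s)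
      + D * ((∫ s in a..t, g s) ^ j / j.factorial)) atTop
      (𝓝 (c * Real.exp (∫ s in a..t, g s) + D * 0)) :=
    tendsto_const_nhds.add ((FloorSemiring.tendsto_pow_div_factorial_atTop _).const_mul D)
  rw [mul_zero, add_zero] at hlim
  refine ge_of_tendsto' hlim fun j => (ht j).trans ?_
  have := Real.sum_le_exp_of_nonneg hG0 j
  gcongr

lemma tendsto_mul_exp_log {x B : ℝ} (hx : x ≤ 1 / 2) :
    Tendsto (fun m : ℕ => B * Real.exp (-(m : ℝ)) * Real.exp (x * (1 + m))) atTop (𝓝 0) := by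
  have h1 : Tendsto (fun m : ℕ => Real.exp (-(m : ℝ) / 2)) atTop (𝓝 0) := by
    refine Real.tendsto_exp_atBot.comp ?_
    have : Tendsto (fun m : ℕ => (m : ℝ) / 2) atTop atTop :=
      tendsto_natCast_atTop_atTop.atTop_div_const (by norm_num)
    refine (tendsto_neg_atTop_atBot.comp this).congr fun m => ?_
    simp [neg_div]
  refine squeeze_zero_norm (a := fun m : ℕ => |B| * Real.exp 1 * Real.exp (-(m : ℝ) / 2))
    (fun m => ?_) (by simpa using h1.const_mul (|B| * Real.exp 1))
  rw [norm_mul, norm_mul, Real.norm_eq_abs B, Real.norm_of_nonneg (Real.exp_pos _).le,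
    Real.norm_of_nonneg (Real.exp_pos _).le, mul_assoc, mul_assoc, ← Real.exp_add, ← Real.exp_add]
  refine mul_le_mul_of_nonneg_left (Real.exp_le_exp.2 ?_) (abs_nonneg B)
  have : (0 : ℝ) ≤ m := m.cast_nonneg
  nlinarith

/-- Gronwall for `y + e^{-m}` gives `y ≤ (1 + C a₀) e^{-m} exp(C (∫ A)(1 + m))`. As `C ∫ A ≤ 1/2` on
this interval, the right side tends to zero with `m`. -/
lemma ae_eq_zero_step {y A : ℝ → ℝ} {T t₀ t₁ C D : ℝ} (ht₀ : 0 ≤ t₀) (ht : t₀ < t₁) (htT : t₁ ≤ T)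
    (hC : 0 ≤ C) (hA0 : ∀ s, 0 ≤ A s) (hA : IntegrableOn A (Ioo 0 T))
    (hy : AEStronglyMeasurable y (volume.restrict (Ioo 0 T)))
    (hy0 : ∀ s, 0 ≤ y s) (hyD : ∀ᵐ t ∂(volume.restrict (Ioo 0 T)), y t ≤ D)
    (h : ∀ m : ℕ, ∀ᵐ t ∂(volume.restrict (Ioo 0 T)), y t ≤
      ∫ s in (0)..t, C * A s * ((1 + m) * y s + Real.exp (-m)))
    (hz : ∀ᵐ t ∂(volume.restrict (Ioo 0 t₀)), y t = 0)
    (hsmall : C * ∫ s in t₀..t₁, A s ≤ 1 / 2) :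
    ∀ᵐ t ∂(volume.restrict (Ioo t₀ t₁)), y t = 0 := by
  have hsub1 : Ioo t₀ t₁ ⊆ Ioo 0 T := Ioo_subset_Ioo ht₀ htT
  have hAI : ∀ {x z}, 0 ≤ x → x ≤ z → z ≤ T → IntervalIntegrable A volume x z :=
    fun hx hxz hz => (intervalIntegrable_iff_integrableOn_Ioo_of_le hxz).2
      (hA.mono_set (Ioo_subset_Ioo hx hz))
  have hyn : ∀ᵐ t ∂(volume.restrict (Ioo 0 T)), ‖y t‖ ≤ D := by
    filter_upwards [hyD] with t h1
    rwa [Real.norm_of_nonneg (hy0 t)]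
  have hAy : IntegrableOn (fun s => A s * y s) (Ioo 0 T) := hA.mul_bdd hy hyn
  have hAyI : ∀ {x z}, 0 ≤ x → x ≤ z → z ≤ T →
      IntervalIntegrable (fun s => A s * y s) volume x z :=
    fun hx hxz hz => (intervalIntegrable_iff_integrableOn_Ioo_of_le hxz).2
      (hAy.mono_set (Ioo_subset_Ioo hx hz))
  set a₀ := ∫ s in (0)..t₀, A s with ha₀
  have ha₀0 : 0 ≤ a₀ := intervalIntegral.integral_nonneg ht₀ fun s _ => hA0 s
  have key : ∀ m : ℕ, ∀ᵐ t ∂(volume.restrict (Ioo t₀ t₁)), y t ≤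
      ((1 + C * a₀) * Real.exp (-m)) * Real.exp (C * (∫ s in t₀..t, A s) * (1 + m)) := by
    intro m
    have hm0 : (0 : ℝ) ≤ m := m.cast_nonneg
    have hm : (1 : ℝ) ≤ 1 + m := by linarith
    set β := Real.exp (-(m : ℝ)) with hβ
    have hβ0 : 0 < β := Real.exp_pos _
    have hg : IntervalIntegrable (fun s => C * (1 + m) * A s) volume t₀ t₁ :=
      (hAI ht₀ ht.le htT).const_mul _
    -- The constant collects the added `β` and the contribution `C a₀ β` of the earlier interval,
    -- where `y` vanishes. The source term is absorbed into `y + β` because `1 + m ≥ 1`.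
    have hG := gronwall_of_ae_le (g := fun s => C * (1 + m) * A s) (v := fun s => y s + β)
      (c := (1 + C * a₀) * β) (D := D + β) ht hg (fun s => by have := hA0 s; positivity)
      ((hy.mono_measure (Measure.restrict_mono hsub1 le_rfl)).add aestronglyMeasurable_const)
      (by positivity) ?_ ?_
    · filter_upwards [hG] with t ht'
      rw [intervalIntegral.integral_const_mul] at ht'
      calc y t ≤ y t + β := by linarith
        _ ≤ _ := ht'
        _ = _ := by ring_nf
    · filter_upwards [ae_restrict_of_ae_restrict_of_subset hsub1 hyn] with t h1
      exact (norm_add_le _ _).trans (add_le_add h1 (Real.norm_of_nonneg hβ0.le).le)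
    · filter_upwards [ae_restrict_of_ae_restrict_of_subset hsub1 (h m),
        ae_restrict_mem measurableSet_Ioo] with t h1 htm
      have hle : t ≤ T := htm.2.le.trans htT
      have i0 : ∀ {x z}, 0 ≤ x → x ≤ z → z ≤ T → IntervalIntegrable
          (fun s => C * A s * ((1 + m) * y s + β)) volume x z := fun hx hxz hz => by
        have := ((hAyI hx hxz hz).const_mul (C * (1 + m))).add ((hAI hx hxz hz).const_mul (C * β))
        refine this.congr fun s _ => ?_
        ring
      rw [← intervalIntegral.integral_add_adjacent_intervals (i0 le_rfl ht₀ (ht.le.trans htT))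
        (i0 ht₀ htm.1.le hle)] at h1
      have e1 : ∫ s in (0)..t₀, C * A s * ((1 + m) * y s + β) = C * β * a₀ := by
        rw [ha₀, ← intervalIntegral.integral_const_mul, intervalIntegral.integral_of_le ht₀,
          intervalIntegral.integral_of_le ht₀, integral_Ioc_eq_integral_Ioo,
          integral_Ioc_eq_integral_Ioo]
        refine integral_congr_ae ?_
        filter_upwards [hz] with s hs
        rw [hs]
        ring
      have e2 : ∫ s in t₀..t, C * A s * ((1 + m) * y s + β)
          ≤ ∫ s in t₀..t, C * (1 + m) * A s * (y s + β) := by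
        refine intervalIntegral.integral_mono_on htm.1.le (i0 ht₀ htm.1.le hle) ?_ fun s _ => ?_
        · have := ((hAyI ht₀ htm.1.le hle).const_mul (C * (1 + m))).add
            ((hAI ht₀ htm.1.le hle).const_mul (C * (1 + m) * β))
          refine this.congr fun s _ => ?_
          ring
        · have h0 : 0 ≤ C * A s := mul_nonneg hC (hA0 s)
          have : C * A s * β ≤ C * A s * β * (1 + m) :=
            le_mul_of_one_le_right (by positivity) hm
          linarith
      rw [e1] at h1
      linarith
  filter_upwards [ae_all_iff.2 key, ae_restrict_mem measurableSet_Ioo] with t h1 htm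
  have hx : C * ∫ s in t₀..t, A s ≤ 1 / 2 := by
    refine le_trans (mul_le_mul_of_nonneg_left ?_ hC) hsmall
    exact intervalIntegral.integral_mono_interval le_rfl htm.1.le htm.2.le
      (ae_of_all _ fun s => hA0 s) (hAI ht₀ ht.le htT)
  exact le_antisymm (ge_of_tendsto' (tendsto_mul_exp_log hx) h1) (hy0 t)

/-- An Osgood type criterion: the logarithmic loss in the coefficient is beaten by the
exponentially small remainder. -/
theorem ae_eq_zero_of_log_gronwall {y A : ℝ → ℝ} {T C D : ℝ} (hT : 0 < T)
    (hC : 0 ≤ C) (hA0 : ∀ s, 0 ≤ A s) (hA : IntegrableOn A (Ioo 0 T))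
    (hy : AEStronglyMeasurable y (volume.restrict (Ioo 0 T)))
    (hy0 : ∀ s, 0 ≤ y s) (hyD : ∀ᵐ t ∂(volume.restrict (Ioo 0 T)), y t ≤ D)
    (h : ∀ m : ℕ, ∀ᵐ t ∂(volume.restrict (Ioo 0 T)), y t ≤
      ∫ s in (0)..t, C * A s * ((1 + m) * y s + Real.exp (-m))) :
    ∀ᵐ t ∂(volume.restrict (Ioo 0 T)), y t = 0 := by
  have hAI : IntervalIntegrable A volume 0 T :=
    (intervalIntegrable_iff_integrableOn_Ioo_of_le hT.le).2 hA
  have hcont := (hAI.const_mul C).absolutelyContinuousOnInterval_intervalIntegral left_mem_uIcc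
    |>.uniformContinuousOn
  rw [uIcc_of_le hT.le, Metric.uniformContinuousOn_iff] at hcont
  -- Uniform continuity of the primitive of `C A` yields one length that works everywhere on
  -- `[0,T]`; steps of `δ / 2` stay strictly below it.
  obtain ⟨δ, hδ, hδs⟩ := hcont (1 / 2) (by norm_num)
  have hstep : ∀ j : ℕ, ∀ᵐ t ∂(volume.restrict (Ioo 0 (min (j * (δ / 2)) T))), y t = 0 := by
    intro j
    induction j with
    | zero => simp [hT.le]
    | succ j ih =>
      set t₀ := min (j * (δ / 2)) T with ht₀
      set t₁ := min ((j + 1 : ℕ) * (δ / 2)) T with ht₁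
      have h0 : 0 ≤ t₀ := le_min (by positivity) hT.le
      have h0T : t₀ ≤ T := min_le_right _ _
      have h1T : t₁ ≤ T := min_le_right _ _
      have h01 : t₀ ≤ t₁ := by
        refine min_le_min_right _ ?_
        push_cast
        nlinarith
      have hd : t₁ ≤ t₀ + δ / 2 := by
        rw [ht₀, ht₁, min_add]
        refine min_le_min (by push_cast; linarith) (by linarith)
      rcases h01.eq_or_lt with he | hlt
      · rwa [← he]
      have hs : C * ∫ s in t₀..t₁, A s ≤ 1 / 2 := by
        have hi : ∀ {x}, 0 ≤ x → x ≤ T → IntervalIntegrable (fun s => C * A s) volume 0 x :=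
          fun hx hxT => (hAI.const_mul C).mono_set (by
            rw [uIcc_of_le hx, uIcc_of_le hT.le]; exact Icc_subset_Icc_right hxT)
        have h2 := hδs t₁ ⟨h0.trans h01, h1T⟩ t₀ ⟨h0, h0T⟩ (by
          rw [Real.dist_eq, abs_of_nonneg (by linarith)]; linarith)
        rw [Real.dist_eq, intervalIntegral.integral_interval_sub_left (hi (h0.trans h01) h1T)
          (hi h0 h0T), intervalIntegral.integral_const_mul] at h2
        exact (le_abs_self _).trans h2.le
      have h2 := ae_eq_zero_step h0 hlt h1T hC hA0 hA hy hy0 hyD h ih hs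
      have hun : Ioo 0 t₁ ⊆ Ioo 0 t₀ ∪ Ioo t₀ t₁ ∪ {t₀} := by
        intro s hs
        rcases lt_trichotomy s t₀ with h3 | h3 | h3
        · exact Or.inl (Or.inl ⟨hs.1, h3⟩)
        · exact Or.inr h3
        · exact Or.inl (Or.inr ⟨h3, hs.2⟩)
      refine ae_restrict_of_ae_restrict_of_subset hun ?_
      rw [ae_restrict_union_iff, ae_restrict_union_iff]
      exact ⟨⟨ih, h2⟩, by simp⟩
  obtain ⟨j, hj⟩ := exists_nat_gt (T / (δ / 2))
  have := hstep j
  rwa [min_eq_right] at this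
  rw [div_lt_iff₀ (by positivity)] at hj
  exact hj.le

end

section

variable {n : ℕ}

/-! ### A measurable majorant of the mean oscillations -/

section Oscillation

variable {F : Type*} [NormedAddCommGroup F] [NormedSpace ℝ F]

lemma meanOscillation_le_two_mul [CompleteSpace F] {f : Space n → F} {Q : Set (Space n)}
    (hf : IntegrableOn f Q) (hQ : volume Q ≠ 0) (hQ' : volume Q ≠ ∞) (a : F) :
    meanOscillation f Q ≤ 2 * ((volume Q)⁻¹ * ∫⁻ y in Q, ‖f y - a‖ₑ) := by
  have h1 : ‖a - ⨍ z in Q, f z‖ₑ ≤ (volume Q)⁻¹ * ∫⁻ y in Q, ‖f y - a‖ₑ := by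
    rw [← enorm_neg, neg_sub]
    exact enorm_setAverage_sub_le hQ hQ' hf a
  have h2 : ∫⁻ y in Q, ‖f y - ⨍ z in Q, f z‖ₑ
      ≤ (∫⁻ y in Q, ‖f y - a‖ₑ) + ‖a - ⨍ z in Q, f z‖ₑ * volume Q := by
    rw [← setLIntegral_const, ← lintegral_add_right _ measurable_const]
    refine lintegral_mono fun y => ?_
    rw [← sub_add_sub_cancel (f y) a]
    exact enorm_add_le _ _
  calc meanOscillation f Q ≤ (volume Q)⁻¹ * ((∫⁻ y in Q, ‖f y - a‖ₑ)
        + ‖a - ⨍ z in Q, f z‖ₑ * volume Q) := mul_le_mul_right h2 _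
    _ = (volume Q)⁻¹ * (∫⁻ y in Q, ‖f y - a‖ₑ)
        + ‖a - ⨍ z in Q, f z‖ₑ * ((volume Q)⁻¹ * volume Q) := by ring
    _ ≤ (volume Q)⁻¹ * (∫⁻ y in Q, ‖f y - a‖ₑ)
        + ((volume Q)⁻¹ * ∫⁻ y in Q, ‖f y - a‖ₑ) * 1 := by
        rw [ENNReal.inv_mul_cancel hQ hQ']
        gcongr
    _ = _ := by ring

lemma meanOscillation_le_of_subset [CompleteSpace F] {f : Space n → F} {Q Q' : Set (Space n)}
    (hf : IntegrableOn f Q') (hQ : volume Q ≠ 0) (hQ' : volume Q' ≠ ∞) (hsub : Q ⊆ Q') {K : ℝ≥0∞}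
    (hK : K ≠ ∞) (hvol : volume Q' ≤ K * volume Q) :
    meanOscillation f Q ≤ 2 * K * meanOscillation f Q' := by
  have hQt : volume Q ≠ ∞ := ne_top_of_le_ne_top hQ' (measure_mono hsub)
  refine (meanOscillation_le_two_mul (hf.mono_set hsub) hQ hQt (⨍ z in Q', f z)).trans ?_
  rw [mul_assoc, meanOscillation, ← mul_assoc K]
  refine mul_le_mul_right (mul_le_mul' ?_ (lintegral_mono_set hsub)) _
  have hQ'0 : volume Q' ≠ 0 := fun h => hQ (measure_mono_null hsub h)
  have hK0 : K ≠ 0 := by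
    rintro rfl
    exact hQ'0 (le_zero_iff.1 (by simpa using hvol))
  calc (volume Q)⁻¹ = K * (K⁻¹ * (volume Q)⁻¹) := by
        rw [← mul_assoc, ENNReal.mul_inv_cancel hK0 hK, one_mul]
    _ = K * (K * volume Q)⁻¹ := by rw [ENNReal.mul_inv (Or.inl hK0) (Or.inl hK)]
    _ ≤ K * (volume Q')⁻¹ := mul_le_mul_right (ENNReal.inv_le_inv.2 hvol) _

/-- The supremum of the mean oscillations over a countable, dense family of cubes. -/
def countableOscillation (f : Space n → F) : ℝ≥0∞ :=
  ⨆ (j : ℕ) (q : ℚ) (_ : 0 < q),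
    meanOscillation f (cube (TopologicalSpace.denseSeq (Space n) j) (q : ℝ))

/-- A supremum over countably many cubes depends measurably on time. Any cube of half-side `r` lies
in one of the family with centre within `r / 2` and half-side between `3r / 2` and `2r`, hence with
volume at most `2 ^ n` times larger; changing the subtracted constant costs the remaining factor
`2`. -/
lemma oscLe_countableOscillation [CompleteSpace F] {f : Space n → F}
    (hf : LocallyIntegrable f volume) :
    OscLe f (2 * 2 ^ n * countableOscillation f) := by
  intro c r hr
  obtain ⟨q, hq1, hq2⟩ := exists_rat_btwn (show 3 * r / 2 < 2 * r by linarith)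
  have hq0 : (0 : ℝ) < q := by linarith
  obtain ⟨j, hj⟩ := (TopologicalSpace.denseRange_denseSeq (Space n)).exists_mem_open
    Metric.isOpen_ball ⟨c, Metric.mem_ball_self (show (0 : ℝ) < r / 2 by positivity)⟩
  rw [Metric.mem_ball, dist_eq_norm] at hj
  generalize hd : TopologicalSpace.denseSeq (Space n) j = d at hj
  have hsub : cube c r ⊆ cube d q := by
    intro x hx i
    have h1 := hx i
    have h2 := PiLp.norm_apply_le (d - c) i
    rw [PiLp.sub_apply, Real.norm_eq_abs] at h2
    have h3 := abs_sub_le (x i) (c i) (d i)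
    rw [abs_sub_comm (c i)] at h3
    linarith
  have hvol : volume (cube d q) ≤ 2 ^ n * volume (cube c r) := by
    rw [volume_cube, volume_cube, ← mul_pow, show (2 : ℝ≥0∞) = ENNReal.ofReal 2 by simp,
      ← ENNReal.ofReal_mul (by norm_num)]
    gcongr
  refine (meanOscillation_le_of_subset
    (LocallyIntegrable.integrableOn_of_isBounded hf (isBounded_cube d q))
    (volume_cube_ne_zero c hr) (volume_cube_ne_top d q) hsub (by finiteness) hvol).trans ?_
  gcongr
  rw [← hd]
  exact le_iSup_of_le j (le_iSup₂_of_le q (by exact_mod_cast hq0) le_rfl)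

/-- The norm is an essential supremum, but a cube has positive measure and so contains a point
outside the exceptional set. -/
lemma meanOscillation_le_bmoNorm (f : Space n → F) (c : Space n) {r : ℝ} (hr : 0 < r) :
    meanOscillation f (cube c r) ≤ bmoNorm f := by
  have h : ∀ᵐ x, sharpMaximal f x ≤ bmoNorm f := by
    rw [bmoNorm, eLpNorm_exponent_top, eLpNormEssSup_eq_essSup_enorm]
    exact ENNReal.ae_le_essSup _
  obtain ⟨x, hx, hxQ⟩ : ∃ x, sharpMaximal f x ≤ bmoNorm f ∧ x ∈ cube c r := by
    by_contra! hne
    refine volume_cube_ne_zero c hr (measure_mono_null (fun x hx => ?_) (ae_iff.1 h))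
    exact fun hle => hne x hle hx
  refine le_trans ?_ hx
  exact le_iSup_of_le c (le_iSup_of_le r (le_iSup_of_le hr (le_iSup_of_le hxQ le_rfl)))

lemma countableOscillation_le_bmoNorm (f : Space n → F) : countableOscillation f ≤ bmoNorm f :=
  iSup_le fun _ => iSup₂_le fun q hq => meanOscillation_le_bmoNorm f _ (by exact_mod_cast hq)

lemma countableOscillation_le_eLpNorm_top [CompleteSpace F] {f : Space n → F}
    (hf : LocallyIntegrable f volume) :
    countableOscillation f ≤ 2 * eLpNorm f ∞ volume := by
  refine iSup_le fun j => iSup₂_le fun q hq => ?_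
  have hq0 : (0 : ℝ) < q := by exact_mod_cast hq
  generalize TopologicalSpace.denseSeq (Space n) j = c
  have hQ := volume_cube_ne_zero c hq0
  have hQ' := volume_cube_ne_top c q
  refine (meanOscillation_le_two_mul
    (LocallyIntegrable.integrableOn_of_isBounded hf (isBounded_cube c q)) hQ hQ' 0).trans ?_
  refine mul_le_mul_right ?_ _
  have h : ∫⁻ y in cube c q, ‖f y - 0‖ₑ ≤ eLpNorm f ∞ volume * volume (cube c q) := by
    rw [← setLIntegral_const]
    refine lintegral_mono_ae (ae_restrict_of_ae ?_)
    rw [eLpNorm_exponent_top, eLpNormEssSup_eq_essSup_enorm]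
    filter_upwards [ENNReal.ae_le_essSup (μ := volume) fun x => ‖f x‖ₑ] with x hx
    rwa [sub_zero]
  calc _ ≤ (volume (cube c q))⁻¹ * (eLpNorm f ∞ volume * volume (cube c q)) :=
        mul_le_mul_right h _
    _ = _ := by rw [mul_left_comm, ENNReal.inv_mul_cancel hQ hQ', mul_one]

lemma countableOscillation_congr_ae {f g : Space n → F} (h : f =ᵐ[volume] g) :
    countableOscillation f = countableOscillation g := by
  have : ∀ Q, meanOscillation f Q = meanOscillation g Q := fun Q => by
    have h1 : ⨍ z in Q, f z = ⨍ z in Q, g z := by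
      rw [setAverage_eq, setAverage_eq, integral_congr_ae (ae_restrict_of_ae h)]
    rw [meanOscillation, meanOscillation, h1]
    congr 1
    refine lintegral_congr_ae (ae_restrict_of_ae ?_)
    filter_upwards [h] with x hx
    rw [hx]
  simp_rw [countableOscillation, this]

lemma measurable_countableOscillation {f : ℝ × Space n → F} (hf : StronglyMeasurable f) :
    Measurable fun t => countableOscillation fun x => f (t, x) := by
  refine Measurable.iSup fun j => Measurable.iSup fun q => Measurable.iSup fun _ => ?_
  generalize cube (TopologicalSpace.denseSeq (Space n) j) (q : ℝ) = Q
  have h1 : StronglyMeasurable fun t => ⨍ z in Q, f (t, z) := by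
    simp_rw [setAverage_eq]
    exact (hf.integral_prod_right' (ν := volume.restrict Q)).const_smul _
  have h2 : StronglyMeasurable fun p : ℝ × Space n => f p - ⨍ z in Q, f (p.1, z) :=
    hf.sub (h1.comp_measurable measurable_fst)
  exact (Measurable.lintegral_prod_right' (ν := volume.restrict Q) h2.enorm).const_mul _

lemma OscLe.add [CompleteSpace F] {f g : Space n → F} {A B : ℝ≥0∞} (hf : OscLe f A) (hg : OscLe g B)
    (hfl : LocallyIntegrable f volume) (hgl : LocallyIntegrable g volume) :
    OscLe (fun x => f x + g x) (A + B) := by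
  intro c r hr
  have hg' := hg.const_smul (-1)
  have h := meanOscillation_sub_le (f := f) (g := fun x => (-1 : ℝ) • g x) (Q := cube c r)
    (LocallyIntegrable.integrableOn_of_isBounded hfl (isBounded_cube c r))
    ((LocallyIntegrable.integrableOn_of_isBounded hgl (isBounded_cube c r)).smul (-1 : ℝ))
  simp only [neg_smul, one_smul, sub_neg_eq_add, enorm_neg, enorm_one, one_mul] at h hg'
  exact h.trans (add_le_add (hf c r hr) (hg' c r hr))

end Oscillation

/-! ### The uniqueness class in terms of mean oscillations -/

lemma lintegral_enorm_sq_eq {α : Type*} [MeasurableSpace α] {μ : Measure α} 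
    {F : Type*} [NormedAddCommGroup F] (f : α → F) :
    ∫⁻ x, ‖f x‖ₑ ^ 2 ∂μ = eLpNorm f 2 μ ^ 2 := by
  have h := eLpNorm_nnreal_pow_eq_lintegral (f := f) (μ := μ) (p := 2) (by norm_num)
  simpa using h.symm

lemma MemMixedLp.exists_eLpNorm_two_le {F : Type*} [NormedAddCommGroup F] {T : ℝ}
    {f : ℝ → Space n → F} (hf : MemMixedLp T ∞ 2 f) :
    ∃ M : ℝ≥0∞, M ≠ ∞ ∧ ∀ᵐ t ∂(volume.restrict (Ioo 0 T)), eLpNorm (f t) 2 volume ≤ M := by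
  refine ⟨_, hf.2.ne, ?_⟩
  rw [eLpNorm_exponent_top, eLpNormEssSup_eq_essSup_enorm]
  exact ENNReal.ae_le_essSup _

/-- Both parts of the gradient have oscillations bounded integrably in time: those of `g` by twice
its `L^∞` norm, those of `b` by its `BMO` norm. The countable suprema of measurable representatives
provide a measurable majorant. -/
theorem InUniquenessClass.exists_regularScalar {T : ℝ} {q p : ℝ≥0∞} {θ : ℝ → Space n → ℝ}
    (h : InUniquenessClass T q p θ) :
    ∃ (H : ℝ → Space n → Space n) (A : ℝ → ℝ) (M : ℝ), 0 ≤ M ∧ (∀ t, 0 < A t) ∧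
      IntegrableOn A (Ioo 0 T) ∧
      ∀ᵐ t ∂(volume.restrict (Ioo 0 T)),
        RegularScalar (θ t) (H t) (A t) (ENNReal.ofReal M) := by
  obtain ⟨h2, -, g, b, hg, hb, -, hgrad⟩ := h
  obtain ⟨M, hM, hMt⟩ := h2.exists_eLpNorm_two_le
  have hgm := hg.1.stronglyMeasurable_mk
  have hbm := hb.1.stronglyMeasurable_mk
  have hgae : ∀ᵐ t ∂(volume.restrict (Ioo 0 T)), g t =ᵐ[volume]
      fun x => hg.1.mk (Function.uncurry g) (t, x) := Measure.ae_ae_of_ae_prod hg.1.ae_eq_mk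
  have hbae : ∀ᵐ t ∂(volume.restrict (Ioo 0 T)), b t =ᵐ[volume]
      fun x => hb.1.mk (Function.uncurry b) (t, x) := Measure.ae_ae_of_ae_prod hb.1.ae_eq_mk
  generalize hg.1.mk (Function.uncurry g) = g' at hgm hgae
  generalize hb.1.mk (Function.uncurry b) = b' at hbm hbae
  let Sg : ℝ → ℝ≥0∞ := fun t => countableOscillation fun x => g' (t, x)
  let Sb : ℝ → ℝ≥0∞ := fun t => countableOscillation fun x => b' (t, x)
  have hSgm : Measurable Sg := measurable_countableOscillation hgm
  have hSbm : Measurable Sb := measurable_countableOscillation hbm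
  -- Slices of `g` are locally integrable because `g + b` is a weak gradient and `b` is in `BMO`.
  have hgl : ∀ᵐ t ∂(volume.restrict (Ioo 0 T)), LocallyIntegrable (g t) volume := by
    filter_upwards [hgrad, hb.2.1] with t h1 h3
    refine (h1.2.1.sub h3.1).congr (ae_of_all _ fun x => ?_)
    simp
  have hSgle : ∀ᵐ t ∂(volume.restrict (Ioo 0 T)), Sg t ≤ 2 * eLpNorm (g t) ∞ volume := by
    filter_upwards [hgl, hgae] with t h1 h3
    rw [show Sg t = countableOscillation (g t) from (countableOscillation_congr_ae h3).symm]
    exact countableOscillation_le_eLpNorm_top h1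
  have hSble : ∀ᵐ t ∂(volume.restrict (Ioo 0 T)), Sb t ≤ bmoNorm (b t) := by
    filter_upwards [hbae] with t h3
    rw [show Sb t = countableOscillation (b t) from (countableOscillation_congr_ae h3).symm]
    exact countableOscillation_le_bmoNorm _
  have hgi : ∫⁻ t in Ioo 0 T, Sg t ≠ ∞ := by
    have h1 := hg.2
    rw [eLpNorm_one_eq_lintegral_enorm] at h1
    refine ((lintegral_mono_ae hSgle).trans_lt ?_).ne
    rw [lintegral_const_mul' _ _ (by norm_num)]
    exact ENNReal.mul_lt_top (by norm_num) h1
  have hbi : ∫⁻ t in Ioo 0 T, Sb t ≠ ∞ := by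
    have h1 := hb.2.2
    rw [eLpNorm_one_eq_lintegral_enorm] at h1
    exact ((lintegral_mono_ae hSble).trans_lt h1).ne
  let S : ℝ → ℝ≥0∞ := fun t => 2 * 2 ^ n * (Sg t + Sb t)
  have hSm : Measurable S := (hSgm.add hSbm).const_mul _
  have hSi : ∫⁻ t in Ioo 0 T, S t ≠ ∞ := by
    rw [lintegral_const_mul' _ _ (by finiteness), lintegral_add_left hSgm]
    finiteness
  -- Adding `1` makes the bound strictly positive, as the rescaling by `A⁻¹` requires.
  refine ⟨fun t x => g t x + b t x, fun t => 1 + (S t).toReal, (M ^ 2).toReal,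
    ENNReal.toReal_nonneg, fun t => by positivity, ?_, ?_⟩
  · exact (integrableOn_const (by simp)).add (integrable_toReal_of_lintegral_ne_top hSm.aemeasurable hSi)
  · filter_upwards [hgrad, hb.2.1, hgl, hMt, ae_lt_top hSm hSi, hgae, hbae] with t h1 h3 h4 h5 h6 h7 h8
    refine ⟨h1, ?_, ?_⟩
    · have hosc : OscLe (fun x => g t x + b t x) (S t) := by
        have e : S t = 2 * 2 ^ n * Sg t + 2 * 2 ^ n * Sb t := mul_add _ _ _
        rw [e]
        refine OscLe.add ?_ ?_ h4 h3.1
        · rw [show Sg t = countableOscillation (g t) from (countableOscillation_congr_ae h7).symm]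
          exact oscLe_countableOscillation h4
        · rw [show Sb t = countableOscillation (b t) from (countableOscillation_congr_ae h8).symm]
          exact oscLe_countableOscillation h3.1
      intro c r hr
      refine (hosc c r hr).trans ?_
      rw [ENNReal.ofReal_add (by norm_num) ENNReal.toReal_nonneg, ENNReal.ofReal_toReal h6.ne]
      exact le_add_self
    · rw [lintegral_enorm_sq_eq, ENNReal.ofReal_toReal (by finiteness)]
      exact pow_le_pow_left' h5 2

end

section

variable {n : ℕ}

/-! ### Fourier multipliers of order zero are bounded on `L²` -/

lemma lintegral_enorm_fourier_sq (f : Lp ℂ 2 (volume : Measure (Space n))) :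
    ∫⁻ ξ, ‖(𝓕 f : Lp ℂ 2 (volume : Measure (Space n))) ξ‖ₑ ^ 2 = ∫⁻ x, ‖f x‖ₑ ^ 2 := by
  rw [lintegral_enorm_sq_eq, lintegral_enorm_sq_eq, ← Lp.enorm_def, ← Lp.enorm_def,
    ← ofReal_norm, ← ofReal_norm, Lp.norm_fourier_eq]

lemma lintegral_enorm_toLp_sq {α E : Type*} [MeasurableSpace α] {μ : Measure α}
    [NormedAddCommGroup E] {f : α → E} (hf : MemLp f 2 μ) :
    ∫⁻ x, ‖hf.toLp f x‖ₑ ^ 2 ∂μ = ∫⁻ x, ‖f x‖ₑ ^ 2 ∂μ := by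
  refine lintegral_congr_ae ?_
  filter_upwards [hf.coeFn_toLp] with x hx
  rw [hx]

lemma enorm_sq_eq_sum (x : Space n) : ‖x‖ₑ ^ 2 = ∑ i, ‖x i‖ₑ ^ 2 := by
  rw [← ofReal_norm, ← ENNReal.ofReal_pow (norm_nonneg _), EuclideanSpace.norm_sq_eq,
    ENNReal.ofReal_sum_of_nonneg fun i _ => by positivity]
  refine Finset.sum_congr rfl fun i _ => ?_
  rw [ENNReal.ofReal_pow (norm_nonneg _), ofReal_norm]

variable {m : Space n → EuclideanSpace ℂ (Fin n)}

lemma IsOrderZeroSymbol.exists_bound (hm : IsOrderZeroSymbol m) : ∃ C : ℝ, 0 ≤ C ∧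
    ∀ ξ, ‖m ξ‖ ≤ C := by
  obtain ⟨C, hC⟩ := hm.bound 0
  refine ⟨max C ‖m 0‖, (norm_nonneg _).trans (le_max_right _ _), fun ξ => ?_⟩
  rcases eq_or_ne ξ 0 with rfl | hξ
  · exact le_max_right _ _
  · have h := hC ξ hξ
    rw [pow_zero, mul_one, norm_iteratedFDeriv_zero] at h
    exact h.trans (le_max_left _ _)

lemma IsMultiplierImage.sub {f₁ f₂ : Space n → ℝ} {v₁ v₂ : Space n → Space n}
    (h₁ : IsMultiplierImage m f₁ v₁) (h₂ : IsMultiplierImage m f₂ v₂) :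
    IsMultiplierImage m (fun x => f₁ x - f₂ x) (fun x => v₁ x - v₂ x) := by
  obtain ⟨hf₁, hv₁, he₁⟩ := h₁
  obtain ⟨hf₂, hv₂, he₂⟩ := h₂
  have hsub : ∀ a b : Lp ℂ 2 (volume : Measure (Space n)), 𝓕 (a - b) = 𝓕 a - 𝓕 b :=
    (Lp.fourierTransformₗᵢ (Space n) ℂ).map_sub
  have hf : MemLp (fun x => ((f₁ x - f₂ x : ℝ) : ℂ)) 2 volume := by
    exact (memLp_congr_ae (ae_of_all _ fun x => by simp)).1 (hf₁.sub hf₂)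
  have hv : ∀ i, MemLp (fun x => (((v₁ x - v₂ x) i : ℝ) : ℂ)) 2 volume := fun i => by
    exact (memLp_congr_ae (ae_of_all _ fun x => by simp)).1 ((hv₁ i).sub (hv₂ i))
  have hfe : hf.toLp = hf₁.toLp - hf₂.toLp := by
    rw [← MemLp.toLp_sub]
    exact MemLp.toLp_congr _ _ (ae_of_all _ fun x => by simp)
  refine ⟨hf, hv, fun i => ?_⟩
  have hve : (hv i).toLp = (hv₁ i).toLp - (hv₂ i).toLp := by
    rw [← MemLp.toLp_sub]
    exact MemLp.toLp_congr _ _ (ae_of_all _ fun x => by simp)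
  rw [hfe, hve, hsub, hsub]
  filter_upwards [Lp.coeFn_sub (𝓕 hf₁.toLp) (𝓕 hf₂.toLp), he₁ i, he₂ i,
    Lp.coeFn_sub (𝓕 (hv₁ i).toLp) (𝓕 (hv₂ i).toLp)] with ξ h1 h2 h3 h4
  rw [h1, h4, Pi.sub_apply, Pi.sub_apply, h2, h3, mul_sub]

/-- Plancherel on each component with the pointwise bound `C` of the symbol; summing `n` components
gives `√n C`. -/
theorem IsOrderZeroSymbol.exists_lintegral_sq_le (hm : IsOrderZeroSymbol m) : ∃ c : ℝ, 0 ≤ c ∧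
    ∀ (f : Space n → ℝ) (v : Space n → Space n), IsMultiplierImage m f v →
      ∫⁻ x, ‖v x‖ₑ ^ 2 ≤ ENNReal.ofReal (c ^ 2) * ∫⁻ x, ‖f x‖ₑ ^ 2 := by
  obtain ⟨C, hC, hmC⟩ := hm.exists_bound
  refine ⟨√n * C, by positivity, fun f v ⟨hf, hv, he⟩ => ?_⟩
  have hre : ∀ a : ℝ, ‖(a : ℂ)‖ₑ = ‖a‖ₑ := fun a => by
    rw [← ofReal_norm, ← ofReal_norm, Complex.norm_real]
  have hi : ∀ i, ∫⁻ x, ‖v x i‖ₑ ^ 2 ≤ ENNReal.ofReal (C ^ 2) * ∫⁻ x, ‖f x‖ₑ ^ 2 := by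
    intro i
    calc ∫⁻ x, ‖v x i‖ₑ ^ 2
        = ∫⁻ ξ, ‖(𝓕 (hv i).toLp : Lp ℂ 2 (volume : Measure (Space n))) ξ‖ₑ ^ 2 := by
          rw [lintegral_enorm_fourier_sq, lintegral_enorm_toLp_sq]
          simp_rw [hre]
      _ ≤ ∫⁻ ξ, ENNReal.ofReal (C ^ 2) *
            ‖(𝓕 hf.toLp : Lp ℂ 2 (volume : Measure (Space n))) ξ‖ₑ ^ 2 := by
          refine lintegral_mono_ae ?_
          filter_upwards [he i] with ξ hξ
          rw [hξ, enorm_mul, mul_pow, ENNReal.ofReal_pow hC]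
          gcongr
          rw [← ofReal_norm]
          exact ENNReal.ofReal_le_ofReal ((PiLp.norm_apply_le _ i).trans (hmC ξ))
      _ = _ := by
          rw [lintegral_const_mul' _ _ ENNReal.ofReal_ne_top, lintegral_enorm_fourier_sq,
            lintegral_enorm_toLp_sq]
          simp_rw [hre]
  have hvm : ∀ i, AEMeasurable (fun x => ‖v x i‖ₑ ^ 2) volume := fun i => by
    have := (hv i).1.enorm.pow_const 2
    simpa only [hre] using this
  simp_rw [enorm_sq_eq_sum]
  rw [lintegral_finsetSum' _ fun i _ => hvm i]
  refine (Finset.sum_le_sum fun i _ => hi i).trans_eq ?_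
  rw [Finset.sum_const, Finset.card_univ, Fintype.card_fin, mul_pow, Real.sq_sqrt (by positivity),
    nsmul_eq_mul, ENNReal.ofReal_mul (by positivity), ENNReal.ofReal_natCast, mul_assoc]

end

section

variable {n : ℕ}

/-! ### The equation for the difference of two weak solutions -/

section TestFunctions

variable {φ : ℝ × Space n → ℝ}

lemma deriv_fst_eq (hφ : ContDiff ℝ 1 φ) (z : ℝ × Space n) :
    deriv (fun s => φ (s, z.2)) z.1 = fderiv ℝ φ z (1, 0) := by
  have h := (hφ.differentiable (by simp) z).hasFDerivAt.comp_hasDerivAt z.1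
    ((hasDerivAt_id z.1).prodMk (hasDerivAt_const z.1 z.2))
  exact h.deriv

lemma gradient_snd_eq (hφ : ContDiff ℝ 1 φ) (z : ℝ × Space n) :
    gradient (fun y => φ (z.1, y)) z.2 = (InnerProductSpace.toDual ℝ (Space n)).symm
      ((fderiv ℝ φ z).comp (ContinuousLinearMap.inr ℝ ℝ (Space n))) := by
  have h : HasFDerivAt (fun y => φ (z.1, y))
      ((fderiv ℝ φ z).comp (ContinuousLinearMap.inr ℝ ℝ (Space n))) z.2 :=
    HasFDerivAt.comp (f := fun y => (z.1, y)) z.2 (hφ.differentiable (by simp) z).hasFDerivAt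
      (hasFDerivAt_prodMk_right z.1 z.2)
  rw [gradient, show fderiv ℝ (fun y => φ (z.1, y)) z.2 = _ from h.fderiv]

lemma continuous_deriv_fst (hφ : ContDiff ℝ 1 φ) :
    Continuous fun z : ℝ × Space n => deriv (fun s => φ (s, z.2)) z.1 := by
  simp_rw [deriv_fst_eq hφ]
  exact (hφ.continuous_fderiv (by simp)).clm_apply continuous_const

lemma continuous_gradient_snd (hφ : ContDiff ℝ 1 φ) :
    Continuous fun z : ℝ × Space n => gradient (fun y => φ (z.1, y)) z.2 := by
  simp_rw [gradient_snd_eq hφ]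
  exact (InnerProductSpace.toDual ℝ (Space n)).symm.continuous.comp
    ((hφ.continuous_fderiv (by simp)).clm_comp continuous_const)

lemma fderiv_eq_zero_of_notMem_tsupport {z : ℝ × Space n} (hz : z ∉ tsupport φ) :
    fderiv ℝ φ z = 0 :=
  image_eq_zero_of_notMem_tsupport fun h => hz (tsupport_fderiv_subset ℝ h)

/-- On the compact support of `φ` the term `θ u · ∇φ` is a product of two `L²` functions.
Integrability of each weak form is needed before two of them can be subtracted. -/
lemma integrable_weakForm {T : ℝ} (hφ : ContDiff ℝ 1 φ) (hφc : HasCompactSupport φ)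
    {θ : ℝ → Space n → ℝ} {u : ℝ → Space n → Space n}
    (hθ : ∀ K : Set (ℝ × Space n), IsCompact K →
      MemLp (Function.uncurry θ) 2 ((slab n T).restrict K))
    (hu : ∀ K : Set (ℝ × Space n), IsCompact K →
      MemLp (Function.uncurry u) 2 ((slab n T).restrict K)) :
    Integrable (fun z => θ z.1 z.2 * (deriv (fun s => φ (s, z.2)) z.1
      + inner ℝ (u z.1 z.2) (gradient (fun y => φ (z.1, y)) z.2))) (slab n T) := by
  have c1 := continuous_deriv_fst hφ
  have c2 := continuous_gradient_snd hφ
  have hz1 : ∀ z ∉ tsupport φ, deriv (fun s => φ (s, z.2)) z.1 = 0 := fun z hz => by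
    rw [deriv_fst_eq hφ, fderiv_eq_zero_of_notMem_tsupport hz]; rfl
  have hz2 : ∀ z ∉ tsupport φ, gradient (fun y => φ (z.1, y)) z.2 = 0 := fun z hz => by
    rw [gradient_snd_eq hφ, fderiv_eq_zero_of_notMem_tsupport hz, ContinuousLinearMap.zero_comp,
      map_zero]
  obtain ⟨B1, hB1⟩ := c1.bounded_above_of_compact_support (HasCompactSupport.intro hφc hz1)
  obtain ⟨B2, hB2⟩ := c2.bounded_above_of_compact_support (HasCompactSupport.intro hφc hz2)
  refine IntegrableOn.integrable_of_forall_notMem_eq_zero (s := tsupport φ) ?_ fun z hz => by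
    rw [hz1 z hz, hz2 z hz, inner_zero_right, add_zero, mul_zero]
  have : IsFiniteMeasure ((slab n T).restrict (tsupport φ)) := by
    have : IsFiniteMeasureOnCompacts (slab n T) := by unfold slab; infer_instance
    exact ⟨by rw [Measure.restrict_apply_univ]; exact hφc.isCompact.measure_lt_top⟩
  have h1 := hθ _ hφc.isCompact
  have h2 := hu _ hφc.isCompact
  have i1 : IntegrableOn (fun z => θ z.1 z.2 * deriv (fun s => φ (s, z.2)) z.1) (tsupport φ)
      (slab n T) :=
    (h1.integrable (by norm_num)).mul_bdd c1.aestronglyMeasurable (ae_of_all _ hB1)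
  have h3 : MemLp (fun z : ℝ × Space n => (inner ℝ (u z.1 z.2)
      (gradient (fun y => φ (z.1, y)) z.2) : ℝ)) 2 ((slab n T).restrict (tsupport φ)) := by
    refine h2.of_le_mul (c := B2) (h2.1.inner c2.aestronglyMeasurable) (ae_of_all _ fun z => ?_)
    refine (norm_inner_le_norm _ _).trans ?_
    rw [mul_comm]
    exact mul_le_mul_of_nonneg_right (hB2 z) (norm_nonneg _)
  have i2 : IntegrableOn (fun z => θ z.1 z.2 * (inner ℝ (u z.1 z.2)
      (gradient (fun y => φ (z.1, y)) z.2) : ℝ)) (tsupport φ) (slab n T) :=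
    MemLp.integrable_mul h1 h3
  refine (i1.add i2).congr (ae_of_all _ fun z => ?_)
  simp only [Pi.add_apply]
  ring

end TestFunctions

/-- The terms with `θ₀` cancel, which gives the difference zero initial datum. -/
theorem IsWeakSolution.solvesContinuity_sub {m : Space n → EuclideanSpace ℂ (Fin n)} {T : ℝ}
    {θ₀ : Space n → ℝ} {θ₁ θ₂ : ℝ → Space n → ℝ} {u₁ u₂ : ℝ → Space n → Space n}
    (h₁ : IsWeakSolution m T θ₀ θ₁ u₁) (h₂ : IsWeakSolution m T θ₀ θ₂ u₂)
    {w : ℝ × Space n → ℝ} {F : ℝ × Space n → Space n}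
    (hw : ∀ᵐ z ∂(slab n T), w z = θ₁ z.1 z.2 - θ₂ z.1 z.2)
    (hF : ∀ᵐ z ∂(slab n T), F z = θ₁ z.1 z.2 • u₁ z.1 z.2 - θ₂ z.1 z.2 • u₂ z.1 z.2) :
    SolvesContinuity T w F := by
  intro φ hφ hφc hφT
  have hφ1 : ContDiff ℝ 1 φ := hφ.of_le (by simp)
  have e1 := h₁.equation φ hφ hφc hφT
  have e2 := h₂.equation φ hφ hφc hφT
  have i1 := integrable_weakForm hφ1 hφc h₁.scalar_L2loc h₁.velocity_L2loc
  have i2 := integrable_weakForm hφ1 hφc h₂.scalar_L2loc h₂.velocity_L2loc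
  have e3 := integral_sub i1 i2
  refine Eq.trans (integral_congr_ae ?_) (e3.trans ?_)
  · filter_upwards [hw, hF] with z h3 h4
    rw [h3, h4, inner_sub_left, real_inner_smul_left, real_inner_smul_left]
    ring
  · linarith

end

section

variable {n : ℕ}

/-! ### Uniqueness -/

lemma lintegral_enorm_smul_le {f : Space n → ℝ} {v : Space n → Space n}
    (hf : AEStronglyMeasurable f volume) (hv : AEStronglyMeasurable v volume) {a b : ℝ≥0∞}
    (ha : ∫⁻ x, ‖f x‖ₑ ^ 2 ≤ a) (hb : ∫⁻ x, ‖v x‖ₑ ^ 2 ≤ b) :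
    ∫⁻ x, ‖f x • v x‖ₑ ≤ 1 + a * b := by
  simp_rw [enorm_smul]
  exact (le_one_add_sq _).trans (add_le_add_right
    ((lintegral_mul_sq_le hf.enorm hv.enorm).trans (mul_le_mul' ha hb)) _)

lemma IsMultiplierImage.memLp_two {m : Space n → EuclideanSpace ℂ (Fin n)} {f : Space n → ℝ}
    {v : Space n → Space n} {c M : ℝ}
    (hc : ∀ (f : Space n → ℝ) (v : Space n → Space n), IsMultiplierImage m f v →
      ∫⁻ x, ‖v x‖ₑ ^ 2 ≤ ENNReal.ofReal (c ^ 2) * ∫⁻ x, ‖f x‖ₑ ^ 2)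
    (h : IsMultiplierImage m f v) (hv : AEStronglyMeasurable v volume)
    (hf : ∫⁻ x, ‖f x‖ₑ ^ 2 ≤ ENNReal.ofReal M) :
    MemLp v 2 volume ∧ ∫⁻ x, ‖v x‖ₑ ^ 2 ≤ ENNReal.ofReal (c ^ 2 * M) := by
  have h1 : ∫⁻ x, ‖v x‖ₑ ^ 2 ≤ ENNReal.ofReal (c ^ 2 * M) := by
    rw [ENNReal.ofReal_mul (sq_nonneg c)]
    exact (hc f v h).trans (mul_le_mul_right hf _)
  exact ⟨(memLp_two_iff hv).2 (h1.trans_lt ENNReal.ofReal_lt_top), h1⟩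

/-- The limit of the energy identity: the energy of a solution of the continuity equation is
controlled by the limiting flux. -/
theorem SolvesContinuity.lintegral_sq_le {T : ℝ} {w : ℝ × Space n → ℝ} {F : ℝ × Space n → Space n}
    (hsol : SolvesContinuity T w F) (hT : 0 < T)
    (hw : StronglyMeasurable w) (hF : StronglyMeasurable F) {M M' : ℝ≥0∞} (hM : M ≠ ∞)
    (hM' : M' ≠ ∞) (hwM : ∀ᵐ t ∂(volume.restrict (Ioo 0 T)), ∫⁻ x, ‖w (t, x)‖ₑ ^ 2 ≤ M)
    (hFM : ∀ᵐ t ∂(volume.restrict (Ioo 0 T)), ∫⁻ x, ‖F (t, x)‖ₑ ≤ M') {J B : ℝ → ℝ}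
    (hB : IntegrableOn B (Ioo 0 T))
    (hJB : ∀ k, ∀ᵐ t ∂(volume.restrict (Ioo 0 T)), ‖∫ x, (inner ℝ (F (t, x))
      (gradient (mollify k (mollify k fun x => w (t, x))) x) : ℝ)‖ ≤ B t)
    (hJ : ∀ᵐ t ∂(volume.restrict (Ioo 0 T)), Tendsto (fun k => ∫ x, (inner ℝ (F (t, x))
      (gradient (mollify k (mollify k fun x => w (t, x))) x) : ℝ)) atTop (𝓝 (J t))) :
    IntegrableOn J (Ioo 0 T) ∧ ∀ᵐ t ∂(volume.restrict (Ioo 0 T)),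
      ∫⁻ x, ‖w (t, x)‖ₑ ^ 2 ≤ ENNReal.ofReal (2 * ∫ s in (0)..t, J s) := by
  have hJkm := aestronglyMeasurable_integral_inner_gradient hw hF hM hM' hwM hFM
  have hJm : AEStronglyMeasurable J (volume.restrict (Ioo 0 T)) :=
    aestronglyMeasurable_of_tendsto_ae atTop hJkm hJ
  refine ⟨Integrable.mono' hB hJm ?_, ?_⟩
  · filter_upwards [hJ, ae_all_iff.2 hJB] with t h1 h2
    exact le_of_tendsto' h1.norm h2
  filter_upwards [ae_all_iff.2 fun k => hsol.energy hT hw hF hM hM' hwM hFM k, hwM,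
    ae_restrict_mem measurableSet_Ioo] with t h1 h2 htT
  have hwt : AEStronglyMeasurable (fun x => w (t, x)) volume :=
    (hw.comp_measurable measurable_prodMk_left).aestronglyMeasurable
  have hl : LocallyIntegrable (fun x => w (t, x)) volume :=
    ((memLp_two_iff hwt).2 (h2.trans_lt hM.lt_top)).locallyIntegrable (by norm_num)
  have hsub : Ioc 0 t ⊆ Ioo 0 T := fun s hs => ⟨hs.1, hs.2.trans_lt htT.2⟩
  -- Dominated convergence in time handles the right side; Fatou in space, applied below, handles
  -- the left.
  have hlim : Tendsto (fun k => ∫ s in (0)..t, ∫ x, (inner ℝ (F (s, x))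
      (gradient (mollify k (mollify k fun x => w (s, x))) x) : ℝ)) atTop
      (𝓝 (∫ s in (0)..t, J s)) := by
    simp_rw [intervalIntegral.integral_of_le htT.1.le]
    exact tendsto_integral_of_dominated_convergence B
      (fun k => (hJkm k).mono_measure (Measure.restrict_mono hsub le_rfl)) (hB.mono_set hsub)
      (fun k => ae_restrict_of_ae_restrict_of_subset hsub (hJB k))
      (ae_restrict_of_ae_restrict_of_subset hsub hJ)
  have hlim2 := ENNReal.tendsto_ofReal (hlim.const_mul 2)
  calc ∫⁻ x, ‖w (t, x)‖ₑ ^ 2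
      = ∫⁻ x, liminf (fun k => ‖mollify k (fun x => w (t, x)) x‖ₑ ^ 2) atTop := by
        refine lintegral_congr_ae ?_
        filter_upwards [ae_tendsto_mollify hl] with x hx
        exact (Tendsto.liminf_eq
          ((ENNReal.continuous_pow 2).continuousAt.tendsto.comp hx.enorm)).symm
    _ ≤ liminf (fun k => ∫⁻ x, ‖mollify k (fun x => w (t, x)) x‖ₑ ^ 2) atTop :=
        lintegral_liminf_le fun k =>
          ((contDiff_mollify k hl).continuous.enorm.measurable.pow_const 2)
    _ = _ := by
        simp_rw [h1]
        exact hlim2.liminf_eq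

theorem uniqueness {m : Space n → EuclideanSpace ℂ (Fin n)} (hm : IsOrderZeroSymbol m) {T : ℝ}
    (hT : 0 < T) {p q : ℝ≥0∞} {θ₀ : Space n → ℝ} {θ₁ θ₂ : ℝ → Space n → ℝ}
    {u₁ u₂ : ℝ → Space n → Space n} (hsol₁ : IsWeakSolution m T θ₀ θ₁ u₁)
    (hsol₂ : IsWeakSolution m T θ₀ θ₂ u₂) (hclass₁ : InUniquenessClass T q p θ₁)
    (hclass₂ : InUniquenessClass T q p θ₂) :
    Function.uncurry θ₁ =ᵐ[slab n T] Function.uncurry θ₂ ∧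
      Function.uncurry u₁ =ᵐ[slab n T] Function.uncurry u₂ := by
  obtain ⟨H₁, A₁, M₁, hM₁, hA₁, hAi₁, hr₁⟩ := hclass₁.exists_regularScalar
  obtain ⟨H₂, A₂, M₂, hM₂, hA₂, hAi₂, hr₂⟩ := hclass₂.exists_regularScalar
  obtain ⟨c, hc, hmul⟩ := hm.exists_lintegral_sq_le
  obtain ⟨K, hK, hflux⟩ := exists_flux_bound n
  set A : ℝ → ℝ := fun t => A₁ t + A₂ t with hAdef
  set M : ℝ := M₁ + M₂ with hMdef
  have hA : ∀ t, 0 < A t := fun t => add_pos (hA₁ t) (hA₂ t)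
  have hM : 0 ≤ M := add_nonneg hM₁ hM₂
  have hAi : IntegrableOn A (Ioo 0 T) := hAi₁.add hAi₂
  have hr₁' : ∀ᵐ t ∂(volume.restrict (Ioo 0 T)),
      RegularScalar (θ₁ t) (H₁ t) (A t) (ENNReal.ofReal M) := by
    filter_upwards [hr₁] with t h
    exact h.mono (le_add_of_nonneg_right (hA₂ t).le)
      (ENNReal.ofReal_le_ofReal (le_add_of_nonneg_right hM₂))
  have hr₂' : ∀ᵐ t ∂(volume.restrict (Ioo 0 T)),
      RegularScalar (θ₂ t) (H₂ t) (A t) (ENNReal.ofReal M) := by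
    filter_upwards [hr₂] with t h
    exact h.mono (le_add_of_nonneg_left (hA₁ t).le)
      (ENNReal.ofReal_le_ofReal (le_add_of_nonneg_left hM₁))
  have hθm : AEStronglyMeasurable (fun z : ℝ × Space n => θ₁ z.1 z.2 - θ₂ z.1 z.2) (slab n T) :=
    hsol₁.aesm_scalar.sub hsol₂.aesm_scalar
  have hFm : AEStronglyMeasurable (fun z : ℝ × Space n =>
      θ₁ z.1 z.2 • u₁ z.1 z.2 - θ₂ z.1 z.2 • u₂ z.1 z.2) (slab n T) :=
    (hsol₁.aesm_scalar.smul hsol₁.aesm_velocity).sub (hsol₂.aesm_scalar.smul hsol₂.aesm_velocity)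
  have hum : AEStronglyMeasurable (fun z : ℝ × Space n => u₁ z.1 z.2 - u₂ z.1 z.2) (slab n T) :=
    hsol₁.aesm_velocity.sub hsol₂.aesm_velocity
  -- Jointly measurable representatives are needed for the energy identity and for passing between
  -- slices and space-time.
  obtain ⟨w, hw, hwe⟩ := hθm
  obtain ⟨F, hF, hFe⟩ := hFm
  obtain ⟨d, hd, hde⟩ := hum
  have hwt : ∀ᵐ t ∂(volume.restrict (Ioo 0 T)),
      (fun x => θ₁ t x - θ₂ t x) =ᵐ[volume] fun x => w (t, x) := Measure.ae_ae_of_ae_prod hwe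
  have hFt : ∀ᵐ t ∂(volume.restrict (Ioo 0 T)),
      (fun x => θ₁ t x • u₁ t x - θ₂ t x • u₂ t x) =ᵐ[volume] fun x => F (t, x) :=
    Measure.ae_ae_of_ae_prod hFe
  have hdt : ∀ᵐ t ∂(volume.restrict (Ioo 0 T)),
      (fun x => u₁ t x - u₂ t x) =ᵐ[volume] fun x => d (t, x) := Measure.ae_ae_of_ae_prod hde
  have hcont : SolvesContinuity T w F :=
    hsol₁.solvesContinuity_sub hsol₂ (hwe.mono fun _ h => h.symm) (hFe.mono fun _ h => h.symm)
  have hwM : ∀ᵐ t ∂(volume.restrict (Ioo 0 T)),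
      ∫⁻ x, ‖w (t, x)‖ₑ ^ 2 ≤ 4 * ENNReal.ofReal M := by
    filter_upwards [hr₁', hr₂', hwt] with t h1 h2 h3
    refine le_of_eq_of_le (lintegral_congr_ae ?_) (h1.sub (hA t).le h2).bound
    filter_upwards [h3] with x hx
    rw [hx]
  have hFM : ∀ᵐ t ∂(volume.restrict (Ioo 0 T)), ∫⁻ x, ‖F (t, x)‖ₑ ≤
      2 * (1 + ENNReal.ofReal M * ENNReal.ofReal (c ^ 2 * M)) := by
    filter_upwards [hr₁', hr₂', hFt, hsol₁.velocity_eq, hsol₂.velocity_eq, hsol₁.div_free,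
      hsol₂.div_free] with t h1 h2 h3 h4 h5 h6 h7
    have a1 := h1.weak.1.aestronglyMeasurable
    have a2 := h2.weak.1.aestronglyMeasurable
    have b1 := h6.1.aestronglyMeasurable
    have b2 := h7.1.aestronglyMeasurable
    calc ∫⁻ x, ‖F (t, x)‖ₑ ≤ ∫⁻ x, (‖θ₁ t x • u₁ t x‖ₑ + ‖θ₂ t x • u₂ t x‖ₑ) := by
          refine lintegral_mono_ae ?_
          filter_upwards [h3] with x hx
          rw [← hx]
          exact enorm_sub_le
      _ = (∫⁻ x, ‖θ₁ t x • u₁ t x‖ₑ) + ∫⁻ x, ‖θ₂ t x • u₂ t x‖ₑ :=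
          lintegral_add_left' (a1.smul b1).enorm _
      _ ≤ _ := by
          rw [two_mul]
          exact add_le_add
            (lintegral_enorm_smul_le a1 b1 h1.bound (h4.memLp_two hmul b1 h1.bound).2)
            (lintegral_enorm_smul_le a2 b2 h2.bound (h5.memLp_two hmul b2 h2.bound).2)
  have hpt : ∀ᵐ t ∂(volume.restrict (Ioo 0 T)), ∃ J : ℝ,
      Tendsto (fun k => ∫ x, (inner ℝ (F (t, x))
        (gradient (mollify k (mollify k fun x => w (t, x))) x) : ℝ)) atTop (𝓝 J) ∧
      (∀ k, |∫ x, (inner ℝ (F (t, x))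
        (gradient (mollify k (mollify k fun x => w (t, x))) x) : ℝ)| ≤ K * A t * c * M) ∧
      ∀ τ L : ℝ, 1 ≤ L → Real.exp (-L) ≤ τ →
        |J| ≤ K * A t * c * (L * (∫⁻ x, ‖w (t, x)‖ₑ ^ 2).toReal + 2 * τ * M) := by
    filter_upwards [hr₁', hr₂', hwt, hFt, hsol₁.velocity_eq, hsol₂.velocity_eq, hsol₁.div_free,
      hsol₂.div_free] with t h1 h2 h3 h4 h5 h6 h7 h8
    have b1 := h5.memLp_two hmul h7.1.aestronglyMeasurable h1.bound
    have b2 := h6.memLp_two hmul h8.1.aestronglyMeasurable h2.bound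
    have h := hflux (θ₁ t) (θ₂ t) (H₁ t) (H₂ t) (u₁ t) (u₂ t) (A t) M c (hA t) hM hc h1 h2 h7 h8
      b1.1 b2.1 b1.2 b2.2 (hmul _ _ (h5.sub h6))
    have hwd := h1.weak.sub h2.weak
    have e1 : ∀ k, ∫ x, (inner ℝ (F (t, x))
        (gradient (mollify k (mollify k fun x => w (t, x))) x) : ℝ)
        = ∫ x, inner ℝ (θ₁ t x • u₁ t x - θ₂ t x • u₂ t x)
          (mollify k (mollify k fun y => H₁ t y - H₂ t y) x) := fun k => by
      rw [← mollify_congr_ae k h3, gradient_mollify k (hwd.mollify k)]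
      refine integral_congr_ae ?_
      filter_upwards [h4] with x hx
      rw [hx]
    have e2 : ∫⁻ x, ‖w (t, x)‖ₑ ^ 2 = ∫⁻ x, ‖θ₁ t x - θ₂ t x‖ₑ ^ 2 := by
      refine lintegral_congr_ae ?_
      filter_upwards [h3] with x hx
      rw [hx]
    simp_rw [e1, e2]
    exact h
  have hne : (ae (volume.restrict (Ioo 0 T))).NeBot := by
    rw [ae_neBot, Ne, Measure.restrict_eq_zero, Real.volume_Ioo]
    simpa using hT
  -- The limits are chosen time by time; measurability of `J` follows later because it is an almost
  -- everywhere limit of measurable fluxes.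
  obtain ⟨J, hJ⟩ := hpt.choice
  have hMt : 4 * ENNReal.ofReal M ≠ ∞ := by finiteness
  obtain ⟨hJi, hen⟩ := hcont.lintegral_sq_le hT hw hF hMt (by finiteness) hwM hFM
    (B := fun t => K * A t * c * M) (J := J) (((hAi.const_mul K).mul_const c).mul_const M)
    (fun k => hJ.mono fun t h => h.2.1 k) (hJ.mono fun t h => h.1)
  let y : ℝ → ℝ := fun t => (∫⁻ x, ‖w (t, x)‖ₑ ^ 2).toReal
  have hym : Measurable y :=
    (Measurable.lintegral_prod_right' (hw.enorm.pow_const 2)).ennreal_toReal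
  have hyD : ∀ᵐ t ∂(volume.restrict (Ioo 0 T)), y t ≤ (4 * ENNReal.ofReal M).toReal :=
    hwM.mono fun t h => ENNReal.toReal_mono hMt h
  have hy : ∀ᵐ t ∂(volume.restrict (Ioo 0 T)), y t = 0 := by
    refine ae_eq_zero_of_log_gronwall (C := 2 * K * c * (1 + 2 * M)) hT (by positivity)
      (fun s => (hA s).le) hAi hym.aestronglyMeasurable (fun s => ENNReal.toReal_nonneg) hyD
      fun k => ?_
    filter_upwards [hen, ae_restrict_mem measurableSet_Ioo] with t h1 htT
    have hsub : Ioc 0 t ⊆ Ioo 0 T := fun s hs => ⟨hs.1, hs.2.trans_lt htT.2⟩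
    have hk : (0 : ℝ) ≤ k := k.cast_nonneg
    have hri : IntegrableOn (fun s => 2 * K * c * (1 + 2 * M) * A s
        * ((1 + k) * y s + Real.exp (-k))) (Ioo 0 T) := by
      refine Integrable.mul_bdd (c := (1 + k) * (4 * ENNReal.ofReal M).toReal + Real.exp (-k))
        (hAi.const_mul _) (by fun_prop) ?_
      filter_upwards [hyD] with s hs
      have : 0 ≤ y s := ENNReal.toReal_nonneg
      rw [Real.norm_of_nonneg (by positivity)]
      gcongr
    have hle : 2 * ∫ s in (0)..t, J s ≤ ∫ s in (0)..t, 2 * K * c * (1 + 2 * M) * A s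
        * ((1 + k) * y s + Real.exp (-k)) := by
      rw [← intervalIntegral.integral_const_mul, intervalIntegral.integral_of_le htT.1.le,
        intervalIntegral.integral_of_le htT.1.le]
      refine integral_mono_ae (IntegrableOn.mono_set (hJi.const_mul 2) hsub) (hri.mono_set hsub) ?_
      filter_upwards [ae_restrict_of_ae_restrict_of_subset hsub hJ] with s hs
      -- Here `L = 1 + k` and `τ = e^{-k}`, admissible since `e^{-(1+k)} ≤ e^{-k}`; the factor `1 +
      -- 2M` absorbs the energy bound in the remainder.
      have h2 := (le_abs_self _).trans (hs.2.2 (Real.exp (-k)) (1 + k) (by linarith)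
        (Real.exp_le_exp.2 (by linarith)))
      have hy0 : 0 ≤ y s := ENNReal.toReal_nonneg
      have he := (Real.exp_pos (-(k : ℝ))).le
      have hAs := (hA s).le
      have h3 : (1 + k) * y s + 2 * Real.exp (-k) * M
          ≤ (1 + 2 * M) * ((1 + k) * y s + Real.exp (-k)) := by
        have : 0 ≤ 2 * M * ((1 + k) * y s) := by positivity
        linarith
      calc 2 * J s ≤ 2 * (K * A s * c * ((1 + k) * y s + 2 * Real.exp (-k) * M)) := by linarith
        _ ≤ 2 * (K * A s * c * ((1 + 2 * M) * ((1 + k) * y s + Real.exp (-k)))) := by gcongr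
        _ = _ := by ring
    refine ENNReal.toReal_le_of_le_ofReal ?_ (h1.trans (ENNReal.ofReal_le_ofReal hle))
    refine intervalIntegral.integral_nonneg htT.1.le fun s _ => ?_
    have hy0 : 0 ≤ y s := ENNReal.toReal_nonneg
    have hAs := (hA s).le
    positivity
  have hw0 : ∀ᵐ t ∂(volume.restrict (Ioo 0 T)), ∫⁻ x, ‖w (t, x)‖ₑ ^ 2 = 0 := by
    filter_upwards [hy, hwM] with t h1 h2
    exact ((ENNReal.toReal_eq_zero_iff _).1 h1).resolve_right (ne_top_of_le_ne_top hMt h2)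
  have hae : ∀ {E : Type} [NormedAddCommGroup E] {f : ℝ × Space n → E}, StronglyMeasurable f →
      (∀ᵐ t ∂(volume.restrict (Ioo 0 T)), ∫⁻ x, ‖f (t, x)‖ₑ ^ 2 = 0) → f =ᵐ[slab n T] 0 := by
    intro E _ f hf h
    have hms : MeasurableSet {z | f z = 0} := hf.measurableSet_eq_fun stronglyMeasurable_zero
    refine (Measure.ae_prod_iff_ae_ae hms).2 ?_
    filter_upwards [h] with t ht
    have hmt : Measurable fun x => ‖f (t, x)‖ₑ ^ 2 :=
      (hf.comp_measurable measurable_prodMk_left).enorm.pow_const 2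
    filter_upwards [(lintegral_eq_zero_iff hmt).1 ht] with x hx
    simpa using hx
  -- The velocities agree because their difference is the multiplier image of `θ₁ - θ₂`, which now
  -- vanishes in `L²`.
  have hd0 : ∀ᵐ t ∂(volume.restrict (Ioo 0 T)), ∫⁻ x, ‖d (t, x)‖ₑ ^ 2 = 0 := by
    filter_upwards [hw0, hwt, hdt, hsol₁.velocity_eq, hsol₂.velocity_eq] with t h1 h2 h3 h4 h5
    have h6 := hmul _ _ (h4.sub h5)
    have e1 : ∫⁻ x, ‖θ₁ t x - θ₂ t x‖ₑ ^ 2 = 0 := by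
      rw [← h1]
      refine lintegral_congr_ae ?_
      filter_upwards [h2] with x hx
      rw [hx]
    rw [e1, mul_zero] at h6
    rw [← le_zero_iff]
    refine le_of_eq_of_le (lintegral_congr_ae ?_) h6
    filter_upwards [h3] with x hx
    rw [hx]
  constructor
  · filter_upwards [hwe, hae hw hw0] with z h1 h2
    rw [h2, Pi.zero_apply] at h1
    exact sub_eq_zero.1 h1
  · filter_upwards [hde, hae hd hd0] with z h1 h2
    rw [h2, Pi.zero_apply] at h1
    exact sub_eq_zero.1 h1

end

end ActiveScalar

end

theorem mainTheorem3 (n : ℕ) (m : ActiveScalar.Space n → EuclideanSpace ℂ (Fin n))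
    (hm : ActiveScalar.IsOrderZeroSymbol m) (T : ℝ) (hT : 0 < T)
    (p q : ℝ≥0∞) (hp : 2 < p) (hp' : p < ∞) (hq : 2 < q) (hq' : q < ∞)
    (θ₀ : ActiveScalar.Space n → ℝ) (hθ₀ : MemLp θ₀ 2 volume)
    (θ₁ θ₂ : ℝ → ActiveScalar.Space n → ℝ)
    (u₁ u₂ : ℝ → ActiveScalar.Space n → ActiveScalar.Space n)
    (hsol₁ : ActiveScalar.IsWeakSolution m T θ₀ θ₁ u₁)
    (hsol₂ : ActiveScalar.IsWeakSolution m T θ₀ θ₂ u₂)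
    (hclass₁ : ActiveScalar.InUniquenessClass T q p θ₁)
    (hclass₂ : ActiveScalar.InUniquenessClass T q p θ₂) :
    Function.uncurry θ₁ =ᵐ[ActiveScalar.slab n T] Function.uncurry θ₂ ∧
      Function.uncurry u₁ =ᵐ[ActiveScalar.slab n T] Function.uncurry u₂ :=
  ActiveScalar.uniqueness hm hT hsol₁ hsol₂ hclass₁ hclass₂
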